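/- Setting. Let $A$ be a $C^*$-algebra with multiplier algebra $M(A)$, and let $(T,\mu)$ be a measure space (for instance a locally compact metric space with a Radon measure). Every $\omega\in A^*$ is extended to $M(A)$ by strict continuity. A field $(m_t)_{t\in T}$ in $M(A)$ is *weak\* measurable* if $t\mapsto\omega(m_t)$ is $\mu$-measurable for every $\omega\in A^*$; it is *integrable with integral* $\int_T m_t\,d\mu(t)=J\in M(A)$ if, for every $\omega\in A^*$, $t\mapsto\omega(m_t)$ is integrable and $\omega(J)=\int_T\omega(m_t)\,d\mu(t)$. A *unital column field* is a weak\* measurable field $(a_t)$ in $M(A)$ with $\int_T a_t^*a_t\,d\mu(t)=\mathbf 1$. For pairwise commuting self-adjoint $z_1,\dots,z_n\in M(A)$ and a real function $f$ continuous on $\prod_i\mathrm{sp}(z_i)$, $f(z_1,\dots,z_n)\in M(A)$ is given by the joint continuous functional calculus (spectra are taken in $M(A)$). For a positive functional $\varphi$ on $A$, its *centralizer* is $\{y\in A:\varphi(xy)=\varphi(yx)\ \forall x\in A\}$. Let $K(A)$ be the minimal dense two-sided ideal of $A$. If $\varphi:A_+\to[0,\infty]$ is additive, positively homogeneous, norm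 lower semicontinuous, and finite on $K(A)_+$ (an *unbounded positive functional*), then $\varphi$ extends linearly to $K(A)$, its *centralizer* is $\{y\in A:\varphi(xy)=\varphi(yx)\ \forall x\in K(A)\}$, and $\varphi(m)=\sup\{\varphi(x):x\in A_+,\ x\le m\}$ for $m\in M(A)_+$. Corollary 12. Let $f$ be a real, continuous, convex function on $I_1\times\cdots\times I_n\subset\mathbb R^n$, where $I_1,\dots,I_n$ are intervals, and let $A_1,\dots,A_n$ be mutually commuting $C^*$-subalgebras of $A$ (that is, $bc=cb$ for $b\in A_i$, $c\in A_j$, $i\ne j$). Let $(x_{it})_{t\in T}$, $1\le i\le n$, be bounded weak\* measurable fields of self-adjoint elements $x_{it}\in A_i$ with $\mathrm{sp}(x_{it})\subset I_i$, and put $\underline x_t=(x_{1t},\dots,x_{nt})$. Let $(a_t)_{t\in T}$ be a unital column field in $M(A)$. Assume that the integrals $y_i=\int_T a_t^*x_{it}a_t\,d\mu(t)$ exist as elements of $A$ and commute pairwise, and put $\underline y=(y_1,\dots,y_n)$. Then: 1. $\mathrm{sp}(y_i)\subset I_i$ for all $i$, so that $f(\underline y)=f\left(\int_T a_t^*\underline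 x_ta_t\,d\mu(t)\right)$ is defined. 2. If $A$ is separable and $\sup_t\|f(\underline x_t)\|<\infty$ (which is automatic if all $I_i$ are compact), then $\int_T a_t^*f(\underline x_t)a_t\,d\mu(t)$ exists in $M(A)$. 3. Whenever the integral $\int_T a_t^*f(\underline x_t)a_t\,d\mu(t)$ exists in $M(A)$, the inequality $$\varphi\left(f\left(\int_T a_t^*\underline x_ta_t\,d\mu(t)\right)\right)\le\varphi\left(\int_T a_t^*f(\underline x_t)a_t\,d\mu(t)\right)$$ holds for every (bounded) positive functional $\varphi$ on $A$ whose centralizer contains $y_1,\dots,y_n$. If $f\ge 0$ on $I_1\times\cdots\times I_n$, it also holds, with values in $[0,\infty]$, for every unbounded positive functional $\varphi$ whose centralizer contains $y_1,\dots,y_n$. -/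

import Mathlib

open scoped MultiplierAlgebra ComplexOrder ENNReal NNReal
open MeasureTheory Filter Topology

noncomputable section

namespace JensenCStar

section JointFunctionalCalculus

variable {M : Type*} [Ring M] [StarRing M] [Algebra ℂ M] {n : ℕ}

/-- The compact box `∏ i, sp (x i)` in `ℝⁿ`; it contains the joint spectrum of the tuple `x`. -/
def spectralBox (x : Fin n → M) : Set (Fin n → ℝ) :=
  Set.univ.pi fun i => spectrum ℝ (x i)

/-- The `i`-th coordinate function on the spectral box, as a complex function. -/
def coordFun (x : Fin n → M) (i : Fin n) : C(spectralBox x, ℂ) where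
  toFun p := ((p : Fin n → ℝ) i : ℂ)
  continuous_toFun :=
    Complex.continuous_ofReal.comp ((continuous_apply i).comp continuous_subtype_val)

/-- A real function that is continuous on the spectral box, as a complex continuous function
on that box. -/
def restrictFun (x : Fin n → M) (f : (Fin n → ℝ) → ℝ) (hf : ContinuousOn f (spectralBox x)) :
    C(spectralBox x, ℂ) where
  toFun p := (f p : ℂ)
  continuous_toFun := Complex.continuous_ofReal.comp hf.domRestrict

open Classical in
/-- The element `f(x₁, …, xₙ)` for a commuting tuple `x` of self-adjoint elements of a unital
C⋆-algebra and a function `f` that is continuous on `∏ i, sp (x i)`. It is the value at `f` of the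
unital ⋆-homomorphism `C(∏ i, sp (x i)) → M` that sends the `i`-th coordinate function to `x i`;
this homomorphism exists (spectral theorem) and is unique (Stone-Weierstrass). -/
def jointCfc (x : Fin n → M) (f : (Fin n → ℝ) → ℝ) : M :=
  if h : (∃ Φ : C(spectralBox x, ℂ) →⋆ₐ[ℂ] M, ∀ i, Φ (coordFun x i) = x i) ∧
      ContinuousOn f (spectralBox x)
  then h.1.choose (restrictFun x f h.2)
  else 0

end JointFunctionalCalculus

/-- The minimal dense two-sided ideal `K(A)`: the intersection of all dense two-sided ideals. -/
def minimalDenseIdeal (A : Type*) [NonUnitalCStarAlgebra A] : Submodule ℂ A :=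
  sInf {J | (∀ x ∈ J, ∀ b : A, b * x ∈ J ∧ x * b ∈ J) ∧ Dense (J : Set A)}

variable {A : Type*} [NonUnitalCStarAlgebra A] [PartialOrder A] [StarOrderedRing A]

/-- The value at a multiplier `m` of the canonical (strictly continuous) extension to `M(A)` of a
bounded functional `ω` on `A`: the limit of `ω (m e)`, with `e` running through the canonical
approximate unit of `A`. -/
def extFunctional (ω : A → ℂ) (m : 𝓜(ℂ, A)) : ℂ :=
  limUnder (CStarAlgebra.approximateUnit A) fun e => ω (m.fst e)

/-- Weak⋆ measurability of a field of multipliers: `t ↦ ω (m t)` is `μ`-measurable for every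
`ω` in the dual of `A`. -/
def WeakStarMeasurable {T : Type*} [MeasurableSpace T] (μ : Measure T) (m : T → 𝓜(ℂ, A)) : Prop :=
  ∀ ω : A →L[ℂ] ℂ, AEMeasurable (fun t => extFunctional ω (m t)) μ

/-- The field `m` of multipliers is integrable and `J ∈ M(A)` is its integral, that is,
`ω J = ∫ ω (m t) dμ(t)` for every `ω` in the dual of `A`. -/
def HasWeakStarIntegral {T : Type*} [MeasurableSpace T] (μ : Measure T) (m : T → 𝓜(ℂ, A))
    (J : 𝓜(ℂ, A)) : Prop :=
  ∀ ω : A →L[ℂ] ℂ, Integrable (fun t => extFunctional ω (m t)) μ ∧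
    ∫ t, extFunctional ω (m t) ∂μ = extFunctional ω J

/-- Unital column fields: `(a t)` is weak⋆ measurable and `∫ (a t)⋆ (a t) dμ(t) = 1`. -/
def IsUnitalColumnField {T : Type*} [MeasurableSpace T] (μ : Measure T) (a : T → 𝓜(ℂ, A)) : Prop :=
  WeakStarMeasurable μ a ∧ HasWeakStarIntegral μ (fun t => star (a t) * a t) 1

/-- A (possibly unbounded) positive functional `φ : A₊ → [0, ∞]` that is lower semicontinuous on
`A₊` and finite on the minimal dense ideal. Values off `A₊` are irrelevant. -/
structure IsUnboundedFunctional (φ : A → ℝ≥0∞) : Prop where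
  map_add : ∀ x y : A, 0 ≤ x → 0 ≤ y → φ (x + y) = φ x + φ y
  map_smul : ∀ (c : ℝ≥0) (x : A), 0 ≤ x → φ (c • x) = c * φ x
  lsc : LowerSemicontinuousOn φ {x | 0 ≤ x}
  finite : ∀ x ∈ minimalDenseIdeal A, 0 ≤ x → φ x ≠ ∞

/-- The value of an unbounded positive functional `φ` at a positive multiplier `m`, namely
`sup {φ x | x ∈ A₊, x ≤ m}`; it equals `φ m` if `m` lies in `A`. -/
def extUnbounded (φ : A → ℝ≥0∞) (m : 𝓜(ℂ, A)) : ℝ≥0∞ :=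
  ⨆ (x : A) (_ : 0 ≤ x) (_ : ∃ z : 𝓜(ℂ, A), m - (x : 𝓜(ℂ, A)) = star z * z), φ x

/-- The centralizer of a bounded functional. -/
def InCentralizer (φ : A → ℂ) (y : A) : Prop :=
  ∀ x : A, φ (x * y) = φ (y * x)

/-- The centralizer of an unbounded positive functional `φ`: `φ (x y) = φ (y x)` for all
`x ∈ K(A)`, where `φ` stands for its linear extension `ψ` from `K(A)₊` to `K(A)` (which is
the linear span of `K(A)₊`, so that `ψ` is determined on `K(A)`). -/
def InUnboundedCentralizer (φ : A → ℝ≥0∞) (y : A) : Prop :=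
  ∃ ψ : A →ₗ[ℂ] ℂ,
    (∀ x ∈ minimalDenseIdeal A, 0 ≤ x → ψ x = ((φ x).toReal : ℂ)) ∧
      ∀ x ∈ minimalDenseIdeal A, ψ (x * y) = ψ (y * x)

end JensenCStar

end

/-!
Everything rests on duality with positive functionals. By the Hahn-Banach theorem they span the dual
of `A`, they extend strictly continuously to the multiplier algebra, and the extensions detect
positivity there (`multiplier_nonneg_of_forall_ext`). Weak⋆ integration is therefore monotone, and
integration against a unital column is in addition unital.

*Spectra.* Let `y = ∫ a⋆ x a` and let `λ` lie in the spectrum of `y`, outside the interval. Then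
`λ - x t` is invertible and, up to a common sign, positive. A state that is concentrated at `λ`
annihilates the integral of `a⋆ (λ - x) a`, hence almost every `a⋆ (λ - x) a`, hence almost every
`a⋆ a`, so that its restriction to `A` vanishes. As `y` belongs to `A`, this forces `λ = 0`, and
then `A` contains an invertible multiplier, which is absurd for a state that vanishes on `A`
(`spectrum_integral_subset`).

*The inequality.* A continuous convex function is the supremum of its affine minorants `l`, and
`l(y) = ∫ a⋆ l(x) a ≤ ∫ a⋆ f(x) a =: F`. The upper bounds `l(y) ≤ F` do not imply `f(y) ≤ F`, but
they do so under a functional `φ` that is centralized by `y`. Let `f ≥ 0`. Choose functions `c` on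
the joint spectrum, one for each of finitely many `l`, with sum at most `1`, such that
`(1 - δ) c f ≤ c l` and such that the sum is `1` where `f ≥ δ` (`exists_weights`). Compressing by
`√c(y)` gives `(1 - δ) √c f(y) √c ≤ √c F √c`. Summation over `l` undoes the compressions under `φ`,
since `φ(√c ⬝ √c)` is additive in `c` (`IsAdditiveAlong`), and `δ → 0` yields `φ(f(y)) ≤ φ(F)`
(`extUnbounded_realHom_le`).

The additivity is clear for polynomials in `y`. It passes to continuous functions because
`m ↦ φ(m x m⋆) ^ (1/2)` is a lower semicontinuous seminorm on the multiplier algebra for each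
positive `x` in the minimal dense ideal, hence continuous (`IsLinearExtension.continuous_fst`). The
values of `φ` on multipliers are suprema over elements of `A` below them, and comparing such suprema
uses that `φ` is a pointwise supremum of bounded positive functionals (`exists_positive_le`). A
bounded functional is a special unbounded one, and subtracting an affine minorant reduces it to
nonnegative `f` (`jensen_bounded`).

*Existence of the integral.* If `A` is separable, then weakly measurable functions are strongly
measurable by Pettis' theorem, so that `a` and `f(x)` are strictly measurable fields
(`strictlyMeasurable_jointCfc`). The column `a` lives on a union of sets `S k` of finite measure on
which it is bounded, and over these sets the integrals exist as Bochner integrals of the products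
with elements of `A`. They converge strictly: for `b ∈ A` the tails of `∫ b⋆ a⋆ a b` decrease weakly
to `0`, hence in norm by Dini's theorem (`tendsto_zero_of_antitone`), and they control the tails of
`∫ a⋆ f(x) a` (`exists_integral_conj_of_nonneg`).
-/

set_option linter.unusedSectionVars false

noncomputable section

namespace JensenCStar

/-! ### Order and norm in C⋆-algebras -/

section General

variable {M : Type*} [CStarAlgebra M] [PartialOrder M] [StarOrderedRing M]

/-- An injective ⋆-homomorphism of C⋆-algebras reflects positivity. -/
theorem nonneg_of_map_nonneg {A : Type*} [NonUnitalCStarAlgebra A] [PartialOrder A]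
    [StarOrderedRing A] (φ : A →⋆ₙₐ[ℂ] M) (hφ : Function.Injective φ) {a : A} (ha : 0 ≤ φ a) :
    0 ≤ a := by
  have hsa : IsSelfAdjoint a := by
    have h := (IsSelfAdjoint.of_nonneg ha).star_eq
    rw [← map_star] at h
    exact hφ h
  rw [← CFC.negPart_eq_zero_iff a]
  apply hφ
  have hc : Continuous φ := (NonUnitalStarAlgHom.isometry φ hφ).continuous
  rw [CFC.negPart_def, NonUnitalStarAlgHomClass.map_cfcₙ (S := ℂ) φ _ a, ← CFC.negPart_def,
    CFC.negPart_eq_zero_iff _ (.of_nonneg ha) |>.mpr ha, map_zero]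

theorem conj_nonneg {A : Type*} [NonUnitalRing A] [StarRing A] [PartialOrder A] [StarOrderedRing A]
    {a : A} (ha : 0 ≤ a) (u : A) : 0 ≤ u * a * star u :=
  star_right_conjugate_nonneg ha u

end General

/-! ### The multiplier algebra -/

section Multiplier

variable {A : Type*} [NonUnitalCStarAlgebra A]

/-- The multiplier algebra carries its unique C⋆-order, in which the positive elements are the
elements `star z * z`. -/
instance instPartialOrderMultiplier : PartialOrder 𝓜(ℂ, A) := CStarAlgebra.spectralOrder _

instance instStarOrderedRingMultiplier : StarOrderedRing 𝓜(ℂ, A) :=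
  CStarAlgebra.spectralOrderedRing _

theorem eq_of_forall_mul_left {x y : A} (h : ∀ d, d * x = d * y) : x = y := by
  have := h (star (x - y))
  rw [← sub_eq_zero, ← mul_sub, CStarRing.star_mul_self_eq_zero_iff, sub_eq_zero] at this
  exact this

theorem eq_of_forall_mul_right {x y : A} (h : ∀ d, x * d = y * d) : x = y := by
  have := h (star (x - y))
  rw [← sub_eq_zero, ← sub_mul, CStarRing.mul_star_self_eq_zero_iff, sub_eq_zero] at this
  exact this

theorem fst_mul (m : 𝓜(ℂ, A)) (b c : A) : m.fst (b * c) = m.fst b * c :=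
  eq_of_forall_mul_left fun d => by rw [← m.central, ← mul_assoc, ← mul_assoc, m.central]

theorem snd_mul (m : 𝓜(ℂ, A)) (b c : A) : m.snd (b * c) = b * m.snd c :=
  eq_of_forall_mul_right fun d => by rw [m.central, mul_assoc, mul_assoc, m.central]

theorem mul_coe (m : 𝓜(ℂ, A)) (b : A) : m * (b : 𝓜(ℂ, A)) = (m.fst b : A) := by
  ext c
  · simp [fst_mul]
  · simp [m.central]

theorem coe_mul (m : 𝓜(ℂ, A)) (b : A) : (b : 𝓜(ℂ, A)) * m = (m.snd b : A) := by
  ext c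
  · simp [m.central]
  · simp [snd_mul]

variable (A) in
/-- The inclusion of `A` in its multiplier algebra. -/
abbrev incl : A →⋆ₙₐ[ℂ] 𝓜(ℂ, A) := DoubleCentralizer.coeHom

theorem incl_injective : Function.Injective (incl A) := by
  intro a b h
  refine eq_of_forall_mul_right fun d => ?_
  have := congrArg (fun m : 𝓜(ℂ, A) => m.fst d) h
  simpa using this

theorem coe_inj {a b : A} : (a : 𝓜(ℂ, A)) = b ↔ a = b := incl_injective.eq_iff

@[simp] theorem norm_coe (a : A) : ‖(a : 𝓜(ℂ, A))‖ = ‖a‖ :=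
  NonUnitalStarAlgHom.norm_map (incl A) incl_injective a

@[simp] theorem coe_zero : ((0 : A) : 𝓜(ℂ, A)) = 0 := map_zero (incl A)
theorem coe_add (a b : A) : ((a + b : A) : 𝓜(ℂ, A)) = a + b := map_add (incl A) a b
theorem coe_sub (a b : A) : ((a - b : A) : 𝓜(ℂ, A)) = a - b := map_sub (incl A) a b
theorem coe_neg (a : A) : ((-a : A) : 𝓜(ℂ, A)) = -a := map_neg (incl A) a
theorem coe_mul_coe (a b : A) : ((a * b : A) : 𝓜(ℂ, A)) = a * b := map_mul (incl A) a b
theorem coe_star (a : A) : ((star a : A) : 𝓜(ℂ, A)) = star (a : 𝓜(ℂ, A)) := map_star (incl A) a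
theorem coe_smul (c : ℂ) (a : A) : ((c • a : A) : 𝓜(ℂ, A)) = c • (a : 𝓜(ℂ, A)) :=
  map_smul (incl A) c a

theorem isSelfAdjoint_coe {a : A} : IsSelfAdjoint (a : 𝓜(ℂ, A)) ↔ IsSelfAdjoint a := by
  rw [IsSelfAdjoint, ← coe_star, coe_inj, IsSelfAdjoint]

theorem norm_fst_apply_le (m : 𝓜(ℂ, A)) (b : A) : ‖m.fst b‖ ≤ ‖m‖ * ‖b‖ := by
  simpa using m.fst.le_opNorm b

theorem multiplier_ext {m m' : 𝓜(ℂ, A)} (h : ∀ b, m.fst b = m'.fst b) : m = m' := by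
  rw [← sub_eq_zero, ← norm_eq_zero, ← DoubleCentralizer.norm_fst, norm_eq_zero]
  ext b
  simp [h]

variable [PartialOrder A] [StarOrderedRing A]

theorem coe_nonneg {a : A} : 0 ≤ (a : 𝓜(ℂ, A)) ↔ 0 ≤ a :=
  ⟨nonneg_of_map_nonneg (incl A) incl_injective, fun h => map_nonneg (incl A) h⟩

theorem coe_le_coe {a b : A} : (a : 𝓜(ℂ, A)) ≤ b ↔ a ≤ b := by
  rw [← sub_nonneg, ← coe_sub, coe_nonneg, sub_nonneg]

omit [PartialOrder A] [StarOrderedRing A] in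
theorem algebraMap_eq_smul (r : ℝ) : algebraMap ℝ 𝓜(ℂ, A) r = (r : ℂ) • 1 := by
  rw [Algebra.algebraMap_eq_smul_one]; rfl

/-- `u a u⋆` as an element of `A`, for `a ∈ A` and a multiplier `u`. -/
def sandwich (u : 𝓜(ℂ, A)) : A →L[ℂ] A := (star u).snd ∘L u.fst

omit [PartialOrder A] [StarOrderedRing A] in
theorem coe_sandwich (u : 𝓜(ℂ, A)) (a : A) :
    (sandwich u a : 𝓜(ℂ, A)) = u * (a : 𝓜(ℂ, A)) * star u := by
  rw [mul_coe, coe_mul]; rfl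

theorem sandwich_nonneg (u : 𝓜(ℂ, A)) {a : A} (ha : 0 ≤ a) : 0 ≤ sandwich u a := by
  rw [← coe_nonneg, coe_sandwich]
  exact conj_nonneg (coe_nonneg.2 ha) u

theorem sandwich_mono (u : 𝓜(ℂ, A)) {a b : A} (h : a ≤ b) : sandwich u a ≤ sandwich u b := by
  rw [← sub_nonneg, ← map_sub]
  exact sandwich_nonneg u (sub_nonneg.2 h)

/-- `b⋆ m b` as an element of `A`, for `b ∈ A` and a multiplier `m`. -/
def innerMul (b : A) (m : 𝓜(ℂ, A)) : A := star b * m.fst b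

omit [PartialOrder A] [StarOrderedRing A] in
theorem coe_innerMul (b : A) (m : 𝓜(ℂ, A)) :
    ((innerMul b m : A) : 𝓜(ℂ, A)) = star (b : 𝓜(ℂ, A)) * m * b := by
  rw [innerMul, coe_mul_coe, ← mul_coe, coe_star, mul_assoc]

/-- Positivity of a multiplier is tested on `A`. -/
theorem multiplier_nonneg_iff {m : 𝓜(ℂ, A)} : 0 ≤ m ↔ ∀ b : A, 0 ≤ innerMul b m := by
  constructor
  · intro h b
    rw [← coe_nonneg, coe_innerMul]
    exact star_left_conjugate_nonneg h _
  · intro h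
    have hzero : ∀ d : 𝓜(ℂ, A), (∀ b : A, innerMul b d = 0) → d = 0 := by
      intro d hd
      -- polarization of the vanishing quadratic map `b ↦ b⋆ d b`
      have hpol : ∀ b c : A, star c * d.fst b = 0 := by
        intro b c
        have h1 := hd (b + c)
        have h2 := hd (b + Complex.I • c)
        have hb := hd b
        have hc := hd c
        simp only [innerMul, map_add, star_add, map_smul, star_smul, add_mul, mul_add,
          smul_mul_assoc, mul_smul_comm, smul_smul, smul_add] at h1 h2 hb hc
        simp only [hb, hc, smul_zero, add_zero, zero_add] at h1 h2
        have h3 := congrArg (fun z => Complex.I • z) h2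
        simp only [smul_add, smul_smul, smul_zero] at h3
        simp only [RCLike.star_def, Complex.conj_I, Complex.I_mul_I, mul_neg, neg_neg,
          one_smul, neg_smul] at h3
        have h4 := congrArg₂ (· + ·) h1 h3
        simp only [add_zero] at h4
        have h5 : (2 : ℂ) • (star c * d.fst b) = 0 := by
          rw [two_smul, ← h4]; abel
        simpa using h5
      refine multiplier_ext fun b => ?_
      have := hpol b (d.fst b)
      rw [CStarRing.star_mul_self_eq_zero_iff] at this
      simpa using this
    have hsa : IsSelfAdjoint m := by
      rw [IsSelfAdjoint, ← sub_eq_zero]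
      refine hzero _ fun b => ?_
      rw [← coe_inj, coe_innerMul, mul_sub, sub_mul]
      have h1 := (IsSelfAdjoint.of_nonneg (coe_nonneg.2 (h b))).star_eq
      rw [coe_innerMul] at h1
      simp only [star_mul, star_star] at h1
      rw [mul_assoc, h1]; simp
    rw [← CFC.negPart_eq_zero_iff m]
    have hn : 0 ≤ m⁻ := CFC.negPart_nonneg m
    have hcube : star m⁻ * m * m⁻ = -(star m⁻ * m⁻ * m⁻) := by
      have h1 : m * m⁻ = -(m⁻ * m⁻) := by
        nth_rw 1 [← CFC.posPart_sub_negPart m hsa]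
        rw [sub_mul, CFC.posPart_mul_negPart, zero_sub]
      rw [mul_assoc, h1, mul_neg, mul_assoc]
    have h3 : 0 ≤ star m⁻ * m⁻ * m⁻ := star_left_conjugate_nonneg hn _
    have h0 : star m⁻ * m⁻ * m⁻ = 0 := by
      refine hzero _ fun b => ?_
      rw [← coe_inj, coe_innerMul, coe_zero]
      refine le_antisymm ?_ (star_left_conjugate_nonneg h3 _)
      have h5 := coe_nonneg.2 (h (m⁻.fst b))
      rw [coe_innerMul, ← mul_coe] at h5
      have h6 : star (m⁻ * (b : 𝓜(ℂ, A))) * m * (m⁻ * b)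
          = -(star (b : 𝓜(ℂ, A)) * (star m⁻ * m⁻ * m⁻) * b) := by
        calc _ = star (b : 𝓜(ℂ, A)) * (star m⁻ * m * m⁻) * b := by simp only [star_mul, mul_assoc]
          _ = _ := by rw [hcube]; simp
      rw [h6] at h5
      exact neg_nonneg.1 h5
    have h7 : star m⁻ * m⁻ = 0 := by
      rw [← CStarRing.star_mul_self_eq_zero_iff, star_mul, star_star,
        (IsSelfAdjoint.of_nonneg hn).star_eq,
        ← mul_assoc]
      rw [(IsSelfAdjoint.of_nonneg hn).star_eq] at h0
      rw [h0, zero_mul]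
    exact CStarRing.star_mul_self_eq_zero_iff _ |>.1 h7

end Multiplier

/-! ### Positive functionals from the Hahn-Banach theorem -/

section HahnBanach

theorem le_zero_of_forall_le {M : Type*} [CStarAlgebra M] [PartialOrder M] [StarOrderedRing M]
    {x : M} (hx : IsSelfAdjoint x) (h : ∀ ε : ℝ, 0 < ε → x ≤ algebraMap ℝ M ε) : x ≤ 0 := by
  rw [← map_zero (algebraMap ℝ M), le_algebraMap_iff_spectrum_le]
  intro r hr
  exact le_of_forall_pos_le_add fun ε hε => by
    have := (le_algebraMap_iff_spectrum_le (a := x)).1 (h ε hε) r hr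
    linarith

/-- A form of the Hahn-Banach theorem. The relation `C x r` says that the price `r` is admissible
for `x`. If prices add and scale, and if the prices of each vector are bounded below, then some
linear functional is below all prices and attains the infimum of the prices of a given vector. -/
theorem exists_linear_le_cost {E : Type*} [AddCommGroup E] [Module ℝ E] (C : E → ℝ → Prop)
    (hadd : ∀ x y r s, C x r → C y s → C (x + y) (r + s))
    (hsmul : ∀ c : ℝ, 0 < c → ∀ x r, C x r → C (c • x) (c * r))
    (hne : ∀ x, ∃ r, C x r) (hbdd : ∀ x, ∃ K, ∀ r, C x r → K ≤ r) (w : E) :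
    ∃ g : E →ₗ[ℝ] ℝ, (∀ x r, C x r → g x ≤ r) ∧ ∀ K, (∀ r, C w r → K ≤ r) → K ≤ g w := by
  let N : E → ℝ := fun x => sInf {r | C x r}
  have hb : ∀ x, BddBelow {r | C x r} := fun x => by
    obtain ⟨K, hK⟩ := hbdd x
    exact ⟨K, hK⟩
  have hle : ∀ c : ℝ, 0 < c → ∀ x, N (c • x) ≤ c * N x := by
    intro c hc x
    rw [← div_le_iff₀' hc]
    refine le_csInf (hne x) fun r hr => ?_
    rw [div_le_iff₀' hc]
    exact csInf_le (hb _) (hsmul c hc x r hr)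
  have hhom : ∀ c : ℝ, 0 < c → ∀ x, N (c • x) = c * N x := by
    intro c hc x
    refine le_antisymm (hle c hc x) ?_
    have := hle c⁻¹ (inv_pos.2 hc) (c • x)
    rw [smul_smul, inv_mul_cancel₀ hc.ne', one_smul] at this
    rwa [← div_eq_inv_mul, le_div_iff₀' hc] at this
  have hN0 : N 0 = 0 := by
    have := hhom 2 (by norm_num) 0
    rw [smul_zero] at this
    linarith
  have hNadd : ∀ x y, N (x + y) ≤ N x + N y := by
    intro x y
    rw [← sub_le_iff_le_add]
    refine le_csInf (hne x) fun r hr => ?_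
    rw [sub_le_iff_le_add, ← sub_le_iff_le_add']
    refine le_csInf (hne y) fun s hs => ?_
    rw [sub_le_iff_le_add']
    exact csInf_le (hb _) (hadd x y r s hr hs)
  have hf : ∀ c : ℝ, c • w = 0 → c • N w = 0 := by
    intro c hc
    by_cases hw : w = 0
    · rw [hw, hN0, smul_zero]
    · rw [(smul_eq_zero.1 hc).resolve_right hw, zero_smul]
  obtain ⟨g, hg, hgN⟩ := exists_extension_of_le_sublinear
    (LinearPMap.mkSpanSingleton' w (N w) hf) N hhom hNadd (by
      rintro ⟨x, hx⟩
      obtain ⟨c, rfl⟩ := Submodule.mem_span_singleton.1 hx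
      rw [LinearPMap.mkSpanSingleton'_apply, smul_eq_mul]
      rcases lt_trichotomy c 0 with hc | rfl | hc
      · have h1 := hNadd (c • w) ((-c) • w)
        rw [← add_smul, add_neg_cancel, zero_smul, hN0, hhom (-c) (by linarith)] at h1
        simp only [RingHom.id_apply]
        linarith
      · simp [hN0]
      · exact (hhom c hc w).ge)
  refine ⟨g, fun x r hr => (hgN x).trans (csInf_le (hb x) hr), fun K hK => ?_⟩
  have h1 := hg ⟨w, Submodule.mem_span_singleton_self w⟩
  have h2 := LinearPMap.mkSpanSingleton'_apply (σ := RingHom.id ℝ) w (N w) hf (1 : ℝ)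
    (by rw [one_smul]; exact Submodule.mem_span_singleton_self w)
  simp only [one_smul] at h2
  rw [h1, h2, RingHom.id_apply, one_smul]
  exact le_csInf (hne w) hK

variable {A : Type*} [NonUnitalCStarAlgebra A] [PartialOrder A] [StarOrderedRing A]

/-- A positive real functional on the self-adjoint part extends to a positive functional. -/
theorem exists_positive_extension (g : selfAdjoint A →ₗ[ℝ] ℝ)
    (hg : ∀ a : selfAdjoint A, 0 ≤ (a : A) → 0 ≤ g a) :
    ∃ ω : A →ₚ[ℂ] ℂ, ∀ a : selfAdjoint A, ω (a : A) = (g a : ℂ) := by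
  let L : A →ₗ[ℂ] ℂ :=
    { toFun := fun a => (g (realPart a) : ℂ) + (g (imaginaryPart a) : ℂ) * Complex.I
      map_add' := fun a b => by
        rw [map_add, map_add, map_add, map_add, Complex.ofReal_add, Complex.ofReal_add]; ring
      map_smul' := fun c a => by
        rw [realPart_smul, imaginaryPart_smul]
        simp only [map_add, map_sub, map_smul, smul_eq_mul, RingHom.id_apply]
        apply Complex.ext <;> simp [sub_eq_add_neg] }
  have hL : ∀ a : selfAdjoint A, L (a : A) = (g a : ℂ) := by
    intro a
    simp only [L, LinearMap.coe_mk, AddHom.coe_mk]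
    rw [a.2.imaginaryPart, map_zero]
    have : realPart (a : A) = a := Subtype.ext a.2.coe_realPart
    rw [this]; simp
  refine ⟨PositiveLinearMap.mk₀ L fun a ha => ?_, hL⟩
  have h1 := hL ⟨a, .of_nonneg ha⟩
  simp only at h1
  rw [h1]
  exact_mod_cast hg _ ha

omit [PartialOrder A] [StarOrderedRing A] in
theorem le_norm_mul_one {a : A} (ha : IsSelfAdjoint a) :
    (a : 𝓜(ℂ, A)) ≤ algebraMap ℝ 𝓜(ℂ, A) ‖a‖ := by
  have := (isSelfAdjoint_coe.2 ha).le_algebraMap_norm_self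
  rwa [norm_coe] at this


omit [PartialOrder A] [StarOrderedRing A] in
theorem neg_norm_mul_one_le {a : A} (ha : IsSelfAdjoint a) :
    -algebraMap ℝ 𝓜(ℂ, A) ‖a‖ ≤ (a : 𝓜(ℂ, A)) := by
  have := (isSelfAdjoint_coe.2 ha).neg_algebraMap_norm_le_self
  rwa [norm_coe] at this

omit [PartialOrder A] [StarOrderedRing A] in
theorem algebraMap_mono {r s : ℝ} (h : r ≤ s) :
    algebraMap ℝ 𝓜(ℂ, A) r ≤ algebraMap ℝ 𝓜(ℂ, A) s := by
  rw [← sub_nonneg, ← map_sub]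
  exact algebraMap_nonneg _ (sub_nonneg.2 h)

omit [PartialOrder A] [StarOrderedRing A] in
theorem smul_le_smul_coe {c : ℝ} (hc : 0 ≤ c) {x y : 𝓜(ℂ, A)} (h : x ≤ y) :
    (c : ℂ) • x ≤ (c : ℂ) • y := by
  have hc' : (0 : ℂ) ≤ c := by exact_mod_cast hc
  exact smul_le_smul_of_nonneg_left h hc'

omit [PartialOrder A] [StarOrderedRing A] in
theorem coe_real_smul (c : ℝ) (x : A) : ((c • x : A) : 𝓜(ℂ, A)) = (c : ℂ) • (x : 𝓜(ℂ, A)) := by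
  rw [← coe_smul, Complex.coe_smul]

omit [PartialOrder A] [StarOrderedRing A] in
theorem smul_algebraMap (c r : ℝ) :
    (c : ℂ) • algebraMap ℝ 𝓜(ℂ, A) r = algebraMap ℝ 𝓜(ℂ, A) (c * r) := by
  rw [algebraMap_eq_smul, algebraMap_eq_smul, smul_smul, Complex.ofReal_mul]

/-- A self-adjoint element whose image under every positive functional is nonnegative is
nonnegative. -/
theorem nonneg_of_forall_positive_of_isSelfAdjoint {a : A} (ha : IsSelfAdjoint a)
    (h : ∀ ω : A →ₚ[ℂ] ℂ, 0 ≤ ω a) : 0 ≤ a := by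
  obtain ⟨g, hg, hgw⟩ := exists_linear_le_cost
    (fun (x : selfAdjoint A) (r : ℝ) => 0 ≤ r ∧ ((x : A) : 𝓜(ℂ, A)) ≤ algebraMap ℝ _ r)
    (fun x y r s ⟨hr, hxr⟩ ⟨hs, hys⟩ => ⟨add_nonneg hr hs, by
      rw [map_add, AddSubgroup.coe_add, coe_add]; exact add_le_add hxr hys⟩)
    (fun c hc x r ⟨hr, hxr⟩ => ⟨by positivity, by
      rw [← smul_algebraMap, selfAdjoint.val_smul, coe_real_smul]
      exact smul_le_smul_coe hc.le hxr⟩)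
    (fun x => ⟨‖(x : A)‖, norm_nonneg _, le_norm_mul_one x.2⟩)
    (fun x => ⟨0, fun r hr => hr.1⟩) (-⟨a, ha⟩)
  obtain ⟨ω, hω⟩ := exists_positive_extension g fun b hb => by
    have h1 := hg (-b) 0 ⟨le_rfl, by
      rw [map_zero, AddSubgroup.coe_neg, coe_neg, neg_nonpos, coe_nonneg]; exact hb⟩
    rw [map_neg] at h1
    linarith
  have h1 := h ω
  have h2 := hω ⟨a, ha⟩
  simp only at h2
  rw [h2] at h1
  have h3 : 0 ≤ g ⟨a, ha⟩ := by exact_mod_cast h1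
  have h4 : g (-⟨a, ha⟩) ≤ 0 := by rw [map_neg]; linarith
  have h5 : ∀ ε : ℝ, 0 < ε → ((-a : A) : 𝓜(ℂ, A)) ≤ algebraMap ℝ _ ε := by
    intro ε hε
    by_contra hcon
    have := hgw ε fun r ⟨_, hr⟩ => by
      by_contra! hlt
      exact hcon (hr.trans (algebraMap_mono hlt.le))
    linarith
  have h6 : ((-a : A) : 𝓜(ℂ, A)) ≤ 0 := le_zero_of_forall_le (isSelfAdjoint_coe.2 ha.neg) h5
  rwa [coe_neg, neg_nonpos, coe_nonneg] at h6

theorem isSelfAdjoint_of_forall_positive {a : A} (h : ∀ ω : A →ₚ[ℂ] ℂ, 0 ≤ ω a) :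
    IsSelfAdjoint a := by
  have h1 : ∀ ω : A →ₚ[ℂ] ℂ, ω (imaginaryPart a : A) = 0 := by
    intro ω
    have h2 := h ω
    rw [← realPart_add_I_smul_imaginaryPart a, map_add, map_smul] at h2
    have h3 := (realPart a).2.map' ω
    have h4 := (imaginaryPart a).2.map' ω
    obtain ⟨s, hs⟩ := Complex.conj_eq_iff_real.1 h3.star_eq
    obtain ⟨t, ht⟩ := Complex.conj_eq_iff_real.1 h4.star_eq
    rw [hs, ht] at h2
    have := h2.2
    simp at this
    rw [ht, ← this]; simp
  have hp : 0 ≤ (imaginaryPart a : A) :=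
    nonneg_of_forall_positive_of_isSelfAdjoint (imaginaryPart a).2 fun ω => (h1 ω).ge
  have hm : 0 ≤ -(imaginaryPart a : A) :=
    nonneg_of_forall_positive_of_isSelfAdjoint (imaginaryPart a).2.neg fun ω => by
      rw [map_neg, h1, neg_zero]
  have h0 : (imaginaryPart a : A) = 0 := le_antisymm (neg_nonneg.1 hm) hp
  rw [← realPart_add_I_smul_imaginaryPart a, h0, smul_zero, add_zero]
  exact (realPart a).2

/-- Positivity in a C⋆-algebra is detected by the positive functionals. -/
theorem nonneg_of_forall_positive {a : A} (h : ∀ ω : A →ₚ[ℂ] ℂ, 0 ≤ ω a) : 0 ≤ a :=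
  nonneg_of_forall_positive_of_isSelfAdjoint (isSelfAdjoint_of_forall_positive h) h

/-- A positive functional as a continuous linear functional. -/
def posCLM (ω : A →ₚ[ℂ] ℂ) : A →L[ℂ] ℂ := ⟨ω.toLinearMap, map_continuous ω⟩

@[simp] theorem posCLM_apply (ω : A →ₚ[ℂ] ℂ) (a : A) : posCLM ω a = ω a := rfl


theorem isSelfAdjoint_apply (ω : A →ₚ[ℂ] ℂ) {a : A} (ha : IsSelfAdjoint a) :
    ω a = ((ω a).re : ℂ) := by
  exact (Complex.conj_eq_iff_re.1 (ha.map' ω).star_eq).symm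

/-- The essence of the Jordan decomposition: the real part of a bounded functional is dominated on
the positive cone by a positive functional. -/
theorem exists_positive_ge (ω : A →L[ℂ] ℂ) :
    ∃ p : A →ₚ[ℂ] ℂ, ∀ a : A, 0 ≤ a → (ω a).re ≤ (p a).re := by
  -- the price of `ρ - v` is `‖ω‖ ρ - Re ω v`, which forces `g v ≥ Re ω v` and `g v ≥ 0`
  obtain ⟨g, hg, -⟩ := exists_linear_le_cost
    (fun (x : selfAdjoint A) (r : ℝ) => ∃ (ρ : ℝ) (v : A), 0 ≤ ρ ∧ 0 ≤ v ∧
      ((x : A) : 𝓜(ℂ, A)) ≤ algebraMap ℝ _ ρ - v ∧ r = ‖ω‖ * ρ - (ω v).re)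
    (by
      rintro x y r s ⟨ρ, v, hρ, hv, hx, rfl⟩ ⟨ρ', v', hρ', hv', hy, rfl⟩
      refine ⟨ρ + ρ', v + v', add_nonneg hρ hρ', add_nonneg hv hv', ?_, ?_⟩
      · rw [map_add, AddSubgroup.coe_add, coe_add, coe_add, add_sub_add_comm]
        exact add_le_add hx hy
      · rw [map_add, Complex.add_re]; ring)
    (by
      rintro c hc x r ⟨ρ, v, hρ, hv, hx, rfl⟩
      refine ⟨c * ρ, c • v, by positivity, smul_nonneg hc.le hv, ?_, ?_⟩
      · rw [← smul_algebraMap, selfAdjoint.val_smul, coe_real_smul, coe_real_smul, ← smul_sub]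
        exact smul_le_smul_coe hc.le hx
      · rw [← Complex.coe_smul, map_smul, smul_eq_mul, Complex.re_ofReal_mul]; ring)
    (fun x => ⟨_, ‖(x : A)‖, 0, norm_nonneg _, le_rfl, by
      rw [coe_zero, sub_zero]; exact le_norm_mul_one x.2, rfl⟩)
    (fun x => ⟨-(‖ω‖ * ‖(x : A)‖), by
      rintro r ⟨ρ, v, hρ, hv, hx, rfl⟩
      have h1 : (v : 𝓜(ℂ, A)) ≤ algebraMap ℝ _ (ρ + ‖(x : A)‖) := by
        rw [map_add]
        have h2 := (neg_norm_mul_one_le x.2).trans hx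
        rw [le_sub_iff_add_le, neg_add_le_iff_le_add, add_comm] at h2
        exact h2
      have h2 : ‖v‖ ≤ ρ + ‖(x : A)‖ := by
        rw [← norm_coe, CStarAlgebra.norm_le_iff_le_algebraMap _ (by positivity)
          (coe_nonneg.2 hv)]
        exact h1
      have h3 : (ω v).re ≤ ‖ω‖ * ‖v‖ := (Complex.re_le_norm _).trans (ω.le_opNorm v)
      nlinarith [norm_nonneg ω, mul_le_mul_of_nonneg_left h2 (norm_nonneg ω)]⟩) 0
  have hle : ∀ a : selfAdjoint A, 0 ≤ (a : A) → (ω (a : A)).re ≤ g a := by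
    intro a ha
    have := hg (-a) _ ⟨0, a, le_rfl, ha, by
      rw [map_zero, zero_sub, AddSubgroup.coe_neg, coe_neg], rfl⟩
    rw [map_neg, mul_zero] at this
    linarith
  obtain ⟨p, hp⟩ := exists_positive_extension g fun a ha => by
    have := hg (-a) _ ⟨0, 0, le_rfl, le_rfl, by
      rw [map_zero, coe_zero, zero_sub, AddSubgroup.coe_neg, coe_neg, neg_zero, neg_nonpos,
        coe_nonneg]; exact ha, rfl⟩
    rw [map_neg] at this
    simp at this
    exact this
  refine ⟨p, fun a ha => ?_⟩
  have h1 := hp ⟨a, .of_nonneg ha⟩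
  simp only at h1
  rw [h1, Complex.ofReal_re]
  exact hle ⟨a, .of_nonneg ha⟩ ha

/-- The positive functionals span the dual of a C⋆-algebra. -/
theorem functional_induction {P : (A →L[ℂ] ℂ) → Prop} (hpos : ∀ ω : A →ₚ[ℂ] ℂ, P (posCLM ω))
    (hadd : ∀ ω ω', P ω → P ω' → P (ω + ω')) (hsmul : ∀ (c : ℂ) ω, P ω → P (c • ω))
    (ω : A →L[ℂ] ℂ) : P ω := by
  -- the real part of a functional on self-adjoint elements is a difference of positive functionals
  have key : ∀ ω : A →L[ℂ] ℂ, ∃ p q : A →ₚ[ℂ] ℂ,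
      ∀ a : A, IsSelfAdjoint a → ((ω a).re : ℂ) = p a - q a := by
    intro ω
    obtain ⟨p, hp⟩ := exists_positive_ge ω
    let g : selfAdjoint A →ₗ[ℝ] ℝ :=
      { toFun := fun a => (p (a : A)).re - (ω (a : A)).re
        map_add' := fun a b => by
          simp only [AddSubgroup.coe_add, map_add, Complex.add_re]; ring
        map_smul' := fun c a => by
          simp only [selfAdjoint.val_smul, RingHom.id_apply, smul_eq_mul]
          rw [← Complex.coe_smul, map_smul, map_smul]
          simp only [smul_eq_mul, Complex.re_ofReal_mul]; ring }
    obtain ⟨q, hq⟩ := exists_positive_extension g fun a ha => sub_nonneg.2 (hp _ ha)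
    refine ⟨p, q, fun a ha => ?_⟩
    have h1 := hq ⟨a, ha⟩
    simp only [g, LinearMap.coe_mk, AddHom.coe_mk] at h1
    rw [h1, isSelfAdjoint_apply p ha]
    push_cast
    simp
  obtain ⟨p, q, h1⟩ := key ω
  obtain ⟨r, s, h2⟩ := key ((-Complex.I) • ω)
  have hω : ω = (posCLM p + (-1 : ℂ) • posCLM q)
      + Complex.I • (posCLM r + (-1 : ℂ) • posCLM s) := by
    have hsa : ∀ a : A, IsSelfAdjoint a → ω a = ((posCLM p + (-1 : ℂ) • posCLM q)
      + Complex.I • (posCLM r + (-1 : ℂ) • posCLM s)) a := by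
      intro a ha
      have e1 := h1 a ha
      have e2 := h2 a ha
      simp only [_root_.add_apply, _root_.smul_apply, posCLM_apply,
        smul_eq_mul, neg_mul, one_mul, ← sub_eq_add_neg] at e2 ⊢
      rw [← e1, ← e2]
      apply Complex.ext <;> simp
    ext a
    rw [← realPart_add_I_smul_imaginaryPart a, map_add, map_add, map_smul, map_smul,
      hsa _ (realPart a).2, hsa _ (imaginaryPart a).2]
  rw [hω]
  exact hadd _ _ (hadd _ _ (hpos p) (hsmul _ _ (hpos q)))
    (hsmul _ _ (hadd _ _ (hpos r) (hsmul _ _ (hpos s))))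

/-- A positive element of a unital C⋆-algebra that is not invertible is annihilated by a state. -/
theorem exists_state_apply_eq_zero {M : Type*} [CStarAlgebra M] [PartialOrder M]
    [StarOrderedRing M] {h : M} (h0 : 0 ≤ h) (hu : ¬ IsUnit h) :
    ∃ ω : M →ₚ[ℂ] ℂ, ω 1 = 1 ∧ ω h = 0 := by
  obtain ⟨g, hg, -⟩ := exists_linear_le_cost
    (fun (x : selfAdjoint M) (r : ℝ) => ∃ s : ℝ, (x : M) ≤ algebraMap ℝ M r + s • h)
    (by
      rintro x y r r' ⟨s, hx⟩ ⟨s', hy⟩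
      refine ⟨s + s', ?_⟩
      rw [AddSubgroup.coe_add, map_add, add_smul, add_add_add_comm]
      exact add_le_add hx hy)
    (by
      rintro c hc x r ⟨s, hx⟩
      refine ⟨c * s, ?_⟩
      rw [selfAdjoint.val_smul, map_mul, mul_smul, ← Algebra.smul_def, ← smul_add]
      exact smul_le_smul_of_nonneg_left hx hc.le)
    (fun x => ⟨‖(x : M)‖, 0, by rw [zero_smul, add_zero]; exact x.2.le_algebraMap_norm_self⟩)
    (fun x => ⟨-‖(x : M)‖, by
      rintro r ⟨s, hx⟩
      -- otherwise `s h` would dominate a positive scalar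
      by_contra! hlt
      have hc : 0 < -r - ‖(x : M)‖ := by linarith
      have h1 : algebraMap ℝ M (-r - ‖(x : M)‖) ≤ s • h := by
        rw [map_sub, map_neg]
        have h2 := x.2.neg_algebraMap_norm_le_self.trans hx
        rw [sub_eq_add_neg]
        exact (add_le_add_right h2 _).trans_eq (by abel)
      have h2 : IsUnit (s • h) := by
        refine CStarAlgebra.isUnit_of_le _ h1 ?_
        refine ⟨algebraMap_nonneg _ hc.le, ?_⟩
        exact (isUnit_iff_ne_zero.2 hc.ne').map (algebraMap ℝ M)
      rcases eq_or_ne s 0 with rfl | hs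
      · rw [zero_smul] at h2
        have := subsingleton_of_zero_eq_one (isUnit_zero_iff.1 h2)
        exact hu (isUnit_of_subsingleton h)
      · refine hu ?_
        have h3 : h = algebraMap ℝ M s⁻¹ * (s • h) := by
          rw [← Algebra.smul_def, smul_smul, inv_mul_cancel₀ hs, one_smul]
        rw [h3]
        exact ((isUnit_iff_ne_zero.2 (inv_ne_zero hs)).map (algebraMap ℝ M)).mul h2⟩) 0
  obtain ⟨ω, hω⟩ := exists_positive_extension g fun a ha => by
    have := hg (-a) 0 ⟨0, by
      rw [map_zero, zero_smul, add_zero, AddSubgroup.coe_neg, neg_nonpos]; exact ha⟩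
    rw [map_neg] at this
    linarith
  refine ⟨ω, ?_, ?_⟩
  · have h1 := hg 1 1 ⟨0, by rw [map_one, zero_smul, add_zero]; rfl⟩
    have h2 := hg (-1) (-1) ⟨0, by rw [map_neg, map_one, zero_smul, add_zero]; rfl⟩
    rw [map_neg] at h2
    have h3 := hω 1
    rw [show g 1 = 1 by linarith] at h3
    simpa using h3
  · have hsa : IsSelfAdjoint h := .of_nonneg h0
    have h1 := hg ⟨h, hsa⟩ 0 ⟨1, by rw [map_zero, one_smul, zero_add]⟩
    have h2 := hg (-⟨h, hsa⟩) 0 ⟨-1, by rw [map_zero, neg_smul, one_smul, zero_add]; rfl⟩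
    rw [map_neg] at h2
    have h3 := hω ⟨h, hsa⟩
    rw [show g ⟨h, hsa⟩ = 0 by linarith] at h3
    simpa using h3

end HahnBanach

/-! ### The strictly continuous extension of functionals to the multiplier algebra -/

section Extension

theorem star_mul_self_mul_le {M : Type*} [CStarAlgebra M] [PartialOrder M] [StarOrderedRing M]
    (m d : M) : star (m * d) * (m * d) ≤ ((‖m‖ ^ 2 : ℝ) : ℂ) • (star d * d) := by
  have h := star_left_conjugate_le_conjugate
    (CStarAlgebra.star_mul_le_algebraMap_norm_sq (a := m)) d
  calc star (m * d) * (m * d) = star d * (star m * m) * d := by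
        rw [star_mul]; simp only [mul_assoc]
    _ ≤ _ := h
    _ = _ := by
      rw [Algebra.algebraMap_eq_smul_one, mul_smul_comm, mul_one, smul_mul_assoc,
        Complex.coe_smul]

variable {A : Type*} [NonUnitalCStarAlgebra A] [PartialOrder A] [StarOrderedRing A]

omit [StarOrderedRing A] in
theorem re_mono (ω : A →ₚ[ℂ] ℂ) {a b : A} (h : a ≤ b) : (ω a).re ≤ (ω b).re :=
  (OrderHomClass.mono ω h).1

omit [StarOrderedRing A] in
theorem re_nonneg (ω : A →ₚ[ℂ] ℂ) {a : A} (h : 0 ≤ a) : 0 ≤ (ω a).re :=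
  (ω.map_nonneg h).1

theorem cauchySchwarz (ω : A →ₚ[ℂ] ℂ) (a b : A) :
    ‖ω (star a * b)‖ ^ 2 ≤ (ω (star a * a)).re * (ω (star b * b)).re := by
  have h := norm_inner_le_norm (𝕜 := ℂ) (ω.toPreGNS a) (ω.toPreGNS b)
  rw [PositiveLinearMap.preGNS_inner_def, PositiveLinearMap.preGNS_norm_def,
    PositiveLinearMap.preGNS_norm_def] at h
  simp only [PositiveLinearMap.ofPreGNS_toPreGNS] at h
  calc _ ≤ _ := pow_le_pow_left₀ (norm_nonneg _) h 2
    _ = _ := by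
      rw [mul_pow, Real.sq_sqrt (re_nonneg ω (star_mul_self_nonneg a)),
        Real.sq_sqrt (re_nonneg ω (star_mul_self_nonneg b))]

theorem re_apply_le (ω : A →ₚ[ℂ] ℂ) (a : A) : (ω a).re ≤ ‖posCLM ω‖ * ‖a‖ :=
  (Complex.re_le_norm _).trans ((posCLM ω).le_opNorm a)

open CStarAlgebra in
/-- The Kadison inequality for positive functionals on a possibly non-unital algebra. -/
theorem norm_apply_sq_le (ω : A →ₚ[ℂ] ℂ) (a : A) :
    ‖ω a‖ ^ 2 ≤ ‖posCLM ω‖ * (ω (star a * a)).re := by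
  have hl := increasingApproximateUnit A
  have h1 : Tendsto (fun e => ‖ω (e * a)‖ ^ 2) (approximateUnit A) (𝓝 (‖ω a‖ ^ 2)) :=
    (((map_continuous ω).tendsto _).comp (hl.tendsto_mul_right a)).norm.pow 2
  refine le_of_tendsto h1 ?_
  filter_upwards [hl.eventually_star_eq, hl.eventually_norm] with e he hn
  have h2 := cauchySchwarz ω e a
  rw [he] at h2
  refine h2.trans (mul_le_mul_of_nonneg_right ?_ (re_nonneg ω (star_mul_self_nonneg a)))
  refine (re_apply_le ω _).trans (mul_le_of_le_one_right (norm_nonneg _) ?_)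
  exact (norm_mul_le _ _).trans (mul_le_one₀ hn (norm_nonneg _) hn)

theorem star_mul_self_le_self {d : A} (h0 : 0 ≤ d) (h1 : ‖d‖ ≤ 1) : star d * d ≤ d := by
  rw [← coe_le_coe, coe_mul_coe, coe_star, (IsSelfAdjoint.of_nonneg (coe_nonneg.2 h0)).star_eq,
    ← pow_two]
  have h2 : (d : 𝓜(ℂ, A)) ≤ 1 := by
    rw [← CStarAlgebra.norm_le_one_iff_of_nonneg _ (coe_nonneg.2 h0), norm_coe]
    exact h1
  simpa using CStarAlgebra.pow_antitone (coe_nonneg.2 h0) h2 one_le_two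

theorem norm_apply_fst_sq_le (ω : A →ₚ[ℂ] ℂ) (m : 𝓜(ℂ, A)) {d : A} (h0 : 0 ≤ d) (h1 : ‖d‖ ≤ 1) :
    ‖ω (m.fst d)‖ ^ 2 ≤ ‖posCLM ω‖ * (‖m‖ ^ 2 * (ω d).re) := by
  refine (norm_apply_sq_le ω _).trans (mul_le_mul_of_nonneg_left ?_ (norm_nonneg _))
  have h2 : star (m.fst d) * m.fst d ≤ ((‖m‖ ^ 2 : ℝ) : ℂ) • (star d * d) := by
    rw [← coe_le_coe, coe_mul_coe, coe_star, ← mul_coe, coe_smul, coe_mul_coe, coe_star]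
    exact star_mul_self_mul_le m (d : 𝓜(ℂ, A))
  refine (re_mono ω h2).trans ?_
  rw [map_smul, smul_eq_mul, Complex.re_ofReal_mul]
  exact mul_le_mul_of_nonneg_left (re_mono ω (star_mul_self_le_self h0 h1)) (by positivity)

open CStarAlgebra in
theorem exists_uniform_cauchy_of_positive (ω : A →ₚ[ℂ] ℂ) {ε : ℝ} (hε : 0 < ε) :
    ∃ S ∈ approximateUnit A, ∀ e ∈ S, ∀ e' ∈ S, ∀ m : 𝓜(ℂ, A),
      ‖ω (m.fst e) - ω (m.fst e')‖ ≤ ε * ‖m‖ := by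
  set N := ‖posCLM ω‖ with hN
  have hN0 : 0 ≤ N := norm_nonneg _
  set V : Set ℝ := (fun e : A => (ω e).re) '' {e | 0 ≤ e ∧ ‖e‖ < 1} with hV
  have hVb : BddAbove V := by
    refine ⟨N, ?_⟩
    rintro _ ⟨e, ⟨-, he⟩, rfl⟩
    exact (re_apply_le ω e).trans (mul_le_of_le_one_right hN0 he.le)
  have hVn : V.Nonempty := ⟨_, 0, ⟨le_rfl, by simp⟩, rfl⟩
  set η := (ε / 2) ^ 2 / (N + 1) with hη
  have hη0 : 0 < η := by positivity
  obtain ⟨_, ⟨e₀, ⟨he₀, he₀n⟩, rfl⟩, hlt⟩ := exists_lt_of_lt_csSup hVn (sub_lt_self (sSup V) hη0)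
  refine ⟨_, (hasBasis_approximateUnit A).mem_of_mem ⟨he₀, he₀n⟩, ?_⟩
  have key : ∀ e : A, e₀ ≤ e → ‖e‖ ≤ 1 → ∀ m : 𝓜(ℂ, A),
      ‖ω (m.fst e) - ω (m.fst e₀)‖ ≤ ε / 2 * ‖m‖ := by
    intro e he hen m
    have hd : 0 ≤ e - e₀ := sub_nonneg.2 he
    have hdn : ‖e - e₀‖ ≤ 1 :=
      (norm_le_norm_of_nonneg_of_le hd (sub_le_self e he₀)).trans hen
    have hsup : (ω e).re ≤ sSup V := by
      have ht := (tendsto_natCast_div_add_atTop (1 : ℝ)).mul_const (ω e).re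
      rw [one_mul] at ht
      refine le_of_tendsto' ht fun n => ?_
      have hc0 : (0 : ℝ) ≤ (n : ℝ) / (n + 1) := by positivity
      have hc1 : (n : ℝ) / (n + 1) < 1 := by
        rw [div_lt_one (by positivity)]; linarith
      refine le_csSup hVb ⟨(((n : ℝ) / (n + 1) : ℝ) : ℂ) • e, ⟨?_, ?_⟩, ?_⟩
      · exact smul_nonneg (by exact_mod_cast hc0) (he₀.trans he)
      · rw [norm_smul, Complex.norm_real, Real.norm_of_nonneg hc0]
        nlinarith [norm_nonneg e]
      · simp only [map_smul, smul_eq_mul, Complex.re_ofReal_mul]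
    have h1 := norm_apply_fst_sq_le ω m hd hdn
    rw [map_sub, map_sub] at h1
    refine abs_le_of_sq_le_sq' ?_ (by positivity) |>.2
    refine h1.trans ?_
    have h2 : (ω (e - e₀)).re ≤ η := by
      rw [map_sub, Complex.sub_re]
      simp only at hlt
      linarith
    have h3 : N * η ≤ (ε / 2) ^ 2 := by
      rw [hη, ← mul_div_assoc, div_le_iff₀ (by positivity)]
      nlinarith [sq_nonneg (ε / 2)]
    calc N * (‖m‖ ^ 2 * (ω (e - e₀)).re) ≤ N * (‖m‖ ^ 2 * η) := by gcongr
      _ = N * η * ‖m‖ ^ 2 := by ring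
      _ ≤ (ε / 2) ^ 2 * ‖m‖ ^ 2 := by gcongr
      _ = _ := by ring
  rintro e ⟨he, hen⟩ e' ⟨he', hen'⟩ m
  rw [mem_closedBall_zero_iff] at hen hen'
  calc ‖ω (m.fst e) - ω (m.fst e')‖
      ≤ ‖ω (m.fst e) - ω (m.fst e₀)‖ + ‖ω (m.fst e') - ω (m.fst e₀)‖ := by
        rw [← norm_neg (ω (m.fst e') - _), neg_sub]
        exact norm_sub_le_norm_sub_add_norm_sub _ _ _
    _ ≤ ε / 2 * ‖m‖ + ε / 2 * ‖m‖ := add_le_add (key e he hen m) (key e' he' hen' m)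
    _ = _ := by ring

open CStarAlgebra in
/-- The net `ω (m e)` is Cauchy along the approximate unit, uniformly for `m` in bounded sets. -/
theorem exists_uniform_cauchy (ω : A →L[ℂ] ℂ) : ∀ {ε : ℝ}, 0 < ε →
    ∃ S ∈ approximateUnit A, ∀ e ∈ S, ∀ e' ∈ S, ∀ m : 𝓜(ℂ, A),
      ‖ω (m.fst e) - ω (m.fst e')‖ ≤ ε * ‖m‖ := by
  induction ω using functional_induction with
  | hpos ω => exact fun hε => exists_uniform_cauchy_of_positive ω hε
  | hadd ω ω' h h' =>
    intro ε hε
    obtain ⟨S, hS, h⟩ := h (half_pos hε)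
    obtain ⟨S', hS', h'⟩ := h' (half_pos hε)
    refine ⟨S ∩ S', inter_mem hS hS', fun e he e' he' m => ?_⟩
    have h1 := h e he.1 e' he'.1 m
    have h2 := h' e he.2 e' he'.2 m
    calc _ = ‖(ω (m.fst e) - ω (m.fst e')) + (ω' (m.fst e) - ω' (m.fst e'))‖ := by
          simp only [_root_.add_apply]; congr 1; ring
      _ ≤ _ := norm_add_le _ _
      _ ≤ _ := by linarith
  | hsmul c ω h =>
    intro ε hε
    obtain ⟨S, hS, h⟩ := h (show 0 < ε / (‖c‖ + 1) by positivity)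
    refine ⟨S, hS, fun e he e' he' m => ?_⟩
    have h1 := h e he e' he' m
    calc _ = ‖c‖ * ‖ω (m.fst e) - ω (m.fst e')‖ := by
          simp only [_root_.smul_apply, ← smul_sub, norm_smul]
      _ ≤ ‖c‖ * (ε / (‖c‖ + 1) * ‖m‖) := by gcongr
      _ ≤ (‖c‖ + 1) * (ε / (‖c‖ + 1) * ‖m‖) := by gcongr; linarith
      _ = _ := by field_simp

open CStarAlgebra in
theorem tendsto_extFunctional (ω : A →L[ℂ] ℂ) (m : 𝓜(ℂ, A)) :
    Tendsto (fun e => ω (m.fst e)) (approximateUnit A) (𝓝 (extFunctional ω m)) := by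
  have hC : Cauchy (map (fun e => ω (m.fst e)) (approximateUnit A)) := by
    rw [Metric.cauchy_iff]
    refine ⟨inferInstance, fun ε hε => ?_⟩
    obtain ⟨S, hS, h⟩ := exists_uniform_cauchy ω (show 0 < ε / (2 * (‖m‖ + 1)) by positivity)
    refine ⟨_, image_mem_map hS, ?_⟩
    rintro _ ⟨e, he, rfl⟩ _ ⟨e', he', rfl⟩
    rw [dist_eq_norm]
    refine (h e he e' he' m).trans_lt ?_
    rw [div_mul_eq_mul_div, div_lt_iff₀ (by positivity)]
    nlinarith [norm_nonneg m]
  obtain ⟨z, hz⟩ := CompleteSpace.complete hC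
  exact tendsto_nhds_limUnder ⟨z, hz⟩

open CStarAlgebra in
theorem eventually_norm_sub_extFunctional_le (ω : A →L[ℂ] ℂ) {ε : ℝ} (hε : 0 < ε) :
    ∀ᶠ e in approximateUnit A, ∀ m : 𝓜(ℂ, A),
      ‖ω (m.fst e) - extFunctional ω m‖ ≤ ε * ‖m‖ := by
  obtain ⟨S, hS, h⟩ := exists_uniform_cauchy ω hε
  filter_upwards [hS] with e he m
  have h1 := (tendsto_const_nhds (x := ω (m.fst e))).sub (tendsto_extFunctional ω m)
  refine le_of_tendsto h1.norm ?_
  filter_upwards [hS] with e' he'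
  exact h e he e' he' m

open CStarAlgebra in
/-- The strictly continuous extension of a bounded functional, as a bounded functional on the
multiplier algebra. -/
def ext (ω : A →L[ℂ] ℂ) : 𝓜(ℂ, A) →L[ℂ] ℂ :=
  LinearMap.mkContinuous
    { toFun := extFunctional ω
      map_add' := fun m m' => by
        refine tendsto_nhds_unique (tendsto_extFunctional ω (m + m')) ?_
        simpa using (tendsto_extFunctional ω m).add (tendsto_extFunctional ω m')
      map_smul' := fun c m => by
        refine tendsto_nhds_unique (tendsto_extFunctional ω (c • m)) ?_
        simpa using (tendsto_extFunctional ω m).const_mul c } ‖ω‖ (by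
    intro m
    refine le_of_tendsto (tendsto_extFunctional ω m).norm ?_
    filter_upwards [(increasingApproximateUnit A).eventually_norm] with e he
    calc ‖ω (m.fst e)‖ ≤ ‖ω‖ * (‖m‖ * ‖e‖) :=
          (ω.le_opNorm _).trans (by gcongr; exact norm_fst_apply_le m e)
      _ ≤ ‖ω‖ * (‖m‖ * 1) := by gcongr
      _ = _ := by rw [mul_one])

theorem ext_apply (ω : A →L[ℂ] ℂ) (m : 𝓜(ℂ, A)) : ext ω m = extFunctional ω m := rfl

theorem norm_ext_le (ω : A →L[ℂ] ℂ) (m : 𝓜(ℂ, A)) : ‖ext ω m‖ ≤ ‖ω‖ * ‖m‖ :=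
  (ext ω).le_of_opNorm_le (LinearMap.mkContinuous_norm_le _ (norm_nonneg _) _) m

open CStarAlgebra in
@[simp] theorem ext_coe (ω : A →L[ℂ] ℂ) (a : A) : ext ω (a : 𝓜(ℂ, A)) = ω a := by
  refine tendsto_nhds_unique (tendsto_extFunctional ω (a : 𝓜(ℂ, A))) ?_
  exact (ω.continuous.tendsto a).comp ((increasingApproximateUnit A).tendsto_mul_left a)

theorem ext_add (ω ω' : A →L[ℂ] ℂ) (m : 𝓜(ℂ, A)) :
    ext (ω + ω') m = ext ω m + ext ω' m :=
  tendsto_nhds_unique (tendsto_extFunctional (ω + ω') m)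
    ((tendsto_extFunctional ω m).add (tendsto_extFunctional ω' m))

theorem ext_smul (c : ℂ) (ω : A →L[ℂ] ℂ) (m : 𝓜(ℂ, A)) :
    ext (c • ω) m = c * ext ω m :=
  tendsto_nhds_unique (tendsto_extFunctional (c • ω) m)
    ((tendsto_extFunctional ω m).const_mul c)

open CStarAlgebra in
/-- Extended functionals are strictly continuous on bounded sets. -/
theorem tendsto_ext_of_strict (ω : A →L[ℂ] ℂ) {ι : Type*} {l : Filter ι} {m : ι → 𝓜(ℂ, A)}
    {m₀ : 𝓜(ℂ, A)} {K : ℝ} (hK : ∀ᶠ i in l, ‖m i‖ ≤ K)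
    (h : ∀ b : A, Tendsto (fun i => (m i).fst b) l (𝓝 (m₀.fst b))) :
    Tendsto (fun i => ext ω (m i)) l (𝓝 (ext ω m₀)) := by
  rw [Metric.tendsto_nhds]
  intro ε hε
  set L := |K| + ‖m₀‖ + 1 with hL
  have hL0 : 0 < L := by positivity
  obtain ⟨e, he⟩ := (eventually_norm_sub_extFunctional_le ω
    (show 0 < ε / (2 * L) by positivity)).exists
  have h1 := ((ω.continuous.tendsto _).comp (h e))
  filter_upwards [hK, Metric.tendsto_nhds.1 h1 (ε / 2) (half_pos hε)] with i hi h2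
  have h3 := he (m i - m₀)
  have h4 : ‖m i - m₀‖ ≤ L - 1 := (norm_sub_le _ _).trans (by
    rw [hL]; linarith [le_abs_self K])
  rw [← ext_apply, map_sub] at h3
  simp only [DoubleCentralizer.sub_fst, _root_.sub_apply, map_sub] at h3
  rw [dist_eq_norm] at h2 ⊢
  simp only [Function.comp_apply] at h2
  have h5 : ε / (2 * L) * ‖m i - m₀‖ ≤ ε / 2 := by
    calc ε / (2 * L) * ‖m i - m₀‖ ≤ ε / (2 * L) * L := by gcongr; linarith
      _ = ε / 2 := by field_simp
  calc ‖ext ω (m i) - ext ω m₀‖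
      ≤ ‖ω ((m i).fst e) - ω (m₀.fst e) - (ext ω (m i) - ext ω m₀)‖
        + ‖ω ((m i).fst e) - ω (m₀.fst e)‖ := by
        rw [← norm_neg (_ - _ - _)]
        refine (norm_add_le _ _).trans' (le_of_eq ?_)
        congr 1; ring
    _ < ε := by linarith

omit [PartialOrder A] [StarOrderedRing A] in
theorem fst_mul_apply (m m' : 𝓜(ℂ, A)) (b : A) : (m * m').fst b = m.fst (m'.fst b) := rfl

open CStarAlgebra in
theorem tendsto_ext_mul_coe_mul (ω : A →L[ℂ] ℂ) (u v : 𝓜(ℂ, A)) :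
    Tendsto (fun e : A => ext ω (u * (e : 𝓜(ℂ, A)) * v)) (approximateUnit A)
      (𝓝 (ext ω (u * v))) := by
  refine tendsto_ext_of_strict (K := ‖u‖ * ‖v‖) ω ?_ fun b => ?_
  · filter_upwards [(increasingApproximateUnit A).eventually_norm] with e he
    calc ‖u * (e : 𝓜(ℂ, A)) * v‖ ≤ ‖u‖ * ‖(e : 𝓜(ℂ, A))‖ * ‖v‖ :=
          (norm_mul_le _ _).trans (by gcongr; exact norm_mul_le _ _)
      _ ≤ ‖u‖ * 1 * ‖v‖ := by rw [norm_coe]; gcongr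
      _ = _ := by rw [mul_one]
  · exact (u.fst.continuous.tendsto _).comp
      ((increasingApproximateUnit A).tendsto_mul_right (v.fst b))

theorem ext_comp_sandwich (ω : A →L[ℂ] ℂ) (u m : 𝓜(ℂ, A)) :
    ext (ω ∘L sandwich u) m = ext ω (u * m * star u) := by
  refine tendsto_nhds_unique (tendsto_extFunctional _ m) ?_
  refine (tendsto_ext_mul_coe_mul ω (u * m) (star u)).congr fun e => ?_
  rw [mul_assoc u m, mul_coe, ← coe_sandwich, ext_coe]; rfl

open CStarAlgebra in
theorem tendsto_apply_sandwich (ω : A →L[ℂ] ℂ) (u : 𝓜(ℂ, A)) :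
    Tendsto (fun e : A => ω (sandwich u e)) (approximateUnit A) (𝓝 (ext ω (u * star u))) :=
  (tendsto_ext_mul_coe_mul ω u (star u)).congr fun e => by rw [← coe_sandwich, ext_coe]

omit [PartialOrder A] [StarOrderedRing A] in
theorem isSelfAdjoint_sqrt (m : 𝓜(ℂ, A)) : star (CFC.sqrt m) = CFC.sqrt m :=
  (IsSelfAdjoint.of_nonneg (CFC.sqrt_nonneg m)).star_eq

theorem ext_nonneg (ω : A →ₚ[ℂ] ℂ) {m : 𝓜(ℂ, A)} (hm : 0 ≤ m) : 0 ≤ ext (posCLM ω) m := by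
  have h := tendsto_apply_sandwich (posCLM ω) (CFC.sqrt m)
  rw [isSelfAdjoint_sqrt, CFC.sqrt_mul_sqrt_self m hm] at h
  refine ge_of_tendsto h ?_
  filter_upwards [(CStarAlgebra.increasingApproximateUnit A).eventually_nonneg] with e he
  exact ω.map_nonneg (sandwich_nonneg _ he)

theorem ext_mono (ω : A →ₚ[ℂ] ℂ) {m m' : 𝓜(ℂ, A)} (h : m ≤ m') :
    ext (posCLM ω) m ≤ ext (posCLM ω) m' := by
  rw [← sub_nonneg, ← map_sub]
  exact ext_nonneg ω (sub_nonneg.2 h)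

/-- The positive functional `a ↦ ω (u a u⋆)`. -/
def posConj (ω : A →ₚ[ℂ] ℂ) (u : 𝓜(ℂ, A)) : A →ₚ[ℂ] ℂ :=
  PositiveLinearMap.mk₀ (ω.toLinearMap ∘ₗ (sandwich u).toLinearMap)
    fun _ ha => ω.map_nonneg (sandwich_nonneg u ha)

theorem ext_posConj (ω : A →ₚ[ℂ] ℂ) (u m : 𝓜(ℂ, A)) :
    ext (posCLM (posConj ω u)) m = ext (posCLM ω) (u * m * star u) :=
  ext_comp_sandwich (posCLM ω) u m

/-- Positivity of a multiplier is detected by the extended positive functionals. -/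
theorem multiplier_nonneg_of_forall_ext {m : 𝓜(ℂ, A)}
    (h : ∀ ω : A →ₚ[ℂ] ℂ, 0 ≤ ext (posCLM ω) m) : 0 ≤ m := by
  rw [multiplier_nonneg_iff]
  intro b
  refine nonneg_of_forall_positive fun ω => ?_
  have := h (posConj ω (star (b : 𝓜(ℂ, A))))
  rwa [ext_posConj, star_star, ← coe_innerMul, ext_coe] at this

theorem multiplier_eq_of_forall_ext {m m' : 𝓜(ℂ, A)}
    (h : ∀ ω : A →ₚ[ℂ] ℂ, ext (posCLM ω) m = ext (posCLM ω) m') : m = m' := by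
  refine le_antisymm ?_ ?_ <;> rw [← sub_nonneg] <;>
    exact multiplier_nonneg_of_forall_ext fun ω => by rw [map_sub, h, sub_self]

end Extension

/-! ### The joint functional calculus -/

section Joint

variable {M : Type*} [CStarAlgebra M] {n : ℕ}

theorem isCompact_spectralBox (x : Fin n → M) : IsCompact (spectralBox x) :=
  isCompact_univ_pi fun i => spectrum.isCompact (x i)

instance compactSpace_spectralBox (x : Fin n → M) : CompactSpace (spectralBox x) :=
  isCompact_iff_compactSpace.1 (isCompact_spectralBox x)

/-- The joint functional calculus exists for commuting self-adjoint tuples: restrict the Gelfand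
transform of the generated commutative C⋆-algebra to functions of the joint spectrum. -/
theorem exists_jointHom {x : Fin n → M} (hsa : ∀ i, IsSelfAdjoint (x i))
    (hcomm : ∀ i j, x i * x j = x j * x i) :
    ∃ Φ : C(spectralBox x, ℂ) →⋆ₐ[ℂ] M, ∀ i, Φ (coordFun x i) = x i := by
  have hmc : IsMulCommutative (StarAlgebra.adjoin ℂ (Set.range x)) := by
    refine StarAlgebra.isMulCommutative_adjoin ℂ ?_ ?_
    · rintro _ ⟨i, rfl⟩ _ ⟨j, rfl⟩
      exact hcomm i j
    · rintro _ ⟨i, rfl⟩ _ ⟨j, rfl⟩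
      rw [(hsa j).star_eq]
      exact hcomm i j
  let S : StarSubalgebra ℂ M := (StarAlgebra.adjoin ℂ (Set.range x)).topologicalClosure
  have hS : IsClosed (S : Set M) := StarSubalgebra.isClosed_topologicalClosure _
  have hc : ∀ a b : S, a * b = b * a :=
    (StarSubalgebra.commRingTopologicalClosure (StarAlgebra.adjoin ℂ (Set.range x))
      fun a b => mul_comm' a b).mul_comm
  let _ : CommCStarAlgebra S := { (inferInstance : CStarAlgebra S) with mul_comm := hc }
  have hxS : ∀ i, x i ∈ S := fun i =>
    StarSubalgebra.le_topologicalClosure _ (StarAlgebra.subset_adjoin ℂ _ ⟨i, rfl⟩)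
  have hre : ∀ (χ : WeakDual.characterSpace ℂ S) (i : Fin n),
      χ ⟨x i, hxS i⟩ = ((χ ⟨x i, hxS i⟩).re : ℂ) ∧
        (χ ⟨x i, hxS i⟩).re ∈ spectrum ℝ (x i) := by
    intro χ i
    have hsa' : IsSelfAdjoint (⟨x i, hxS i⟩ : S) := Subtype.ext (hsa i)
    have h1 := WeakDual.CharacterSpace.apply_mem_spectrum χ (⟨x i, hxS i⟩ : S)
    have h2 := hsa'.mem_spectrum_eq_re h1
    refine ⟨h2, ?_⟩
    have h3 := hsa'.map_spectrum_real S.subtype Subtype.val_injective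
    have h4 : S.subtype ⟨x i, hxS i⟩ = x i := rfl
    rw [h4] at h3
    rw [h3, ← spectrum.algebraMap_mem_iff ℂ]
    rw [h2] at h1
    exact h1
  let q : C(WeakDual.characterSpace ℂ S, spectralBox x) :=
    { toFun := fun χ => ⟨fun i => (χ ⟨x i, hxS i⟩).re, fun i _ => (hre χ i).2⟩
      continuous_toFun := by
        refine Continuous.subtype_mk (continuous_pi fun i => Complex.continuous_re.comp ?_) _
        exact (WeakDual.eval_continuous _).comp continuous_subtype_val }
  refine ⟨S.subtype.comp (((gelfandStarTransform S).symm : _ →⋆ₐ[ℂ] S).comp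
    (ContinuousMap.compStarAlgHom' ℂ ℂ q)), fun i => ?_⟩
  have h1 : ContinuousMap.compStarAlgHom' ℂ ℂ q (coordFun x i)
      = gelfandStarTransform S ⟨x i, hxS i⟩ := by
    ext χ
    exact (hre χ i).1.symm
  simp only [StarAlgHom.comp_apply, h1]
  have h2 : (gelfandStarTransform S).symm (gelfandStarTransform S ⟨x i, hxS i⟩) = ⟨x i, hxS i⟩ :=
    StarAlgEquiv.symm_apply_apply _ _
  exact congrArg Subtype.val h2

/-- The homomorphism that underlies `jointCfc`. -/
theorem exists_jointCfc_eq {x : Fin n → M} (hsa : ∀ i, IsSelfAdjoint (x i))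
    (hcomm : ∀ i j, x i * x j = x j * x i) :
    ∃ Φ : C(spectralBox x, ℂ) →⋆ₐ[ℂ] M, (∀ i, Φ (coordFun x i) = x i) ∧
      ∀ (f : (Fin n → ℝ) → ℝ) (hf : ContinuousOn f (spectralBox x)),
        jointCfc x f = Φ (restrictFun x f hf) := by
  have h := exists_jointHom hsa hcomm
  refine ⟨h.choose, h.choose_spec, fun f hf => ?_⟩
  rw [jointCfc, dif_pos ⟨h, hf⟩]

variable {X : Type*} [TopologicalSpace X]

/-- The restriction of a homomorphism `C(X, ℂ) → M` to real functions. -/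
def realHom (Φ : C(X, ℂ) →⋆ₐ[ℂ] M) : C(X, ℝ) →+* M :=
  (Φ : C(X, ℂ) →+* M).comp (RingHom.compLeftContinuous X Complex.ofRealHom Complex.continuous_ofReal)

theorem realHom_apply (Φ : C(X, ℂ) →⋆ₐ[ℂ] M) (g : C(X, ℝ)) :
    realHom Φ g = Φ ⟨fun p => (g p : ℂ), Complex.continuous_ofReal.comp g.continuous⟩ := rfl

theorem realHom_isSelfAdjoint (Φ : C(X, ℂ) →⋆ₐ[ℂ] M) (g : C(X, ℝ)) :
    IsSelfAdjoint (realHom Φ g) := by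
  rw [realHom_apply, IsSelfAdjoint, ← map_star]
  congr 1
  ext p
  exact Complex.conj_ofReal _

theorem realHom_const (Φ : C(X, ℂ) →⋆ₐ[ℂ] M) (r : ℝ) :
    realHom Φ (ContinuousMap.const X r) = (r : ℂ) • 1 := by
  rw [realHom_apply, ← map_one Φ, ← map_smul]
  congr 1
  ext p
  simp

theorem realHom_smul (Φ : C(X, ℂ) →⋆ₐ[ℂ] M) (r : ℝ) (g : C(X, ℝ)) :
    realHom Φ (r • g) = (r : ℂ) • realHom Φ g := by
  rw [realHom_apply, realHom_apply, ← map_smul]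
  congr 1
  ext p
  simp

/-- The square root of a real continuous function. -/
def sqrtFun (g : C(X, ℝ)) : C(X, ℝ) := ⟨fun p => √(g p), g.continuous.sqrt⟩

theorem sqrtFun_mul_self {g : C(X, ℝ)} (hg : 0 ≤ g) : sqrtFun g * sqrtFun g = g := by
  ext p
  exact Real.mul_self_sqrt (hg p)

theorem realHom_nonneg [PartialOrder M] [StarOrderedRing M] (Φ : C(X, ℂ) →⋆ₐ[ℂ] M) {g : C(X, ℝ)}
    (hg : 0 ≤ g) : 0 ≤ realHom Φ g := by
  rw [← sqrtFun_mul_self hg, map_mul]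
  nth_rw 1 [← (realHom_isSelfAdjoint Φ (sqrtFun g)).star_eq]
  exact star_mul_self_nonneg _

theorem realHom_mono [PartialOrder M] [StarOrderedRing M] (Φ : C(X, ℂ) →⋆ₐ[ℂ] M) {g h : C(X, ℝ)}
    (hgh : g ≤ h) : realHom Φ g ≤ realHom Φ h := by
  rw [← sub_nonneg, ← map_sub]
  exact realHom_nonneg Φ (sub_nonneg.2 hgh)

theorem norm_realHom_le [CompactSpace X] (Φ : C(X, ℂ) →⋆ₐ[ℂ] M) {g : C(X, ℝ)} {r : ℝ} (hr : 0 ≤ r)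
    (hg : ∀ p, |g p| ≤ r) : ‖realHom Φ g‖ ≤ r := by
  rw [realHom_apply]
  refine (NonUnitalStarAlgHom.norm_apply_le Φ _).trans ?_
  rw [ContinuousMap.norm_le _ hr]
  intro p
  simpa using hg p

end Joint

/-! ### Weak⋆ integrals and the spectrum of the integral -/

section Integral

variable {A : Type*} [NonUnitalCStarAlgebra A] [PartialOrder A] [StarOrderedRing A]
  {T : Type*} [MeasurableSpace T] {μ : Measure T}

theorem HasWeakStarIntegral.sub {m m' : T → 𝓜(ℂ, A)} {J J' : 𝓜(ℂ, A)}
    (h : HasWeakStarIntegral μ m J) (h' : HasWeakStarIntegral μ m' J') :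
    HasWeakStarIntegral μ (fun t => m t - m' t) (J - J') := by
  intro ω
  have e : ∀ m m' : 𝓜(ℂ, A), extFunctional ω (m - m') = extFunctional ω m - extFunctional ω m' :=
    fun m m' => map_sub (ext ω) m m'
  simp only [e]
  exact ⟨(h ω).1.sub (h' ω).1, by rw [integral_sub (h ω).1 (h' ω).1, (h ω).2, (h' ω).2]⟩

theorem HasWeakStarIntegral.add {m m' : T → 𝓜(ℂ, A)} {J J' : 𝓜(ℂ, A)}
    (h : HasWeakStarIntegral μ m J) (h' : HasWeakStarIntegral μ m' J') :
    HasWeakStarIntegral μ (fun t => m t + m' t) (J + J') := by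
  intro ω
  have e : ∀ m m' : 𝓜(ℂ, A), extFunctional ω (m + m') = extFunctional ω m + extFunctional ω m' :=
    fun m m' => map_add (ext ω) m m'
  simp only [e]
  exact ⟨(h ω).1.add (h' ω).1, by rw [integral_add (h ω).1 (h' ω).1, (h ω).2, (h' ω).2]⟩

theorem HasWeakStarIntegral.smul {m : T → 𝓜(ℂ, A)} {J : 𝓜(ℂ, A)}
    (h : HasWeakStarIntegral μ m J) (c : ℂ) :
    HasWeakStarIntegral μ (fun t => c • m t) (c • J) := by
  intro ω
  have e : ∀ m : 𝓜(ℂ, A), extFunctional ω (c • m) = c * extFunctional ω m :=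
    fun m => map_smul (ext ω) c m
  simp only [e]
  exact ⟨(h ω).1.const_mul c, by rw [integral_const_mul, (h ω).2]⟩

theorem HasWeakStarIntegral.zero : HasWeakStarIntegral μ (fun _ : T => (0 : 𝓜(ℂ, A))) 0 := by
  intro ω
  have e : extFunctional ω (0 : 𝓜(ℂ, A)) = 0 := map_zero (ext ω)
  simp [e]

theorem HasWeakStarIntegral.sum {ι : Type*} (s : Finset ι) {m : ι → T → 𝓜(ℂ, A)}
    {J : ι → 𝓜(ℂ, A)} (h : ∀ i ∈ s, HasWeakStarIntegral μ (m i) (J i)) :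
    HasWeakStarIntegral μ (fun t => ∑ i ∈ s, m i t) (∑ i ∈ s, J i) := by
  classical
  induction s using Finset.induction_on with
  | empty => simpa using HasWeakStarIntegral.zero
  | insert i s hi ih =>
    simp only [Finset.sum_insert hi]
    exact (h i (Finset.mem_insert_self _ _)).add
      (ih fun j hj => h j (Finset.mem_insert_of_mem hj))

theorem HasWeakStarIntegral.ext_nonneg {m : T → 𝓜(ℂ, A)} {J : 𝓜(ℂ, A)}
    (h : HasWeakStarIntegral μ m J) (hm : ∀ t, 0 ≤ m t) (ω : A →ₚ[ℂ] ℂ) :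
    0 ≤ ext (posCLM ω) J := by
  rw [ext_apply, ← (h (posCLM ω)).2]
  exact integral_nonneg_of_ae (Eventually.of_forall fun t => JensenCStar.ext_nonneg ω (hm t))

theorem HasWeakStarIntegral.nonneg {m : T → 𝓜(ℂ, A)} {J : 𝓜(ℂ, A)}
    (h : HasWeakStarIntegral μ m J) (hm : ∀ t, 0 ≤ m t) : 0 ≤ J :=
  multiplier_nonneg_of_forall_ext (h.ext_nonneg hm)

/-- Integration against a unital column field is unital. -/
theorem IsUnitalColumnField.integral_const {a : T → 𝓜(ℂ, A)} (ha : IsUnitalColumnField μ a)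
    (c : ℂ) : HasWeakStarIntegral μ (fun t => star (a t) * (c • 1) * a t) (c • 1) := by
  have := ha.2.smul c
  simpa using this

omit [PartialOrder A] [StarOrderedRing A] [MeasurableSpace T] in
theorem column_sub {a : T → 𝓜(ℂ, A)} (d d' : T → 𝓜(ℂ, A)) :
    (fun t => star (a t) * (d t - d' t) * a t)
      = fun t => star (a t) * d t * a t - star (a t) * d' t * a t := by
  ext1 t; rw [mul_sub, sub_mul]

/-- If a positive functional annihilates the compression of a field of strictly positive
multipliers by a unital column field, then it vanishes. -/
theorem ext_one_eq_zero_of_strictlyPositive {a d : T → 𝓜(ℂ, A)} (ha : IsUnitalColumnField μ a)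
    {D : 𝓜(ℂ, A)} (hd : ∀ t, 0 ≤ d t) (hu : ∀ t, IsUnit (d t))
    (hD : HasWeakStarIntegral μ (fun t => star (a t) * d t * a t) D) (ω : A →ₚ[ℂ] ℂ)
    (h0 : ext (posCLM ω) D = 0) : ext (posCLM ω) (1 : 𝓜(ℂ, A)) = 0 := by
  cases subsingleton_or_nontrivial 𝓜(ℂ, A)
  · rw [Subsingleton.elim (1 : 𝓜(ℂ, A)) 0, map_zero]
  obtain ⟨hi, hI⟩ := hD (posCLM ω)
  obtain ⟨-, hJ⟩ := ha.2 (posCLM ω)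
  have hnn : ∀ t, 0 ≤ ext (posCLM ω) (star (a t) * d t * a t) := fun t =>
    ext_nonneg ω (star_left_conjugate_nonneg (hd t) _)
  have hre : ∫ t, (ext (posCLM ω) (star (a t) * d t * a t)).re ∂μ = 0 := by
    have h1 := integral_re hi
    simp only [RCLike.re_to_complex] at h1
    rw [hI, ← ext_apply, h0] at h1
    simpa [ext_apply] using h1
  rw [integral_eq_zero_iff_of_nonneg (fun t => (hnn t).1) hi.re] at hre
  rw [ext_apply, ← hJ]
  refine integral_eq_zero_of_ae ?_
  filter_upwards [hre] with t ht
  obtain ⟨ε, hε, hle⟩ := (CFC.exists_pos_algebraMap_le_iff (.of_nonneg (hd t))).2 fun r hr => by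
    have h1 := spectrum_nonneg_of_nonneg (hd t) hr
    refine lt_of_le_of_ne h1 ?_
    rintro rfl
    exact spectrum.zero_notMem_iff ℝ |>.2 (hu t) hr
  have h1 : (ε : ℂ) • (star (a t) * a t) ≤ star (a t) * d t * a t := by
    have := star_left_conjugate_le_conjugate hle (a t)
    rwa [algebraMap_eq_smul, mul_smul_comm, mul_one, smul_mul_assoc] at this
  have h2 := (ext_mono ω h1).1
  have h3 : 0 ≤ ext (posCLM ω) (star (a t) * a t) := ext_nonneg ω (star_mul_self_nonneg _)
  rw [map_smul, smul_eq_mul, Complex.re_ofReal_mul] at h2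
  simp only [Pi.zero_apply] at ht
  rw [ht] at h2
  have h4 : (ext (posCLM ω) (star (a t) * a t)).re ≤ 0 := by
    by_contra! h
    nlinarith
  exact Complex.ext (le_antisymm h4 h3.1) h3.2.symm

/-- A positive functional with `ω 1 = 0` vanishes. -/
theorem apply_eq_zero_of_ext_one_eq_zero {ω : A →ₚ[ℂ] ℂ} (h : ext (posCLM ω) (1 : 𝓜(ℂ, A)) = 0)
    (b : A) : ω b = 0 := by
  have h1 := norm_apply_sq_le ω b
  have h2 : ext (posCLM ω) ((star b * b : A) : 𝓜(ℂ, A)) ≤ 0 := by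
    refine (ext_mono ω (le_norm_mul_one (.star_mul_self b))).trans ?_
    rw [algebraMap_eq_smul, map_smul, h, smul_zero]
  rw [ext_coe, posCLM_apply] at h2
  have h3 : ‖ω b‖ ^ 2 ≤ 0 :=
    h1.trans (mul_nonpos_of_nonneg_of_nonpos (norm_nonneg _) h2.1)
  exact norm_eq_zero.1 (pow_eq_zero_iff two_ne_zero |>.1 (le_antisymm h3 (by positivity)))

/-- The restriction to `A` of a positive functional on the multiplier algebra. -/
def restrictPos (ω : 𝓜(ℂ, A) →ₚ[ℂ] ℂ) : A →ₚ[ℂ] ℂ :=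
  PositiveLinearMap.mk₀ (ω.toLinearMap ∘ₗ (incl A : A →ₗ[ℂ] 𝓜(ℂ, A)))
    fun _ ha => ω.map_nonneg (coe_nonneg.2 ha)

theorem restrictPos_apply (ω : 𝓜(ℂ, A) →ₚ[ℂ] ℂ) (a : A) :
    restrictPos ω a = ω (a : 𝓜(ℂ, A)) := rfl

/-- The integral `∫ a⋆ x a` of a bounded self-adjoint field is self-adjoint. -/
theorem isSelfAdjoint_of_integral {a : T → 𝓜(ℂ, A)} (ha : IsUnitalColumnField μ a) {x : T → A}
    (hsa : ∀ t, IsSelfAdjoint (x t)) (hbdd : ∃ R : ℝ, ∀ t, ‖x t‖ ≤ R) {y : 𝓜(ℂ, A)}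
    (hy : HasWeakStarIntegral μ (fun t => star (a t) * (x t : 𝓜(ℂ, A)) * a t) y) :
    IsSelfAdjoint y := by
  obtain ⟨R, hR⟩ := hbdd
  have h1 := (ha.integral_const (R : ℂ)).sub hy
  rw [← column_sub] at h1
  have h2 := h1.nonneg fun t => star_left_conjugate_nonneg (by
    rw [sub_nonneg, ← algebraMap_eq_smul]
    exact (le_norm_mul_one (hsa t)).trans (algebraMap_mono (hR t))) _
  have h3 : IsSelfAdjoint ((R : ℂ) • (1 : 𝓜(ℂ, A))) := by
    rw [IsSelfAdjoint, star_smul, star_one, Complex.star_def, Complex.conj_ofReal]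
  have := h3.sub (.of_nonneg h2)
  rwa [sub_sub_cancel] at this

/-- For `λ ∈ sp y` there is a state of the multiplier algebra concentrated at `λ`: it takes the
value `λ` at `y`, and the strictly continuous extension of its restriction to `A`, which is another
functional in general, annihilates `λ - y`. -/
theorem exists_state_of_mem_spectrum {y : A} (hy : IsSelfAdjoint y) {l : ℝ}
    (hl : l ∈ spectrum ℝ (y : 𝓜(ℂ, A))) :
    ∃ ω : 𝓜(ℂ, A) →ₚ[ℂ] ℂ, ω 1 = 1 ∧ ω (y : 𝓜(ℂ, A)) = l ∧
      ext (posCLM (restrictPos ω)) ((l : ℂ) • 1 - (y : 𝓜(ℂ, A))) = 0 := by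
  set u : 𝓜(ℂ, A) := (l : ℂ) • 1 - (y : 𝓜(ℂ, A)) with hu
  have husa : star u = u := by
    rw [hu, star_sub, star_smul, star_one, Complex.star_def, Complex.conj_ofReal,
      (isSelfAdjoint_coe.2 hy).star_eq]
  have hnu : ¬ IsUnit (star u * u) := by
    rw [husa, (Commute.refl u).isUnit_mul_iff]
    rw [spectrum.mem_iff, algebraMap_eq_smul] at hl
    exact fun h => hl h.1
  obtain ⟨ω, h1, h0⟩ := exists_state_apply_eq_zero (star_mul_self_nonneg u) hnu
  have hcs : ∀ v : 𝓜(ℂ, A), ω (u * v) = 0 := by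
    intro v
    have := cauchySchwarz ω u v
    rw [h0, husa, Complex.zero_re, zero_mul] at this
    exact norm_eq_zero.1 (pow_eq_zero_iff two_ne_zero |>.1 (le_antisymm this (by positivity)))
  refine ⟨ω, h1, ?_, ?_⟩
  · have := hcs 1
    rw [mul_one, hu, map_sub, map_smul, h1, sub_eq_zero, smul_eq_mul, mul_one] at this
    exact this.symm
  · refine tendsto_nhds_unique (tendsto_extFunctional (posCLM (restrictPos ω)) u) ?_
    refine tendsto_const_nhds.congr fun e => ?_
    rw [posCLM_apply, restrictPos_apply, ← mul_coe, hcs]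

/-- The spectrum of `∫ a⋆ x a` lies in any interval that contains the spectra of the `x t`. -/
theorem spectrum_integral_subset {I : Set ℝ} (hI : I.OrdConnected) {a : T → 𝓜(ℂ, A)}
    (ha : IsUnitalColumnField μ a) {x : T → A} (hsa : ∀ t, IsSelfAdjoint (x t))
    (hspec : ∀ t, spectrum ℝ (x t : 𝓜(ℂ, A)) ⊆ I) {y : A} (hysa : IsSelfAdjoint y)
    (hy : HasWeakStarIntegral μ (fun t => star (a t) * (x t : 𝓜(ℂ, A)) * a t) (y : 𝓜(ℂ, A))) :
    spectrum ℝ (y : 𝓜(ℂ, A)) ⊆ I := by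
  intro l hl
  by_contra hlI
  obtain ⟨ω, h1, hωy, hω⟩ := exists_state_of_mem_spectrum hysa hl
  have hdiff := (ha.integral_const (l : ℂ)).sub hy
  rw [← column_sub] at hdiff
  have hunit : ∀ t, IsUnit ((l : ℂ) • 1 - (x t : 𝓜(ℂ, A))) := by
    intro t
    by_contra hn
    refine hlI (hspec t ?_)
    rwa [spectrum.mem_iff, algebraMap_eq_smul]
  have hxsa := fun t => isSelfAdjoint_coe.2 (hsa t)
  have hext : ext (posCLM (restrictPos ω)) (1 : 𝓜(ℂ, A)) = 0 := by
    by_cases hlt : ∀ s ∈ I, s < l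
    · refine ext_one_eq_zero_of_strictlyPositive ha (fun t => ?_) hunit hdiff _ hω
      rw [sub_nonneg, ← algebraMap_eq_smul, le_algebraMap_iff_spectrum_le]
      exact fun s hs => (hlt s (hspec t hs)).le
    · push Not at hlt
      obtain ⟨s₀, hs₀, hls₀⟩ := hlt
      have hgt : ∀ s ∈ I, l < s := by
        intro s hs
        by_contra! hsl
        exact hlI (hI.out hs hs₀ ⟨hsl, hls₀⟩)
      have hdiff' := hy.sub (ha.integral_const (l : ℂ))
      rw [← column_sub] at hdiff'
      refine ext_one_eq_zero_of_strictlyPositive ha (fun t => ?_) (fun t => ?_) hdiff' _ ?_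
      · rw [sub_nonneg, ← algebraMap_eq_smul, algebraMap_le_iff_le_spectrum]
        exact fun s hs => (hgt s (hspec t hs)).le
      · rw [← neg_sub]; exact (hunit t).neg
      · rw [← neg_sub, map_neg, hω, neg_zero]
  have hzero : ∀ b : A, ω (b : 𝓜(ℂ, A)) = 0 := fun b => apply_eq_zero_of_ext_one_eq_zero hext b
  have hl0 : l = 0 := by
    have := hzero y
    rw [hωy] at this
    exact_mod_cast this
  -- now `0 ∉ I`, so that `A` contains invertible multipliers and hence the unit
  have hone : ∃ e : A, (e : 𝓜(ℂ, A)) = 1 := by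
    cases isEmpty_or_nonempty T with
    | inl hT =>
      refine ⟨0, multiplier_eq_of_forall_ext fun ω' => ?_⟩
      rw [coe_zero, map_zero, ext_apply, ← (ha.2 (posCLM ω')).2, Measure.eq_zero_of_isEmpty μ]
      simp
    | inr hT =>
      obtain ⟨t⟩ := hT
      have hu := hunit t
      rw [hl0, Complex.ofReal_zero, zero_smul, zero_sub] at hu
      obtain ⟨v, hv⟩ := hu.exists_right_inv
      refine ⟨-(v : 𝓜(ℂ, A)).snd (x t), ?_⟩
      rw [coe_neg, ← coe_mul, ← neg_mul, hv]
  obtain ⟨e, he⟩ := hone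
  have := hzero e
  rw [he, h1] at this
  exact one_ne_zero this

end Integral

/-! ### The minimal dense ideal -/

section MinimalIdeal

variable {A : Type*} [NonUnitalCStarAlgebra A]

theorem mem_minimalDenseIdeal {x : A} : x ∈ minimalDenseIdeal A ↔
    ∀ J : Submodule ℂ A, (∀ x ∈ J, ∀ b : A, b * x ∈ J ∧ x * b ∈ J) → Dense (J : Set A) → x ∈ J := by
  simp only [minimalDenseIdeal, Submodule.mem_sInf, Set.mem_ofPred_eq, and_imp]

theorem mul_mem_minimalDenseIdeal {x : A} (hx : x ∈ minimalDenseIdeal A) (b : A) :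
    b * x ∈ minimalDenseIdeal A ∧ x * b ∈ minimalDenseIdeal A := by
  simp only [mem_minimalDenseIdeal] at hx ⊢
  exact ⟨fun J hJ hd => (hJ x (hx J hJ hd) b).1, fun J hJ hd => (hJ x (hx J hJ hd) b).2⟩

/-- Elements with a right unit in `A` belong to the minimal dense ideal: if `h χ = h` and `v` is an
element of a dense ideal with `‖χ - v‖ < 1`, then `h v = h (1 - (χ - v))`, where the second factor
is invertible. -/
theorem mem_minimalDenseIdeal_of_mul_eq {h χ : A} (hχ : h * χ = h) : h ∈ minimalDenseIdeal A := by
  rw [mem_minimalDenseIdeal]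
  intro J hJ hd
  obtain ⟨v, hv, hvχ⟩ := hd.exists_dist_lt χ one_pos
  rw [dist_eq_norm] at hvχ
  have hu : IsUnit (1 - ((χ - v : A) : 𝓜(ℂ, A))) :=
    isUnit_one_sub_of_norm_lt_one (by rwa [norm_coe])
  obtain ⟨w, hw⟩ := hu.exists_right_inv
  have h1 : (h : 𝓜(ℂ, A)) * (1 - ((χ - v : A) : 𝓜(ℂ, A))) = ((h * v : A) : 𝓜(ℂ, A)) := by
    rw [mul_sub, mul_one, ← coe_mul_coe, mul_sub h, hχ, coe_sub, sub_sub_cancel]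
  have h2 : h = h * v + (h * v) * w.snd (χ - v) := by
    have hw' : w = 1 + ((χ - v : A) : 𝓜(ℂ, A)) * w := by
      rwa [sub_mul, one_mul, sub_eq_iff_eq_add] at hw
    rw [← coe_inj, coe_add, coe_mul_coe (h * v), ← coe_mul]
    calc (h : 𝓜(ℂ, A)) = h * ((1 - ((χ - v : A) : 𝓜(ℂ, A))) * w) := by rw [hw, mul_one]
      _ = ((h * v : A) : 𝓜(ℂ, A)) * w := by rw [← mul_assoc, h1]
      _ = ((h * v : A) : 𝓜(ℂ, A)) * (1 + ((χ - v : A) : 𝓜(ℂ, A)) * w) := by rw [← hw']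
      _ = _ := by rw [mul_add, mul_one]
  rw [h2]
  have hhv := (hJ v hv h).1
  exact J.add_mem hhv (hJ _ hhv _).2

variable [PartialOrder A] [StarOrderedRing A]

open CStarAlgebra in
/-- The minimal dense ideal is a two-sided module over the multiplier algebra. -/
theorem fst_mem_minimalDenseIdeal {x : A} (hx : x ∈ minimalDenseIdeal A) (m : 𝓜(ℂ, A)) :
    m.fst x ∈ minimalDenseIdeal A := by
  rw [mem_minimalDenseIdeal]
  intro J hJ hd
  -- `A J` is a dense ideal on which multipliers act
  let J' : Submodule ℂ A := Submodule.span ℂ {z | ∃ b : A, ∃ j ∈ J, z = b * j}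
  have hJ' : ∀ x ∈ J', ∀ b : A, b * x ∈ J' ∧ x * b ∈ J' := by
    intro x hx b
    induction hx using Submodule.span_induction with
    | mem z hz =>
      obtain ⟨c, j, hj, rfl⟩ := hz
      exact ⟨Submodule.subset_span ⟨b * c, j, hj, (mul_assoc _ _ _).symm⟩,
        Submodule.subset_span ⟨c, j * b, (hJ j hj b).2, mul_assoc _ _ _⟩⟩
    | zero => simp
    | add z w _ _ h h' =>
      rw [mul_add, add_mul]
      exact ⟨J'.add_mem h.1 h'.1, J'.add_mem h.2 h'.2⟩
    | smul c z _ h =>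
      rw [mul_smul_comm, smul_mul_assoc]
      exact ⟨J'.smul_mem c h.1, J'.smul_mem c h.2⟩
  have hd' : Dense (J' : Set A) := by
    intro a
    rw [← closure_closure]
    refine mem_closure_of_tendsto ((increasingApproximateUnit A).tendsto_mul_right a)
      (Eventually.of_forall fun e => ?_)
    exact map_mem_closure (continuous_const_mul e) (hd a)
      fun j hj => Submodule.subset_span ⟨e, j, hj, rfl⟩
  have hxJ := mem_minimalDenseIdeal.1 hx J' hJ' hd'
  clear hx
  induction hxJ using Submodule.span_induction with
  | mem z hz =>
    obtain ⟨c, j, hj, rfl⟩ := hz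
    rw [fst_mul]
    exact (hJ j hj _).1
  | zero => simp
  | add z w _ _ h h' => rw [map_add]; exact J.add_mem h h'
  | smul c z _ h => rw [map_smul]; exact J.smul_mem c h

/-- A positive element is a limit of smaller positive elements of the minimal dense ideal. -/
theorem exists_seq_minimalDenseIdeal {x : A} (hx : 0 ≤ x) :
    ∃ z : ℕ → A, (∀ k, z k ∈ minimalDenseIdeal A) ∧ (∀ k, 0 ≤ z k) ∧ (∀ k, z k ≤ x) ∧
      Tendsto z atTop (𝓝 x) := by
  have hq : ∀ s ∈ quasispectrum ℝ x, 0 ≤ s := fun s hs => quasispectrum_nonneg_of_nonneg x hx s hs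
  have key : ∀ δ : ℝ, 0 < δ → ∃ z ∈ minimalDenseIdeal A, 0 ≤ z ∧ z ≤ x ∧ ‖x - z‖ ≤ δ := by
    intro δ hδ
    have hf0 : (fun s : ℝ => max (s - δ) 0) 0 = 0 := by simp [hδ.le]
    have hg0 : (fun s : ℝ => min (s / δ) 1) 0 = 0 := by simp
    refine ⟨cfcₙ (fun s : ℝ => max (s - δ) 0) x, ?_, ?_, ?_, ?_⟩
    · apply mem_minimalDenseIdeal_of_mul_eq (χ := cfcₙ (fun s : ℝ => min (s / δ) 1) x)
      rw [← cfcₙ_mul (fun s : ℝ => max (s - δ) 0) (fun s : ℝ => min (s / δ) 1) x (by fun_prop) hf0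
        (by fun_prop) hg0]
      refine cfcₙ_congr fun s hs => ?_
      rcases le_total s δ with h | h
      · rw [max_eq_right (by linarith), zero_mul]
      · rw [min_eq_right ((one_le_div hδ).2 h), mul_one]
    · exact cfcₙ_nonneg fun s _ => le_max_right _ _
    · conv_rhs => rw [← cfcₙ_id' ℝ x]
      refine cfcₙ_mono (fun s hs => ?_) (by fun_prop) (by fun_prop) hf0
      exact max_le (by linarith) (hq s hs)
    · nth_rw 1 [← cfcₙ_id' ℝ x]
      rw [← cfcₙ_sub (fun s : ℝ => s) (fun s : ℝ => max (s - δ) 0) x (by fun_prop) rfl (by fun_prop) hf0]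
      refine norm_cfcₙ_le fun s hs => ?_
      have := hq s hs
      rw [Real.norm_eq_abs, abs_le]
      rcases le_total s δ with h | h
      · rw [max_eq_right (by linarith)]; constructor <;> linarith
      · rw [max_eq_left (by linarith)]; constructor <;> linarith
  choose z hz using fun k : ℕ => key (1 / ((k : ℝ) + 1)) (by positivity)
  refine ⟨z, fun k => (hz k).1, fun k => (hz k).2.1, fun k => (hz k).2.2.1, ?_⟩
  rw [tendsto_iff_norm_sub_tendsto_zero]
  refine squeeze_zero (fun _ => norm_nonneg _) (fun k => ?_) tendsto_one_div_add_atTop_nhds_zero_nat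
  rw [norm_sub_rev]
  exact (hz k).2.2.2

theorem dense_minimalDenseIdeal : Dense (minimalDenseIdeal A : Set A) := by
  have hpos : ∀ x : A, 0 ≤ x → x ∈ (minimalDenseIdeal A).topologicalClosure := by
    intro x hx
    obtain ⟨z, hz, -, -, h⟩ := exists_seq_minimalDenseIdeal hx
    exact mem_closure_of_tendsto h (Eventually.of_forall hz)
  intro a
  obtain ⟨x, hx, -, rfl⟩ := CStarAlgebra.exists_sum_four_nonneg a
  exact (minimalDenseIdeal A).topologicalClosure.sum_mem fun i _ =>
    Submodule.smul_mem _ _ (hpos _ (hx i))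

/-- The minimal dense ideal is spanned by the elements `w⋆ w` with `w` in the ideal. -/
theorem minimalDenseIdeal_le_span :
    minimalDenseIdeal A ≤ Submodule.span ℂ {z | ∃ w ∈ minimalDenseIdeal A, z = star w * w} := by
  let J : Submodule ℂ A := Submodule.span ℂ
    {z | ∃ u ∈ minimalDenseIdeal A, ∃ v ∈ minimalDenseIdeal A, z = star u * v}
  have hJ : ∀ x ∈ J, ∀ b : A, b * x ∈ J ∧ x * b ∈ J := by
    intro x hx b
    induction hx using Submodule.span_induction with
    | mem z hz =>
      obtain ⟨u, hu, v, hv, rfl⟩ := hz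
      exact ⟨Submodule.subset_span ⟨u * star b, (mul_mem_minimalDenseIdeal hu _).2, v, hv, by
        rw [star_mul, star_star, mul_assoc]⟩,
        Submodule.subset_span ⟨u, hu, v * b, (mul_mem_minimalDenseIdeal hv _).2, mul_assoc _ _ _⟩⟩
    | zero => simp
    | add z w _ _ h h' =>
      rw [mul_add, add_mul]
      exact ⟨J.add_mem h.1 h'.1, J.add_mem h.2 h'.2⟩
    | smul c z _ h =>
      rw [mul_smul_comm, smul_mul_assoc]
      exact ⟨J.smul_mem c h.1, J.smul_mem c h.2⟩
  have hd : Dense (J : Set A) := by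
    intro a
    rw [← closure_closure]
    refine mem_closure_of_tendsto
      ((CStarAlgebra.increasingApproximateUnit A).tendsto_mul_right a)
      (Eventually.of_forall fun e => ?_)
    have h1 := map_mem_closure₂ (f := fun u v : A => star u * v) (by fun_prop)
      (dense_minimalDenseIdeal (star e)) (dense_minimalDenseIdeal a) (u := (J : Set A))
      fun u hu v hv => Submodule.subset_span ⟨u, hu, v, hv, rfl⟩
    simpa using h1
  intro x hx
  have hxJ := mem_minimalDenseIdeal.1 hx J hJ hd
  refine (Submodule.span_le.2 ?_ : J ≤ _) hxJ
  rintro _ ⟨u, hu, v, hv, rfl⟩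
  have hpol : star u * v = (1 / 4 : ℂ) • ((star (u + v) * (u + v)
      - star (u - v) * (u - v)) + ((-Complex.I) • (star (u + Complex.I • v) * (u + Complex.I • v))
      + Complex.I • (star (u - Complex.I • v) * (u - Complex.I • v)))) := by
    simp only [star_add, star_sub, star_smul, add_mul, mul_add, sub_mul, mul_sub, smul_add,
      smul_sub, smul_mul_assoc, mul_smul_comm, smul_smul, RCLike.star_def, Complex.conj_I,
      neg_smul, neg_mul, Complex.I_mul_I, neg_neg, one_smul, smul_neg]
    module
  have hmem : ∀ c : ℂ, star (u + c • v) * (u + c • v) ∈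
      Submodule.span ℂ {z | ∃ w ∈ minimalDenseIdeal A, z = star w * w} := fun c =>
    Submodule.subset_span ⟨_, Submodule.add_mem _ hu (Submodule.smul_mem _ _ hv), rfl⟩
  have m1 := hmem 1
  have m2 := hmem (-1)
  have m3 := hmem Complex.I
  have m4 := hmem (-Complex.I)
  simp only [one_smul, neg_smul, ← sub_eq_add_neg] at m1 m2 m4
  rw [hpol]
  exact Submodule.smul_mem _ _ (Submodule.add_mem _ (Submodule.sub_mem _ m1 m2)
    (Submodule.add_mem _ (Submodule.smul_mem _ _ m3) (Submodule.smul_mem _ _ m4)))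

theorem minimalDenseIdeal_induction {P : A → Prop}
    (hpos : ∀ x ∈ minimalDenseIdeal A, 0 ≤ x → P x) (hadd : ∀ x y, P x → P y → P (x + y))
    (hsmul : ∀ (c : ℂ) x, P x → P (c • x)) {x : A} (hx : x ∈ minimalDenseIdeal A) : P x := by
  have h := minimalDenseIdeal_le_span hx
  clear hx
  induction h using Submodule.span_induction with
  | mem z hz =>
    obtain ⟨w, hw, rfl⟩ := hz
    exact hpos _ (mul_mem_minimalDenseIdeal hw _).1 (star_mul_self_nonneg w)
  | zero => exact hpos 0 (Submodule.zero_mem _) le_rfl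
  | add z w _ _ h h' => exact hadd _ _ h h'
  | smul c z _ h => exact hsmul c z h

theorem star_mem_minimalDenseIdeal {x : A} (hx : x ∈ minimalDenseIdeal A) :
    star x ∈ minimalDenseIdeal A := by
  refine minimalDenseIdeal_induction (P := fun x => star x ∈ minimalDenseIdeal A)
    (fun x hx h0 => ?_) (fun x y h h' => ?_) (fun c x h => ?_) hx
  · rwa [(IsSelfAdjoint.of_nonneg h0).star_eq]
  · rw [star_add]; exact Submodule.add_mem _ h h'
  · rw [star_smul]; exact Submodule.smul_mem _ _ h

theorem snd_mem_minimalDenseIdeal {x : A} (hx : x ∈ minimalDenseIdeal A) (m : 𝓜(ℂ, A)) :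
    m.snd x ∈ minimalDenseIdeal A := by
  have h := star_mem_minimalDenseIdeal
    (fst_mem_minimalDenseIdeal (star_mem_minimalDenseIdeal hx) (star m))
  simpa using h

theorem sandwich_mem_minimalDenseIdeal {x : A} (hx : x ∈ minimalDenseIdeal A) (m : 𝓜(ℂ, A)) :
    sandwich m x ∈ minimalDenseIdeal A :=
  snd_mem_minimalDenseIdeal (fst_mem_minimalDenseIdeal hx m) (star m)

end MinimalIdeal

/-! ### Unbounded functionals and their centralizers -/

/-- The seminorm of a positive semidefinite sesquilinear form, with the Cauchy-Schwarz
inequality. -/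
theorem exists_seminorm_of_core {E : Type*} [AddCommGroup E] [Module ℂ E]
    (c : PreInnerProductSpace.Core ℂ E) :
    ∃ p : Seminorm ℂ E, (∀ u, p u = √(c.inner u u).re) ∧
      ∀ u v, ‖c.inner u v‖ ≤ p u * p v := by
  let _ : SeminormedAddCommGroup E := InnerProductSpace.Core.toSeminormedAddCommGroup (𝕜 := ℂ)
  let _ : NormedSpace ℂ E := InnerProductSpace.Core.toNormedSpace
  exact ⟨normSeminorm ℂ E, fun u => rfl,
    fun u v => InnerProductSpace.Core.norm_inner_le_norm (c := c) u v⟩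

/-- An induction principle for real continuous functions on compact subsets of `ℝⁿ`, by the
Stone-Weierstrass theorem. -/
theorem continuousMap_induction {n : ℕ} {S : Set (Fin n → ℝ)} [CompactSpace S]
    {P : C(S, ℝ) → Prop} (hconst : ∀ r : ℝ, P (ContinuousMap.const S r))
    (hcoord : ∀ i, P ⟨fun p => (p : Fin n → ℝ) i, (continuous_apply i).comp continuous_subtype_val⟩)
    (hadd : ∀ g h, P g → P h → P (g + h)) (hmul : ∀ g h, P g → P h → P (g * h))
    (hclosed : IsClosed {g | P g}) (g : C(S, ℝ)) : P g := by
  let L : Subalgebra ℝ C(S, ℝ) :=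
    { carrier := {g | P g}
      mul_mem' := fun {g h} => hmul g h
      add_mem' := fun {g h} => hadd g h
      algebraMap_mem' := hconst }
  have hsep : L.SeparatesPoints := by
    intro p q hpq
    obtain ⟨i, hi⟩ : ∃ i, (p : Fin n → ℝ) i ≠ (q : Fin n → ℝ) i := by
      by_contra! h
      exact hpq (Subtype.ext (funext h))
    exact ⟨_, ⟨_, hcoord i, rfl⟩, hi⟩
  have hL : L = ⊤ := by
    rw [← ContinuousMap.subalgebra_topologicalClosure_eq_top_of_separatesPoints L hsep]
    exact SetLike.coe_injective (IsClosed.closure_eq hclosed).symm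
  have : g ∈ L := hL ▸ Algebra.mem_top
  exact this

section Unbounded

variable {A : Type*} [NonUnitalCStarAlgebra A] [PartialOrder A] [StarOrderedRing A]
  {φ : A → ℝ≥0∞}

theorem IsUnboundedFunctional.map_zero (hφ : IsUnboundedFunctional φ) : φ 0 = 0 := by
  have := hφ.map_smul 0 0 le_rfl
  simpa using this

theorem IsUnboundedFunctional.mono (hφ : IsUnboundedFunctional φ) {x y : A} (hx : 0 ≤ x)
    (hxy : x ≤ y) : φ x ≤ φ y := by
  have := hφ.map_add x (y - x) hx (sub_nonneg.2 hxy)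
  rw [add_sub_cancel] at this
  rw [this]
  exact le_self_add

theorem IsUnboundedFunctional.lt_of_tendsto (hφ : IsUnboundedFunctional φ) {ι : Type*}
    {l : Filter ι} {z : ι → A} {x : A} (hz : ∀ i, 0 ≤ z i) (hx : 0 ≤ x) (h : Tendsto z l (𝓝 x))
    {r : ℝ≥0∞} (hr : r < φ x) : ∀ᶠ i in l, r < φ (z i) :=
  (tendsto_nhdsWithin_iff.2 ⟨h, Eventually.of_forall hz⟩).eventually (hφ.lsc x hx r hr)

/-- Lower semicontinuity of an unbounded functional, for upper bounds along convergent families. -/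
theorem IsUnboundedFunctional.le_of_tendsto (hφ : IsUnboundedFunctional φ) {ι : Type*}
    {l : Filter ι} [l.NeBot] {z : ι → A} {x : A} (hz : ∀ i, 0 ≤ z i) (hx : 0 ≤ x)
    (h : Tendsto z l (𝓝 x)) {r : ℝ≥0∞} (hr : ∀ i, φ (z i) ≤ r) : φ x ≤ r := by
  by_contra! hlt
  obtain ⟨i, hi⟩ := (hφ.lt_of_tendsto hz hx h hlt).exists
  exact hi.not_ge (hr i)

theorem IsUnboundedFunctional.tendsto (hφ : IsUnboundedFunctional φ) {ι : Type*}
    {l : Filter ι} {z : ι → A} {x : A} (hz : ∀ i, 0 ≤ z i) (hzx : ∀ i, z i ≤ x) (hx : 0 ≤ x)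
    (h : Tendsto z l (𝓝 x)) : Tendsto (fun i => φ (z i)) l (𝓝 (φ x)) :=
  tendsto_order.2 ⟨fun _ hr => hφ.lt_of_tendsto hz hx h hr,
    fun _ hr => Eventually.of_forall fun i => (hφ.mono (hz i) (hzx i)).trans_lt hr⟩

theorem continuous_sandwich (x : A) : Continuous fun c : 𝓜(ℂ, A) => sandwich c x := by
  have h := (NonUnitalStarAlgHom.isometry (incl A) incl_injective).isEmbedding.isInducing
  rw [h.continuous_iff]
  have h1 : Continuous fun c : 𝓜(ℂ, A) => c * (x : 𝓜(ℂ, A)) * star c := by fun_prop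
  exact h1.congr fun c => (coe_sandwich c x).symm

theorem lowerSemicontinuous_sandwich (hφ : IsUnboundedFunctional φ) {x : A} (hx : 0 ≤ x) :
    LowerSemicontinuous fun c : 𝓜(ℂ, A) => φ (sandwich c x) := by
  intro c r hr
  exact hφ.lt_of_tendsto (fun d => sandwich_nonneg d hx) (sandwich_nonneg c hx)
    ((continuous_sandwich x).tendsto c) hr

/-- The defining property of the linear extension of an unbounded functional to the minimal dense
ideal. -/
def IsLinearExtension (φ : A → ℝ≥0∞) (ψ : A →ₗ[ℂ] ℂ) : Prop :=
  ∀ x ∈ minimalDenseIdeal A, 0 ≤ x → ψ x = ((φ x).toReal : ℂ)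

variable {ψ : A →ₗ[ℂ] ℂ}

theorem IsLinearExtension.eq {ψ' : A →ₗ[ℂ] ℂ} (h : IsLinearExtension φ ψ)
    (h' : IsLinearExtension φ ψ') {x : A} (hx : x ∈ minimalDenseIdeal A) : ψ x = ψ' x :=
  minimalDenseIdeal_induction (P := fun x => ψ x = ψ' x) (fun x hx h0 => by rw [h x hx h0, h' x hx h0])
    (fun x y hx hy => by rw [map_add, map_add, hx, hy])
    (fun c x hx => by rw [map_smul, map_smul, hx]) hx

theorem IsLinearExtension.map_star (h : IsLinearExtension φ ψ) {x : A}
    (hx : x ∈ minimalDenseIdeal A) : ψ (star x) = star (ψ x) :=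
  minimalDenseIdeal_induction (P := fun x => ψ (star x) = star (ψ x))
    (fun x hx h0 => by
      rw [(IsSelfAdjoint.of_nonneg h0).star_eq, h x hx h0]; exact (Complex.conj_ofReal _).symm)
    (fun x y hx hy => by rw [star_add, map_add, map_add, hx, hy, star_add])
    (fun c x hx => by rw [star_smul, map_smul, map_smul, hx, star_smul]) hx

theorem star_fst_apply (m : 𝓜(ℂ, A)) (x : A) : star (m.fst x) = (star m).snd (star x) := by
  simp

theorem star_snd_apply (m : 𝓜(ℂ, A)) (x : A) : star (m.snd x) = (star m).fst (star x) := by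
  simp

theorem snd_fst_comm (m d : 𝓜(ℂ, A)) (x : A) : m.snd (d.fst x) = d.fst (m.snd x) := by
  rw [← coe_inj, ← coe_mul, ← mul_coe, ← mul_coe, ← coe_mul, mul_assoc]

/-- The multiplication by multipliers is continuous for a lower semicontinuous functional on the
minimal dense ideal: the seminorm `c ↦ φ (c x c⋆) ^ (1/2)` on the multiplier algebra is lower
semicontinuous, hence continuous, since Banach spaces are barrelled. -/
theorem IsLinearExtension.continuous_fst (hφ : IsUnboundedFunctional φ)
    (h : IsLinearExtension φ ψ) {x : A} (hx : x ∈ minimalDenseIdeal A) :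
    Continuous fun c : 𝓜(ℂ, A) => ψ (c.fst x) := by
  refine minimalDenseIdeal_induction (P := fun x => Continuous fun c : 𝓜(ℂ, A) => ψ (c.fst x))
    (fun x hx h0 => ?_) (fun x y hx hy => ?_) (fun c x hx => ?_) hx
  · have hsand : ∀ c : 𝓜(ℂ, A), ψ (sandwich c x) = ((φ (sandwich c x)).toReal : ℂ) := fun c =>
      h _ (sandwich_mem_minimalDenseIdeal hx c) (sandwich_nonneg c h0)
    obtain ⟨p, hp, hcs⟩ := exists_seminorm_of_core (E := 𝓜(ℂ, A))
      { inner := fun d c => ψ ((star d).snd (c.fst x))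
        conj_inner_symm := fun d c => by
          have h1 := h.map_star (snd_mem_minimalDenseIdeal (fst_mem_minimalDenseIdeal hx d) (star c))
          rw [star_snd_apply, star_fst_apply, star_star, (IsSelfAdjoint.of_nonneg h0).star_eq,
            ← snd_fst_comm] at h1
          exact h1.symm
        re_inner_nonneg := fun c => by
          have h1 := hsand c
          rw [sandwich] at h1
          change 0 ≤ (ψ ((star c).snd (c.fst x))).re
          erw [h1]
          simp
        add_left := fun c d e => by simp
        smul_left := fun c d r => by simp }
    have hp' : ∀ c, p c = √(φ (sandwich c x)).toReal := fun c => by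
      rw [hp]
      have h1 := hsand c
      change √(ψ (sandwich c x)).re = _
      rw [h1, Complex.ofReal_re]
    have hpc : Continuous p := by
      refine p.continuous_of_lowerSemicontinuous ?_
      rw [lowerSemicontinuous_iff_isClosed_preimage]
      intro r
      rcases lt_or_ge r 0 with hr | hr
      · have : p ⁻¹' Set.Iic r = ∅ := by
          ext c
          simpa using hr.trans_le (apply_nonneg p c)
        rw [this]; exact isClosed_empty
      · have : p ⁻¹' Set.Iic r
            = (fun c : 𝓜(ℂ, A) => φ (sandwich c x)) ⁻¹' Set.Iic (ENNReal.ofReal (r ^ 2)) := by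
          ext c
          have hfin := hφ.finite _ (sandwich_mem_minimalDenseIdeal hx c) (sandwich_nonneg c h0)
          rw [Set.mem_preimage, Set.mem_preimage, Set.mem_Iic, Set.mem_Iic, hp',
            Real.sqrt_le_left hr, ← ENNReal.le_ofReal_iff_toReal_le hfin (by positivity)]
        rw [this]
        exact (lowerSemicontinuous_sandwich hφ h0).isClosed_preimage _
    let L : 𝓜(ℂ, A) →ₗ[ℂ] ℂ :=
      { toFun := fun c => ψ (c.fst x)
        map_add' := fun c d => by simp
        map_smul' := fun r c => by simp }
    have hL : ∀ c, ‖L c‖ ≤ p 1 * p c := fun c => by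
      have h1 := hcs 1 c
      change ‖ψ ((star (1 : 𝓜(ℂ, A))).snd (c.fst x))‖ ≤ _ at h1
      rw [star_one] at h1
      exact h1
    refine continuous_of_continuousAt_zero L ?_
    rw [ContinuousAt, _root_.map_zero]
    refine squeeze_zero_norm hL ?_
    have := (hpc.tendsto 0).const_mul (p 1)
    simpa using this
  · exact (hx.add hy).congr fun c => by simp
  · exact (hx.const_smul c).congr fun d => by simp

theorem IsLinearExtension.continuous_snd (hφ : IsUnboundedFunctional φ)
    (h : IsLinearExtension φ ψ) {x : A} (hx : x ∈ minimalDenseIdeal A) :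
    Continuous fun c : 𝓜(ℂ, A) => ψ (c.snd x) := by
  have h1 := h.continuous_fst hφ (star_mem_minimalDenseIdeal hx)
  refine (continuous_star.comp (h1.comp continuous_star)).congr fun c => ?_
  have h2 := h.map_star (fst_mem_minimalDenseIdeal (star_mem_minimalDenseIdeal hx) (star c))
  rw [star_fst_apply, star_star, star_star] at h2
  exact h2.symm

/-- Multipliers in the centralizer of an unbounded functional, acting on the minimal dense ideal. -/
def IsCentralMultiplier (ψ : A →ₗ[ℂ] ℂ) (c : 𝓜(ℂ, A)) : Prop :=
  ∀ x ∈ minimalDenseIdeal A, ψ (c.fst x) = ψ (c.snd x)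

/-- The value of an unbounded functional on compressions of `x` by functions of the tuple `y` is
additive in the function. This is the only consequence of the hypothesis on the centralizer that
the Jensen inequality needs. -/
def IsAdditiveAlong {X : Type*} [TopologicalSpace X] (φ : A → ℝ≥0∞)
    (Φ : C(X, ℂ) →⋆ₐ[ℂ] 𝓜(ℂ, A)) : Prop :=
  ∀ g h : C(X, ℝ), 0 ≤ g → 0 ≤ h → ∀ x : A, 0 ≤ x →
    φ (sandwich (realHom Φ (sqrtFun (g + h))) x)
      = φ (sandwich (realHom Φ (sqrtFun g)) x) + φ (sandwich (realHom Φ (sqrtFun h)) x)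

theorem continuous_realHom {X : Type*} [TopologicalSpace X] [CompactSpace X]
    (Φ : C(X, ℂ) →⋆ₐ[ℂ] 𝓜(ℂ, A)) : Continuous (realHom Φ) :=
  AddMonoidHomClass.continuous_of_bound (realHom Φ) 1 fun g => by
    rw [one_mul]
    exact norm_realHom_le Φ (norm_nonneg g) g.norm_coe_le_norm

theorem isCentralMultiplier_realHom (hφ : IsUnboundedFunctional φ) (h : IsLinearExtension φ ψ)
    {n : ℕ} {S : Set (Fin n → ℝ)} [CompactSpace S] (Φ : C(S, ℂ) →⋆ₐ[ℂ] 𝓜(ℂ, A))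
    (hcoord : ∀ i, IsCentralMultiplier ψ
      (realHom Φ ⟨fun p => (p : Fin n → ℝ) i, (continuous_apply i).comp continuous_subtype_val⟩))
    (g : C(S, ℝ)) : IsCentralMultiplier ψ (realHom Φ g) := by
  induction g using continuousMap_induction with
  | hconst r => intro x hx; rw [realHom_const]; simp
  | hcoord i => exact hcoord i
  | hadd g k hg hk => intro x hx; rw [map_add]; simp [hg x hx, hk x hx]
  | hmul g k hg hk =>
    intro x hx
    rw [map_mul]
    calc ψ ((realHom Φ g).fst ((realHom Φ k).fst x))
        = ψ ((realHom Φ g).snd ((realHom Φ k).fst x)) := hg _ (fst_mem_minimalDenseIdeal hx _)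
      _ = ψ ((realHom Φ k).snd ((realHom Φ g).snd x)) := by
        rw [snd_fst_comm, hk _ (snd_mem_minimalDenseIdeal hx _)]
  | hclosed =>
    have : {g : C(S, ℝ) | IsCentralMultiplier ψ (realHom Φ g)} = ⋂ x ∈ minimalDenseIdeal A,
        {g | ψ ((realHom Φ g).fst x) = ψ ((realHom Φ g).snd x)} := by
      ext g; simp [IsCentralMultiplier]
    rw [this]
    exact isClosed_biInter fun x hx => isClosed_eq
      ((h.continuous_fst hφ hx).comp (continuous_realHom Φ))
      ((h.continuous_snd hφ hx).comp (continuous_realHom Φ))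

/-- Additivity on the minimal dense ideal extends to the positive cone by semicontinuity. -/
theorem isAdditiveAlong_of_minimalDenseIdeal (hφ : IsUnboundedFunctional φ) {X : Type*}
    [TopologicalSpace X] (Φ : C(X, ℂ) →⋆ₐ[ℂ] 𝓜(ℂ, A))
    (h : ∀ g h : C(X, ℝ), 0 ≤ g → 0 ≤ h → ∀ x ∈ minimalDenseIdeal A, 0 ≤ x →
      φ (sandwich (realHom Φ (sqrtFun (g + h))) x)
        = φ (sandwich (realHom Φ (sqrtFun g)) x) + φ (sandwich (realHom Φ (sqrtFun h)) x)) :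
    IsAdditiveAlong φ Φ := by
  intro g k hg hk x hx
  obtain ⟨z, hzK, hz0, hzx, hz⟩ := exists_seq_minimalDenseIdeal hx
  have ht : ∀ m : 𝓜(ℂ, A),
      Tendsto (fun j => φ (sandwich m (z j))) atTop (𝓝 (φ (sandwich m x))) := fun m =>
    hφ.tendsto (fun j => sandwich_nonneg m (hz0 j)) (fun j => sandwich_mono m (hzx j))
      (sandwich_nonneg m hx) (((sandwich m).continuous.tendsto x).comp hz)
  refine tendsto_nhds_unique (ht _) (((ht _).add (ht _)).congr fun j => ?_)
  exact (h g k hg hk (z j) (hzK j) (hz0 j)).symm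

theorem isAdditiveAlong_of_isCentralMultiplier (hφ : IsUnboundedFunctional φ)
    (h : IsLinearExtension φ ψ) {X : Type*} [TopologicalSpace X] (Φ : C(X, ℂ) →⋆ₐ[ℂ] 𝓜(ℂ, A))
    (hc : ∀ g, IsCentralMultiplier ψ (realHom Φ g)) : IsAdditiveAlong φ Φ := by
  refine isAdditiveAlong_of_minimalDenseIdeal hφ Φ fun g k hg hk x hx h0 => ?_
  have key : ∀ g : C(X, ℝ), 0 ≤ g →
      ((φ (sandwich (realHom Φ (sqrtFun g)) x)).toReal : ℂ) = ψ ((realHom Φ g).fst x) := by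
    intro g hg
    rw [← h _ (sandwich_mem_minimalDenseIdeal hx _) (sandwich_nonneg _ h0)]
    change ψ ((star (realHom Φ (sqrtFun g))).snd ((realHom Φ (sqrtFun g)).fst x)) = _
    rw [(realHom_isSelfAdjoint Φ _).star_eq, ← hc _ _ (fst_mem_minimalDenseIdeal hx _),
      ← fst_mul_apply, ← map_mul, sqrtFun_mul_self hg]
  have hfin : ∀ m : 𝓜(ℂ, A), φ (sandwich m x) ≠ ∞ := fun m =>
    hφ.finite _ (sandwich_mem_minimalDenseIdeal hx m) (sandwich_nonneg m h0)
  rw [← ENNReal.toReal_eq_toReal_iff' (hfin _) (ENNReal.add_ne_top.2 ⟨hfin _, hfin _⟩),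
    ENNReal.toReal_add (hfin _) (hfin _), ← Complex.ofReal_inj, Complex.ofReal_add,
    key _ (add_nonneg hg hk), key _ hg, key _ hk, map_add]
  simp

/-- Functions of elements of the centralizer act additively. Without variables the functions are
constants and homogeneity suffices. -/
theorem isAdditiveAlong (hφ : IsUnboundedFunctional φ) {n : ℕ} {y : Fin n → A}
    (hy : ∀ i, InUnboundedCentralizer φ (y i))
    (Φ : C(spectralBox fun i => (y i : 𝓜(ℂ, A)), ℂ) →⋆ₐ[ℂ] 𝓜(ℂ, A))
    (hΦ : ∀ i, Φ (coordFun _ i) = (y i : 𝓜(ℂ, A))) : IsAdditiveAlong φ Φ := by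
  rcases n with _ | n
  · intro g k hg hk x hx
    have hconst : ∀ g : C(spectralBox fun i : Fin 0 => (y i : 𝓜(ℂ, A)), ℝ),
        0 ≤ g → ∃ r : ℝ≥0, (∀ p, g p = r) ∧ φ (sandwich (realHom Φ (sqrtFun g)) x) = r * φ x := by
      intro g hg
      let p₀ : spectralBox fun i : Fin 0 => (y i : 𝓜(ℂ, A)) := ⟨0, fun i => i.elim0⟩
      have hp : ∀ p, g p = g p₀ := fun p => by
        congr 1; exact Subsingleton.elim _ _
      obtain ⟨r, hr⟩ : ∃ r : ℝ≥0, (r : ℝ) = g p₀ := ⟨⟨g p₀, hg p₀⟩, rfl⟩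
      refine ⟨r, fun p => by rw [hp, hr], ?_⟩
      have h1 : sqrtFun g = ContinuousMap.const _ √(r : ℝ) := by
        ext p
        exact congrArg Real.sqrt ((hp p).trans hr.symm)
      rw [← hφ.map_smul _ _ hx, h1, realHom_const]
      congr 1
      rw [← coe_inj, coe_sandwich, star_smul, star_one, Complex.star_def, Complex.conj_ofReal,
        smul_one_mul, mul_smul_one, smul_smul, ← Complex.ofReal_mul, Real.mul_self_sqrt r.coe_nonneg,
        ← coe_real_smul]
      rfl
    obtain ⟨r, hr, h1⟩ := hconst g hg
    obtain ⟨s, hs, h2⟩ := hconst k hk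
    obtain ⟨q, hq, h3⟩ := hconst (g + k) (add_nonneg hg hk)
    rw [h1, h2, h3, ← add_mul]
    have h4 := hq ⟨0, fun i => i.elim0⟩
    rw [ContinuousMap.add_apply, hr, hs] at h4
    have : q = r + s := by ext; simpa using h4.symm
    rw [this, ENNReal.coe_add]
  · choose ψ hψ hc using hy
    refine isAdditiveAlong_of_isCentralMultiplier hφ (hψ 0) Φ
      (isCentralMultiplier_realHom hφ (hψ 0) Φ fun i => ?_)
    intro x hx
    have h1 : realHom Φ ⟨fun p => (p : Fin (n + 1) → ℝ) i,
        (continuous_apply i).comp continuous_subtype_val⟩ = (y i : 𝓜(ℂ, A)) := hΦ i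
    have hK := mul_mem_minimalDenseIdeal hx (y i)
    have e1 := IsLinearExtension.eq (hψ 0) (hψ i) hK.1
    have e2 := IsLinearExtension.eq (hψ 0) (hψ i) hK.2
    have h2 := hc i x hx
    rw [h1]
    simp only [DoubleCentralizer.coe_fst, DoubleCentralizer.coe_snd, ContinuousLinearMap.mul_apply',
      ContinuousLinearMap.flip_apply]
    rw [e1, e2, h2]

end Unbounded

/-! ### Lower semicontinuous functionals as suprema of bounded functionals -/

/-- A compression by a contraction `k` moves a positive element little if the opposite compression,
by `1 - k`, is small. -/
theorem norm_sub_compression_le {M : Type*} [CStarAlgebra M] [PartialOrder M] [StarOrderedRing M]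
    {w k : M} (hw : 0 ≤ w) (hk : IsSelfAdjoint k) (hk1 : ‖k‖ ≤ 1) {η : ℝ} (hη : 0 ≤ η)
    (h : (1 - k) * w * (1 - k) ≤ algebraMap ℝ M η) :
    ‖w - k * w * k‖ ≤ 2 * √η * ‖CFC.sqrt w‖ := by
  set s := CFC.sqrt w with hs
  have hss : s * s = w := CFC.sqrt_mul_sqrt_self w hw
  have hssa : star s = s := (IsSelfAdjoint.of_nonneg (CFC.sqrt_nonneg w)).star_eq
  have h1k : IsSelfAdjoint (1 - k) := (IsSelfAdjoint.one M).sub hk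
  have h3 : ‖(1 - k) * s‖ ≤ √η := by
    refine Real.le_sqrt_of_sq_le ?_
    have e : (1 - k) * w * (1 - k) = (1 - k) * s * star ((1 - k) * s) := by
      rw [star_mul, hssa, h1k.star_eq, ← hss]; simp only [mul_assoc]
    rw [e] at h
    rw [pow_two, ← CStarRing.norm_self_mul_star,
      CStarAlgebra.norm_le_iff_le_algebraMap _ hη (mul_star_self_nonneg _)]
    exact h
  have h4 : ‖s * (1 - k)‖ ≤ √η := by
    rw [← norm_star, star_mul, hssa, h1k.star_eq]; exact h3
  have e : w - k * w * k = (1 - k) * s * s + k * s * (s * (1 - k)) := by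
    rw [← hss]; noncomm_ring
  calc ‖w - k * w * k‖ ≤ ‖(1 - k) * s * s‖ + ‖k * s * (s * (1 - k))‖ := by
        rw [e]; exact norm_add_le _ _
    _ ≤ √η * ‖s‖ + 1 * ‖s‖ * √η := by
        refine add_le_add ((norm_mul_le _ _).trans (by gcongr)) ((norm_mul_le _ _).trans ?_)
        gcongr
        exact (norm_mul_le _ _).trans (by gcongr)
    _ = 2 * √η * ‖s‖ := by ring

/-- If `w ≤ z + η`, then a compression of `w` that is close to `w` lies below `z`. -/
theorem exists_compression_le {M : Type*} [CStarAlgebra M] [PartialOrder M] [StarOrderedRing M]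
    {w z : M} (hw : 0 ≤ w) (hz : 0 ≤ z) {η : ℝ} (hη : 0 < η) (h : w ≤ z + algebraMap ℝ M η) :
    ∃ k : M, star k = k ∧ k * w * k ≤ z ∧ ‖w - k * w * k‖ ≤ 2 * √η * ‖CFC.sqrt w‖ := by
  cases subsingleton_or_nontrivial M
  · exact ⟨0, Subsingleton.elim _ _, (Subsingleton.elim _ _).le, by
      rw [Subsingleton.elim (w - 0 * w * 0) 0, norm_zero]; positivity⟩
  have hsp : ∀ t ∈ spectrum ℝ z, 0 ≤ t := fun t ht => spectrum_nonneg_of_nonneg hz ht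
  have hpos : ∀ t ∈ spectrum ℝ z, 0 < t + η := fun t ht => by linarith [hsp t ht]
  have hzsa : IsSelfAdjoint z := .of_nonneg hz
  let κ : ℝ → ℝ := fun t => √(t / (t + η))
  have hκ : ContinuousOn κ (spectrum ℝ z) :=
    (continuousOn_id.div (by fun_prop) fun t ht => (hpos t ht).ne').sqrt
  have hadd : z + algebraMap ℝ M η = cfc (fun t : ℝ => t + η) z := by
    rw [cfc_add_const η (fun t : ℝ => t) z, cfc_id' ℝ z]
  have hsub : 1 - cfc κ z = cfc (fun t => 1 - κ t) z := by
    rw [cfc_sub (fun _ : ℝ => (1 : ℝ)) κ z, cfc_const_one ℝ z]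
  set k := cfc κ z with hk
  have hksa : IsSelfAdjoint k := IsSelfAdjoint.cfc
  have hknorm : ‖k‖ ≤ 1 := by
    refine norm_cfc_le zero_le_one fun t ht => ?_
    rw [Real.norm_of_nonneg (Real.sqrt_nonneg _), Real.sqrt_le_one, div_le_one (hpos t ht)]
    linarith
  refine ⟨k, hksa.star_eq, ?_, ?_⟩
  · have h1 := hksa.conjugate_le_conjugate h
    refine h1.trans_eq ?_
    rw [hadd, hk, ← cfc_mul κ _ z, ← cfc_mul _ κ z]
    conv_rhs => rw [← cfc_id' ℝ z]
    refine cfc_congr fun t ht => ?_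
    have := (hpos t ht).ne'
    calc κ t * (t + η) * κ t = κ t * κ t * (t + η) := by ring
      _ = t / (t + η) * (t + η) := by
        rw [Real.mul_self_sqrt (div_nonneg (hsp t ht) (hpos t ht).le)]
      _ = t := by field_simp
  · have h1k : IsSelfAdjoint (1 - k) := (IsSelfAdjoint.one M).sub hksa
    refine norm_sub_compression_le hw hksa hknorm hη.le ?_
    refine (h1k.conjugate_le_conjugate h).trans ?_
    rw [hadd, hsub, ← cfc_mul _ _ z, ← cfc_mul _ _ z]
    refine cfc_le_algebraMap _ _ _ fun t ht => ?_
    have ht0 := hsp t ht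
    have htp := hpos t ht
    have e1 : κ t * √(t + η) = √t := by
      rw [← Real.sqrt_mul (div_nonneg ht0 htp.le), div_mul_cancel₀ _ htp.ne']
    have e2 : √(t + η) * √(t + η) = t + η := Real.mul_self_sqrt htp.le
    have e3 : √t * √t = t := Real.mul_self_sqrt ht0
    have e4 : √t ≤ √(t + η) := Real.sqrt_le_sqrt (by linarith)
    calc (1 - κ t) * (t + η) * (1 - κ t) = (√(t + η) - κ t * √(t + η)) ^ 2 := by
          nth_rw 1 [← e2]; ring
      _ ≤ η := by rw [e1]; nlinarith [Real.sqrt_nonneg t]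

variable {A : Type*} [NonUnitalCStarAlgebra A] [PartialOrder A] [StarOrderedRing A]
  {φ : A → ℝ≥0∞}

/-- A lower semicontinuous functional on the positive cone is the pointwise supremum of the bounded
positive functionals that it dominates. -/
theorem exists_positive_le (hφ : IsUnboundedFunctional φ) {w : A} (hw : 0 ≤ w) {r : ℝ≥0∞}
    (hr : r < φ w) : ∃ ω : A →ₚ[ℂ] ℂ, (∀ x, 0 ≤ x → ENNReal.ofReal (ω x).re ≤ φ x) ∧
      r < ENNReal.ofReal (ω w).re := by
  obtain ⟨r', hrr', hr'⟩ := exists_between hr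
  have hr'top : r' ≠ ∞ := hr'.ne_top
  -- the price of `x ≤ z + ρ` is `φ z + N ρ`
  let C : ℝ → selfAdjoint A → ℝ → Prop := fun N x s => ∃ (z : A) (ρ : ℝ), 0 ≤ z ∧ φ z ≠ ∞ ∧
    0 ≤ ρ ∧ ((x : A) : 𝓜(ℂ, A)) ≤ (z : 𝓜(ℂ, A)) + algebraMap ℝ _ ρ ∧ s = (φ z).toReal + N * ρ
  have hsmul_nn : ∀ {c : ℝ} (hc : 0 ≤ c) (z : A), 0 ≤ z → φ (c • z) = ENNReal.ofReal c * φ z :=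
    fun {c} hc z hz => by
      have := hφ.map_smul ⟨c, hc⟩ z hz
      rw [ENNReal.ofReal_eq_coe_nnreal hc]
      exact this
  obtain ⟨N, hN0, hN⟩ : ∃ N : ℝ, 0 ≤ N ∧ ∀ s, C N ⟨w, .of_nonneg hw⟩ s → r'.toReal ≤ s := by
    by_contra! hcon
    choose s hC hs using fun n : ℕ => hcon (n + 1 : ℝ) (by positivity)
    choose z ρ hz0 hzf hρ hle heq using hC
    have hρn : ∀ n, ρ n ≤ r'.toReal / (n + 1) := fun n => by
      rw [le_div_iff₀ (by positivity)]
      have h1 := hs n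
      rw [heq] at h1
      nlinarith [ENNReal.toReal_nonneg (a := φ (z n))]
    set η : ℕ → ℝ := fun n => (r'.toReal + 1) / (n + 1) with hη
    have hη0 : ∀ n, 0 < η n := fun n => by positivity
    have hρη : ∀ n, ρ n ≤ η n := fun n => (hρn n).trans (by
      rw [hη]; dsimp only; gcongr; linarith)
    choose k hk hkz hkw using fun n => exists_compression_le (coe_nonneg.2 hw)
      (coe_nonneg.2 (hz0 n)) (hη0 n) ((hle n).trans (add_le_add le_rfl (algebraMap_mono (hρη n))))
    have hcoe : ∀ n, (sandwich (k n) w : 𝓜(ℂ, A)) = k n * w * k n := fun n => by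
      rw [coe_sandwich, hk]
    refine hr'.not_ge (hφ.le_of_tendsto (l := atTop) (z := fun n => sandwich (k n) w)
      (fun n => sandwich_nonneg _ hw) hw ?_ fun n => ?_)
    · rw [tendsto_iff_norm_sub_tendsto_zero]
      have h1 : Tendsto η atTop (𝓝 0) := by
        have := (tendsto_one_div_add_atTop_nhds_zero_nat (𝕜 := ℝ)).const_mul (r'.toReal + 1)
        rw [mul_zero] at this
        exact this.congr fun n => by rw [hη]; ring
      have h2 : Tendsto (fun n => 2 * √(η n) * ‖CFC.sqrt (w : 𝓜(ℂ, A))‖) atTop (𝓝 0) := by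
        have := (h1.sqrt.const_mul 2).mul_const ‖CFC.sqrt (w : 𝓜(ℂ, A))‖
        simpa using this
      refine squeeze_zero (fun _ => norm_nonneg _) (fun n => ?_) h2
      rw [norm_sub_rev, ← norm_coe, coe_sub, hcoe]
      exact hkw n
    · have h1 : sandwich (k n) w ≤ z n := by rw [← coe_le_coe, hcoe]; exact hkz n
      refine (hφ.mono (sandwich_nonneg _ hw) h1).trans ?_
      rw [← ENNReal.toReal_le_toReal (hzf n) hr'top]
      have h2 := hs n
      rw [heq] at h2
      have h3 : 0 ≤ ((n : ℝ) + 1) * ρ n := mul_nonneg (by positivity) (hρ n)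
      linarith
  obtain ⟨g, hg, hgw⟩ := exists_linear_le_cost (C N)
    (by
      rintro x y s s' ⟨z, ρ, hz, hzf, hρ, hx, rfl⟩ ⟨z', ρ', hz', hzf', hρ', hy, rfl⟩
      refine ⟨z + z', ρ + ρ', add_nonneg hz hz', ?_, add_nonneg hρ hρ', ?_, ?_⟩
      · rw [hφ.map_add _ _ hz hz']; exact ENNReal.add_ne_top.2 ⟨hzf, hzf'⟩
      · rw [AddSubgroup.coe_add, coe_add, coe_add, map_add, add_add_add_comm]
        exact add_le_add hx hy
      · rw [hφ.map_add _ _ hz hz', ENNReal.toReal_add hzf hzf']; ring)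
    (by
      rintro c hc x s ⟨z, ρ, hz, hzf, hρ, hx, rfl⟩
      refine ⟨c • z, c * ρ, smul_nonneg hc.le hz, ?_, by positivity, ?_, ?_⟩
      · rw [hsmul_nn hc.le z hz]; exact ENNReal.mul_ne_top ENNReal.ofReal_ne_top hzf
      · rw [← smul_algebraMap, selfAdjoint.val_smul, coe_real_smul, coe_real_smul, ← smul_add]
        exact smul_le_smul_coe hc.le hx
      · rw [hsmul_nn hc.le z hz, ENNReal.toReal_mul, ENNReal.toReal_ofReal hc.le]; ring)
    (fun x => ⟨_, 0, ‖(x : A)‖, le_rfl, by rw [hφ.map_zero]; exact ENNReal.zero_ne_top,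
      norm_nonneg _, by rw [coe_zero, zero_add]; exact le_norm_mul_one x.2, rfl⟩)
    (fun x => ⟨0, by rintro s ⟨z, ρ, -, -, hρ, -, rfl⟩; positivity⟩)
    ⟨w, .of_nonneg hw⟩
  obtain ⟨ω, hω⟩ := exists_positive_extension g fun a ha => by
    have h1 := hg (-a) _ ⟨0, 0, le_rfl, by rw [hφ.map_zero]; exact ENNReal.zero_ne_top, le_rfl, by
      rw [coe_zero, _root_.map_zero, add_zero, AddSubgroup.coe_neg, coe_neg, neg_nonpos]
      exact coe_nonneg.2 ha, rfl⟩
    rw [hφ.map_zero, map_neg] at h1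
    simpa using h1
  have hω' : ∀ x (hx : 0 ≤ x), (ω x).re = g ⟨x, .of_nonneg hx⟩ := fun x hx => by
    have := hω ⟨x, .of_nonneg hx⟩
    exact congrArg Complex.re this
  refine ⟨ω, fun x hx => ?_, ?_⟩
  · rcases eq_or_ne (φ x) ∞ with h | h
    · rw [h]; exact le_top
    · rw [hω' x hx]
      refine ENNReal.ofReal_le_of_le_toReal ?_
      have := hg ⟨x, .of_nonneg hx⟩ _ ⟨x, 0, hx, h, le_rfl, by rw [_root_.map_zero, add_zero], rfl⟩
      simpa using this
  · refine hrr'.trans_le ?_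
    rw [hω' w hw, ← ENNReal.ofReal_toReal hr'top]
    exact ENNReal.ofReal_le_ofReal (hgw _ hN)

/-! ### Comparison of a function of the tuple with a majorant of its minorants -/

/-- A positive continuous function is nearly a weighted mean of minorants. -/
theorem exists_weights {X : Type*} [TopologicalSpace X] [CompactSpace X] {g : C(X, ℝ)}
    {L : Set C(X, ℝ)} (hL : ∀ p, ∀ r < g p, ∃ l ∈ L, r < l p) {δ : ℝ} (hδ : 0 < δ) :
    ∃ (t : Finset C(X, ℝ)) (c : C(X, ℝ) → C(X, ℝ)), (∀ l ∈ t, l ∈ L) ∧ (∀ l, 0 ≤ c l) ∧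
      (∀ p, ∑ l ∈ t, c l p ≤ 1) ∧ (∀ p, δ ≤ g p → ∑ l ∈ t, c l p = 1) ∧
      ∀ l p, c l p * ((1 - δ) * g p) ≤ c l p * l p := by
  classical
  have hK : IsCompact {p | δ ≤ g p} := (isClosed_le continuous_const g.continuous).isCompact
  obtain ⟨t, ht⟩ := hK.elim_finite_subcover (fun l : L => {q | (1 - δ) * g q < (l : C(X, ℝ)) q})
    (fun l => isOpen_lt (by fun_prop) (by fun_prop)) (fun p hp => by
      have hp' : δ ≤ g p := hp
      obtain ⟨l, hl, hlp⟩ := hL p ((1 - δ) * g p) (by nlinarith)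
      exact Set.mem_iUnion.2 ⟨⟨l, hl⟩, hlp⟩)
  let s : Finset C(X, ℝ) := t.image Subtype.val
  -- the weight of `l` lives where `l ≥ (1 - δ) g`; the bound `η` keeps the denominators positive
  let u : C(X, ℝ) → X → ℝ := fun l p => max (l p - (1 - δ) * g p) 0
  have hu : ∀ l, Continuous (u l) := fun l => by fun_prop
  have hu0 : ∀ l p, 0 ≤ u l p := fun l p => le_max_right _ _
  have hU : Continuous fun p => ∑ l ∈ s, u l p := continuous_finsetSum _ fun l _ => hu l
  obtain ⟨η, hη, hηU⟩ := hK.exists_forall_le' hU.continuousOn (a := 0) (fun p hp => by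
    obtain ⟨l, hl⟩ := Set.mem_iUnion.1 (ht hp)
    obtain ⟨hlt, hlp⟩ := Set.mem_iUnion.1 hl
    refine Finset.sum_pos' (fun l _ => hu0 l p) ⟨l, Finset.mem_image_of_mem _ hlt, ?_⟩
    exact lt_max_of_lt_left (sub_pos.2 hlp))
  have hmax : ∀ p, 0 < max (∑ l ∈ s, u l p) η := fun p => lt_max_of_lt_right hη
  refine ⟨s, fun l => ⟨fun p => u l p / max (∑ l ∈ s, u l p) η,
    (hu l).div (hU.max continuous_const) fun p => (hmax p).ne'⟩, ?_, ?_, ?_, ?_, ?_⟩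
  · intro l hl
    obtain ⟨l', -, rfl⟩ := Finset.mem_image.1 hl
    exact l'.2
  · intro l p
    exact div_nonneg (hu0 l p) (hmax p).le
  · intro p
    simp only [ContinuousMap.coe_mk]
    rw [← Finset.sum_div, div_le_one (hmax p)]
    exact le_max_left _ _
  · intro p hp
    simp only [ContinuousMap.coe_mk]
    rw [← Finset.sum_div, div_eq_one_iff_eq (hmax p).ne', max_eq_left (hηU p hp)]
  · intro l p
    simp only [ContinuousMap.coe_mk]
    rcases le_total (l p - (1 - δ) * g p) 0 with h | h
    · have : u l p = 0 := max_eq_right h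
      rw [this]; simp
    · exact mul_le_mul_of_nonneg_left (by linarith) (div_nonneg (hu0 l p) (hmax p).le)

theorem eventually_lt_sum {κ ι : Type*} {l : Filter ι} (s : Finset κ) {a : κ → ℝ≥0∞}
    {b : κ → ι → ℝ≥0∞} (h : ∀ k ∈ s, ∀ r < a k, ∀ᶠ e in l, r < b k e) :
    ∀ r < ∑ k ∈ s, a k, ∀ᶠ e in l, r < ∑ k ∈ s, b k e := by
  classical
  induction s using Finset.induction_on with
  | empty => intro r hr; simp at hr
  | insert k s hk ih =>
    have ih' := ih fun j hj => h j (Finset.mem_insert_of_mem hj)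
    have hk' := h k (Finset.mem_insert_self _ _)
    intro r hr
    simp only [Finset.sum_insert hk] at hr ⊢
    rcases eq_or_ne (a k) 0 with h0 | h0
    · rw [h0, zero_add] at hr
      filter_upwards [ih' r hr] with e he
      exact he.trans_le le_add_self
    rcases eq_or_ne (∑ k ∈ s, a k) 0 with h1 | h1
    · rw [h1, add_zero] at hr
      filter_upwards [hk' r hr] with e he
      exact he.trans_le le_self_add
    obtain ⟨r₁, hr₁, r₂, hr₂, hlt⟩ := ENNReal.exists_lt_add_of_lt_add hr h0 h1
    filter_upwards [hk' r₁ hr₁, ih' r₂ hr₂] with e he he'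
    exact hlt.trans (ENNReal.add_lt_add he he')

variable {A : Type*} [NonUnitalCStarAlgebra A] [PartialOrder A] [StarOrderedRing A]
  {φ : A → ℝ≥0∞}

theorem le_extUnbounded {m : 𝓜(ℂ, A)} {x : A} (hx : 0 ≤ x) (hxm : (x : 𝓜(ℂ, A)) ≤ m) :
    φ x ≤ extUnbounded φ m := by
  obtain ⟨z, hz⟩ := CStarAlgebra.nonneg_iff_eq_star_mul_self.1 (sub_nonneg.2 hxm)
  exact le_iSup_of_le x (le_iSup_of_le hx (le_iSup_of_le ⟨z, hz⟩ le_rfl))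

theorem extUnbounded_le {m : 𝓜(ℂ, A)} {r : ℝ≥0∞}
    (h : ∀ x : A, 0 ≤ x → (x : 𝓜(ℂ, A)) ≤ m → φ x ≤ r) : extUnbounded φ m ≤ r :=
  iSup_le fun x => iSup_le fun hx => iSup_le fun ⟨z, hz⟩ => h x hx
    (sub_nonneg.1 (hz ▸ star_mul_self_nonneg z))

theorem coe_sandwich_sqrt_le {F : 𝓜(ℂ, A)} (hF : 0 ≤ F) {e : A} (he0 : 0 ≤ e) (he1 : ‖e‖ ≤ 1) :
    (sandwich (CFC.sqrt F) e : 𝓜(ℂ, A)) ≤ F := by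
  have h3 : (e : 𝓜(ℂ, A)) ≤ 1 := by
    refine (le_norm_mul_one (IsSelfAdjoint.of_nonneg he0)).trans ?_
    rw [← map_one (algebraMap ℝ 𝓜(ℂ, A))]
    exact algebraMap_mono he1
  have h4 := star_right_conjugate_le_conjugate h3 (CFC.sqrt F)
  rw [mul_one, isSelfAdjoint_sqrt, CFC.sqrt_mul_sqrt_self F hF] at h4
  rwa [coe_sandwich, isSelfAdjoint_sqrt]

open CStarAlgebra in
/-- If `w ≤ u F u⋆` for a positive multiplier `F`, then `φ w` is asymptotically bounded by the
values of `φ` at the elements `u (F ^ (1/2) e F ^ (1/2)) u⋆`, with `e` in the approximate unit. -/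
theorem eventually_lt_sandwich (hφ : IsUnboundedFunctional φ) {F u : 𝓜(ℂ, A)} (hF : 0 ≤ F) {w : A}
    (hw : 0 ≤ w) (hwF : (w : 𝓜(ℂ, A)) ≤ u * F * star u) {r : ℝ≥0∞} (hr : r < φ w) :
    ∀ᶠ e in approximateUnit A, r < φ (sandwich u (sandwich (CFC.sqrt F) e)) := by
  obtain ⟨ω, hω, hrω⟩ := exists_positive_le hφ hw hr
  have h1 := tendsto_apply_sandwich (posCLM (posConj ω u)) (CFC.sqrt F)
  rw [isSelfAdjoint_sqrt, CFC.sqrt_mul_sqrt_self F hF, ext_posConj] at h1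
  have h2 : r < ENNReal.ofReal (ext (posCLM ω) (u * F * star u)).re := by
    refine hrω.trans_le (ENNReal.ofReal_le_ofReal ?_)
    have := (ext_mono ω hwF).1
    rwa [ext_coe] at this
  have h3 := ENNReal.tendsto_ofReal ((Complex.continuous_re.tendsto _).comp h1)
  filter_upwards [h3.eventually (lt_mem_nhds h2), (increasingApproximateUnit A).eventually_nonneg]
    with e he he0
  exact he.trans_le (hω _ (sandwich_nonneg u (sandwich_nonneg _ he0)))

section Additive

variable {X : Type*} [TopologicalSpace X] {Φ : C(X, ℂ) →⋆ₐ[ℂ] 𝓜(ℂ, A)}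

theorem IsAdditiveAlong.sum (h : IsAdditiveAlong φ Φ) (hφ : IsUnboundedFunctional φ) {ι : Type*}
    (s : Finset ι) (c : ι → C(X, ℝ)) (hc : ∀ i, 0 ≤ c i) {x : A} (hx : 0 ≤ x) :
    φ (sandwich (realHom Φ (sqrtFun (∑ i ∈ s, c i))) x)
      = ∑ i ∈ s, φ (sandwich (realHom Φ (sqrtFun (c i))) x) := by
  classical
  induction s using Finset.induction_on with
  | empty =>
    have h0 : sqrtFun (0 : C(X, ℝ)) = 0 := by ext p; simp [sqrtFun]
    rw [Finset.sum_empty, Finset.sum_empty, h0, map_zero, ← hφ.map_zero]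
    congr 1
    rw [← coe_inj, coe_sandwich]; simp
  | insert i s hi ih =>
    rw [Finset.sum_insert hi, Finset.sum_insert hi, ← ih]
    exact h _ _ (hc i) (Finset.sum_nonneg fun j _ => hc j) x hx

theorem sandwich_one (x : A) : sandwich (1 : 𝓜(ℂ, A)) x = x := by
  rw [← coe_inj, coe_sandwich, star_one, one_mul, mul_one]

theorem IsAdditiveAlong.le (h : IsAdditiveAlong φ Φ) {q : C(X, ℝ)} (hq : 0 ≤ q) (hq1 : q ≤ 1)
    {x : A} (hx : 0 ≤ x) : φ (sandwich (realHom Φ (sqrtFun q)) x) ≤ φ x := by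
  have h1 := h q (1 - q) hq (sub_nonneg.2 hq1) x hx
  have h2 : sqrtFun (1 : C(X, ℝ)) = 1 := by ext p; simp [sqrtFun]
  rw [add_sub_cancel, h2, map_one, sandwich_one] at h1
  rw [h1]
  exact le_self_add

theorem coe_sandwich_realHom (g : C(X, ℝ)) (x : A) :
    (sandwich (realHom Φ g) x : 𝓜(ℂ, A)) = realHom Φ g * (x : 𝓜(ℂ, A)) * realHom Φ g := by
  rw [coe_sandwich, (realHom_isSelfAdjoint Φ g).star_eq]

theorem realHom_conj (g : C(X, ℝ)) {c : C(X, ℝ)} (hc : 0 ≤ c) :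
    realHom Φ (sqrtFun c) * realHom Φ g * realHom Φ (sqrtFun c) = realHom Φ (c * g) := by
  rw [← map_mul, ← map_mul, mul_right_comm, sqrtFun_mul_self hc]

/-- Up to a factor `1 - δ` and the compression by a function that is `1` where `g ≥ δ`, the value of
`φ` at an element below `g` is bounded by the value at `F`. -/
theorem apply_compression_le [CompactSpace X] (hφ : IsUnboundedFunctional φ)
    (hadd : IsAdditiveAlong φ Φ) {g : C(X, ℝ)} {F : 𝓜(ℂ, A)} (hF : 0 ≤ F)
    {L : Set C(X, ℝ)} (hL : ∀ p, ∀ r < g p, ∃ l ∈ L, r < l p) (hLF : ∀ l ∈ L, realHom Φ l ≤ F)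
    {x : A} (hx : 0 ≤ x) (hxg : (x : 𝓜(ℂ, A)) ≤ realHom Φ g) {δ : ℝ} (hδ : 0 < δ) (hδ1 : δ < 1) :
    ∃ q : C(X, ℝ), 0 ≤ q ∧ q ≤ 1 ∧ (∀ p, δ ≤ g p → q p = 1) ∧
      φ (sandwich (realHom Φ (sqrtFun q)) ((1 - δ) • x)) ≤ extUnbounded φ F := by
  obtain ⟨t, c, htL, hc, hc1, hcδ, hcl⟩ := exists_weights hL hδ
  have hsum : ∀ p, (∑ l ∈ t, c l) p = ∑ l ∈ t, c l p := fun p => by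
    rw [ContinuousMap.sum_apply]
  have hq0 : 0 ≤ ∑ l ∈ t, c l := Finset.sum_nonneg fun l _ => hc l
  have hq1 : ∑ l ∈ t, c l ≤ 1 := fun p => by
    have := hc1 p
    rw [← hsum] at this
    exact this
  refine ⟨∑ l ∈ t, c l, hq0, hq1, fun p hp => by rw [hsum]; exact hcδ p hp, ?_⟩
  have h1δ : 0 ≤ 1 - δ := by linarith
  have hx' : 0 ≤ (1 - δ) • x := smul_nonneg h1δ hx
  rw [hadd.sum hφ t c hc hx']
  refine le_of_forall_lt fun r hr => ?_
  have hev : ∀ l ∈ t, ∀ r < φ (sandwich (realHom Φ (sqrtFun (c l))) ((1 - δ) • x)),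
      ∀ᶠ e in CStarAlgebra.approximateUnit A,
        r < φ (sandwich (realHom Φ (sqrtFun (c l))) (sandwich (CFC.sqrt F) e)) := by
    intro l hl r hr
    refine eventually_lt_sandwich hφ hF (sandwich_nonneg _ hx') ?_ hr
    have hsa := realHom_isSelfAdjoint Φ (sqrtFun (c l))
    rw [coe_sandwich, hsa.star_eq]
    calc _ ≤ realHom Φ (sqrtFun (c l)) * realHom Φ ((1 - δ) • g) * realHom Φ (sqrtFun (c l)) := by
          refine hsa.conjugate_le_conjugate ?_
          rw [coe_real_smul, realHom_smul]
          exact smul_le_smul_coe h1δ hxg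
      _ ≤ realHom Φ (sqrtFun (c l)) * realHom Φ l * realHom Φ (sqrtFun (c l)) := by
          rw [realHom_conj _ (hc l), realHom_conj _ (hc l)]
          exact realHom_mono Φ fun p => hcl l p
      _ ≤ _ := hsa.conjugate_le_conjugate (hLF l (htL l hl))
  have h2 := eventually_lt_sum t hev r hr
  obtain ⟨e, he, he0, he1⟩ := (h2.and
    ((CStarAlgebra.increasingApproximateUnit A).eventually_nonneg.and
      (CStarAlgebra.increasingApproximateUnit A).eventually_norm)).exists
  have hz0 : 0 ≤ sandwich (CFC.sqrt F) e := sandwich_nonneg _ he0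
  rw [← hadd.sum hφ t c hc hz0] at he
  refine he.trans_le ((hadd.le hq0 hq1 hz0).trans (le_extUnbounded hz0
    (coe_sandwich_sqrt_le hF he0 he1)))

/-- If `F` majorizes minorants of `g` that have supremum `g`, then `φ g ≤ φ F`, provided that `φ`
is additive along the functional calculus. -/
theorem extUnbounded_realHom_le [CompactSpace X] (hφ : IsUnboundedFunctional φ)
    (hadd : IsAdditiveAlong φ Φ) {g : C(X, ℝ)} (hg : 0 ≤ g) {F : 𝓜(ℂ, A)} (hF : 0 ≤ F)
    {L : Set C(X, ℝ)} (hL : ∀ p, ∀ r < g p, ∃ l ∈ L, r < l p) (hLF : ∀ l ∈ L, realHom Φ l ≤ F) :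
    extUnbounded φ (realHom Φ g) ≤ extUnbounded φ F := by
  refine extUnbounded_le fun x hx hxg => ?_
  set δ : ℕ → ℝ := fun j => 1 / ((j + 1 : ℕ) + 1) with hδ
  have hδ0 : ∀ j, 0 < δ j := fun j => by positivity
  have hδ1 : ∀ j, δ j < 1 := fun j => by
    rw [hδ]; dsimp only
    rw [div_lt_one (by positivity)]
    have : (0 : ℝ) < (j + 1 : ℕ) := by positivity
    linarith
  have hδlim : Tendsto δ atTop (𝓝 0) :=
    (tendsto_one_div_add_atTop_nhds_zero_nat (𝕜 := ℝ)).comp (tendsto_add_atTop_nat 1)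
  choose q hq0 hq1 hqδ hqF using fun j =>
    apply_compression_le hφ hadd hF hL hLF hx hxg (hδ0 j) (hδ1 j)
  have hlim : Tendsto (fun j => sandwich (realHom Φ (sqrtFun (q j))) x) atTop (𝓝 x) := by
    rw [tendsto_iff_norm_sub_tendsto_zero]
    have h2 : Tendsto (fun j => 2 * √(δ j) * ‖CFC.sqrt (x : 𝓜(ℂ, A))‖) atTop (𝓝 0) := by
      have := (hδlim.sqrt.const_mul 2).mul_const ‖CFC.sqrt (x : 𝓜(ℂ, A))‖
      simpa using this
    refine squeeze_zero (fun _ => norm_nonneg _) (fun j => ?_) h2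
    rw [norm_sub_rev, ← norm_coe, coe_sub, coe_sandwich_realHom]
    have hs1 : ∀ p, 0 ≤ sqrtFun (q j) p ∧ sqrtFun (q j) p ≤ 1 := fun p =>
      ⟨Real.sqrt_nonneg _, Real.sqrt_le_one.2 (hq1 j p)⟩
    refine norm_sub_compression_le (coe_nonneg.2 hx) (realHom_isSelfAdjoint Φ (sqrtFun (q j)))
      (norm_realHom_le Φ zero_le_one fun p => abs_le.2 ⟨by linarith [(hs1 p).1], (hs1 p).2⟩)
      (hδ0 j).le ?_
    rw [← map_one (realHom Φ), ← _root_.map_sub]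
    refine ((realHom_isSelfAdjoint Φ _).conjugate_le_conjugate hxg).trans ?_
    rw [← map_mul, ← map_mul, algebraMap_eq_smul, ← realHom_const Φ]
    refine realHom_mono Φ fun p => ?_
    change (1 - sqrtFun (q j) p) * g p * (1 - sqrtFun (q j) p) ≤ δ j
    rcases le_total (δ j) (g p) with h | h
    · have : sqrtFun (q j) p = 1 := by
        change √(q j p) = 1
        rw [hqδ j p h, Real.sqrt_one]
      rw [this, sub_self, mul_zero]
      exact (hδ0 j).le
    · have h1 := hs1 p
      have h3 : (1 - sqrtFun (q j) p) * (1 - sqrtFun (q j) p) ≤ 1 := by nlinarith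
      have h4 : 0 ≤ g p := hg p
      nlinarith [mul_le_mul_of_nonneg_right h3 h4]
  refine hφ.le_of_tendsto (l := atTop)
    (z := fun j => sandwich (realHom Φ (sqrtFun (q j))) ((1 - δ j) • x))
    (fun j => sandwich_nonneg _ (smul_nonneg (by linarith [hδ1 j]) hx)) hx ?_ hqF
  have h5 := (hδlim.const_sub 1).smul hlim
  rw [sub_zero, one_smul] at h5
  refine h5.congr fun j => ?_
  rw [← Complex.coe_smul, ← Complex.coe_smul, map_smul]

end Additive

/-! ### Affine minorants -/

/-- A continuous convex function is the supremum of its affine minorants, also if its domain is not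
closed: separate a point below the graph from the closed epigraph. -/
theorem exists_affine_minorant {n : ℕ} {C : Set (Fin n → ℝ)} {f : (Fin n → ℝ) → ℝ}
    (hc : ContinuousOn f C) (hf : ConvexOn ℝ C f) {p : Fin n → ℝ} (hp : p ∈ C) {r : ℝ}
    (hr : r < f p) :
    ∃ (c : Fin n → ℝ) (d : ℝ), (∀ q ∈ C, ∑ i, c i * q i + d ≤ f q) ∧ r < ∑ i, c i * p i + d := by
  set E : Set ((Fin n → ℝ) × ℝ) := {z | z.1 ∈ C ∧ f z.1 ≤ z.2} with hE
  have hnot : (p, r) ∉ closure E := by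
    obtain ⟨r', hrr', hr'⟩ := exists_between hr
    have h1 : ∀ᶠ q in 𝓝 p, q ∈ C → r' < f q :=
      eventually_nhdsWithin_iff.1 ((hc p hp).eventually (lt_mem_nhds hr'))
    have h2 : ∀ᶠ z : (Fin n → ℝ) × ℝ in 𝓝 (p, r), (z.1 ∈ C → r' < f z.1) ∧ z.2 < r' := by
      rw [nhds_prod_eq]
      exact h1.prod_mk (gt_mem_nhds hrr')
    rw [mem_closure_iff_frequently]
    intro hfr
    obtain ⟨z, hz, hz'⟩ := (hfr.and_eventually h2).exists
    have := hz'.1 hz.1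
    linarith [hz.2, hz'.2]
  obtain ⟨L, u, hLu, hLE⟩ := geometric_hahn_banach_point_closed
    (hf.convex_epigraph.closure) isClosed_closure hnot
  have hLE' : ∀ q ∈ C, ∀ s, f q ≤ s → u < L (q, s) := fun q hq s hs =>
    hLE _ (subset_closure ⟨hq, hs⟩)
  set τ := L (0, 1) with hτ
  have hL : ∀ q s, L (q, s) = ∑ i, L (Pi.single i 1, 0) * q i + τ * s := by
    intro q s
    have h1 : (q, s) = (q, (0 : ℝ)) + s • ((0 : Fin n → ℝ), (1 : ℝ)) := by simp
    rw [h1, map_add, map_smul, smul_eq_mul, mul_comm s]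
    congr 1
    have h2 := LinearMap.pi_apply_eq_sum_univ
      ((L : (Fin n → ℝ) × ℝ →ₗ[ℝ] ℝ) ∘ₗ LinearMap.inl ℝ (Fin n → ℝ) ℝ) q
    simp only [LinearMap.comp_apply, LinearMap.inl_apply, smul_eq_mul] at h2
    refine h2.trans (Finset.sum_congr rfl fun i _ => ?_)
    rw [show (fun j => if i = j then (1 : ℝ) else 0) = Pi.single i 1 from by
      ext j; simp [Pi.single_apply, eq_comm], mul_comm]
    rfl
  have hτ0 : 0 < τ := by
    have h1 := hLE' p hp (f p) le_rfl
    have h2 := hLu.trans h1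
    rw [hL, hL] at h2
    nlinarith
  have hform : ∀ q : Fin n → ℝ, ∑ i, (-L (Pi.single i 1, 0) / τ) * q i + u / τ
      = (u - ∑ i, L (Pi.single i 1, 0) * q i) / τ := by
    intro q
    rw [sub_div, Finset.sum_div, sub_eq_neg_add, ← Finset.sum_neg_distrib]
    congr 1
    refine Finset.sum_congr rfl fun i _ => by ring
  refine ⟨fun i => -L (Pi.single i 1, 0) / τ, u / τ, fun q hq => ?_, ?_⟩
  · have h1 := hLE' q hq (f q) le_rfl
    rw [hform, div_le_iff₀ hτ0]
    rw [hL] at h1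
    linarith
  · rw [hform, lt_div_iff₀ hτ0]
    rw [hL] at hLu
    linarith

section Affine

variable {M : Type*} [CStarAlgebra M] {n : ℕ}

/-- The value of an affine function at a tuple of elements of an algebra. -/
def affineElement (x : Fin n → M) (c : Fin n → ℝ) (d : ℝ) : M :=
  ∑ i, (c i : ℂ) • x i + (d : ℂ) • 1

/-- An affine function as a continuous function on a subset of `ℝⁿ`. -/
def affineFun (S : Set (Fin n → ℝ)) (c : Fin n → ℝ) (d : ℝ) : C(S, ℝ) :=
  ⟨fun p => ∑ i, c i * (p : Fin n → ℝ) i + d,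
    (continuous_finsetSum _ fun i _ => continuous_const.mul
      ((continuous_apply i).comp continuous_subtype_val)).add continuous_const⟩

/-- The restriction of a real function to a set on which it is continuous. -/
def realRestrict (f : (Fin n → ℝ) → ℝ) (S : Set (Fin n → ℝ)) (hf : ContinuousOn f S) : C(S, ℝ) :=
  ⟨fun p => f p, hf.domRestrict⟩

theorem realHom_affineFun {x : Fin n → M} {Φ : C(spectralBox x, ℂ) →⋆ₐ[ℂ] M}
    (hΦ : ∀ i, Φ (coordFun x i) = x i) (c : Fin n → ℝ) (d : ℝ) :
    realHom Φ (affineFun _ c d) = affineElement x c d := by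
  rw [affineElement, ← map_one Φ]
  simp only [← hΦ, ← map_smul, ← map_sum, ← map_add]
  rw [realHom_apply]
  congr 1
  ext p
  simp [affineFun, coordFun]

theorem exists_jointCfc_eq_realHom {x : Fin n → M} (hsa : ∀ i, IsSelfAdjoint (x i))
    (hcomm : ∀ i j, x i * x j = x j * x i) :
    ∃ Φ : C(spectralBox x, ℂ) →⋆ₐ[ℂ] M, (∀ i, Φ (coordFun x i) = x i) ∧
      (∀ c d, realHom Φ (affineFun _ c d) = affineElement x c d) ∧
      ∀ (f : (Fin n → ℝ) → ℝ) (hf : ContinuousOn f (spectralBox x)),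
        jointCfc x f = realHom Φ (realRestrict f _ hf) := by
  obtain ⟨Φ, hΦ, h⟩ := exists_jointCfc_eq hsa hcomm
  exact ⟨Φ, hΦ, realHom_affineFun hΦ, h⟩

theorem jointCfc_sub_affine {x : Fin n → M} (hsa : ∀ i, IsSelfAdjoint (x i))
    (hcomm : ∀ i j, x i * x j = x j * x i) {f : (Fin n → ℝ) → ℝ}
    (hf : ContinuousOn f (spectralBox x)) (c : Fin n → ℝ) (d : ℝ) :
    jointCfc x (fun p => f p - (∑ i, c i * p i + d)) = jointCfc x f - affineElement x c d := by
  obtain ⟨Φ, -, haff, h⟩ := exists_jointCfc_eq_realHom hsa hcomm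
  rw [h f hf, h (fun p => f p - (∑ i, c i * p i + d)) (hf.sub (by fun_prop)), ← haff, ← map_sub]
  rfl

theorem jointCfc_isSelfAdjoint {x : Fin n → M} (hsa : ∀ i, IsSelfAdjoint (x i))
    (hcomm : ∀ i j, x i * x j = x j * x i) {f : (Fin n → ℝ) → ℝ}
    (hf : ContinuousOn f (spectralBox x)) : IsSelfAdjoint (jointCfc x f) := by
  obtain ⟨Φ, -, -, h⟩ := exists_jointCfc_eq_realHom hsa hcomm
  rw [h f hf]
  exact realHom_isSelfAdjoint Φ _

theorem jointCfc_nonneg [PartialOrder M] [StarOrderedRing M] {x : Fin n → M}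
    (hsa : ∀ i, IsSelfAdjoint (x i)) (hcomm : ∀ i j, x i * x j = x j * x i)
    {f : (Fin n → ℝ) → ℝ} (hf : ContinuousOn f (spectralBox x))
    (h0 : ∀ p ∈ spectralBox x, 0 ≤ f p) : 0 ≤ jointCfc x f := by
  obtain ⟨Φ, -, -, h⟩ := exists_jointCfc_eq_realHom hsa hcomm
  rw [h f hf]
  exact realHom_nonneg Φ fun p => h0 p p.2

theorem spectralBox_nonempty [Nontrivial M] {x : Fin n → M} (hsa : ∀ i, IsSelfAdjoint (x i)) :
    (spectralBox x).Nonempty :=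
  Set.univ_pi_nonempty_iff.2 fun i => ContinuousFunctionalCalculus.spectrum_nonempty (R := ℝ) (x i) (hsa i)

end Affine

/-! ### The Jensen inequality -/

section Jensen

variable {A : Type*} [NonUnitalCStarAlgebra A] [PartialOrder A] [StarOrderedRing A]
  {T : Type*} [MeasurableSpace T] {μ : Measure T} {n : ℕ} {a : T → 𝓜(ℂ, A)}
  {x : T → Fin n → 𝓜(ℂ, A)} {y : Fin n → A}

theorem integral_affineElement (ha : IsUnitalColumnField μ a)
    (hy : ∀ i, HasWeakStarIntegral μ (fun t => star (a t) * x t i * a t) (y i : 𝓜(ℂ, A)))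
    (c : Fin n → ℝ) (d : ℝ) :
    HasWeakStarIntegral μ (fun t => star (a t) * affineElement (x t) c d * a t)
      (affineElement (fun i => (y i : 𝓜(ℂ, A))) c d) := by
  have h := (HasWeakStarIntegral.sum Finset.univ fun i _ => (hy i).smul (c i : ℂ)).add
    (ha.integral_const (d : ℂ))
  have e : (fun t => star (a t) * affineElement (x t) c d * a t)
      = fun t => ∑ i, (c i : ℂ) • (star (a t) * x t i * a t) + star (a t) * ((d : ℂ) • 1) * a t := by
    ext1 t
    simp only [affineElement, mul_add, add_mul, Finset.mul_sum, Finset.sum_mul, mul_smul_comm,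
      smul_mul_assoc]
  rw [e]
  exact h

/-- The Jensen inequality for unbounded functionals and nonnegative functions: an affine minorant
`l` of `f` satisfies `l (y) = ∫ a⋆ l(x) a ≤ ∫ a⋆ f(x) a`. -/
theorem jensen_unbounded (ha : IsUnitalColumnField μ a)
    (hxsa : ∀ t i, IsSelfAdjoint (x t i)) (hxc : ∀ t i j, x t i * x t j = x t j * x t i)
    (hysa : ∀ i, IsSelfAdjoint (y i)) (hyc : ∀ i j, y i * y j = y j * y i)
    (hy : ∀ i, HasWeakStarIntegral μ (fun t => star (a t) * x t i * a t) (y i : 𝓜(ℂ, A)))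
    {C : Set (Fin n → ℝ)} (hxC : ∀ t, spectralBox (x t) ⊆ C)
    (hyC : spectralBox (fun i => (y i : 𝓜(ℂ, A))) ⊆ C)
    {f : (Fin n → ℝ) → ℝ} (hf : ContinuousOn f C) (hconv : ConvexOn ℝ C f)
    (hf0 : ∀ p ∈ C, 0 ≤ f p) {F : 𝓜(ℂ, A)}
    (hF : HasWeakStarIntegral μ (fun t => star (a t) * jointCfc (x t) f * a t) F)
    {φ : A → ℝ≥0∞} (hφ : IsUnboundedFunctional φ) (hcen : ∀ i, InUnboundedCentralizer φ (y i)) :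
    extUnbounded φ (jointCfc (fun i => (y i : 𝓜(ℂ, A))) f) ≤ extUnbounded φ F := by
  obtain ⟨Φ, hΦ, haff, h⟩ := exists_jointCfc_eq_realHom (x := fun i => (y i : 𝓜(ℂ, A)))
    (fun i => isSelfAdjoint_coe.2 (hysa i))
    (fun i j => by rw [← coe_mul_coe, ← coe_mul_coe, hyc])
  rw [h f (hf.mono hyC)]
  have hF0 : 0 ≤ F := hF.nonneg fun t => star_left_conjugate_nonneg
    (jointCfc_nonneg (hxsa t) (hxc t) (hf.mono (hxC t)) fun p hp => hf0 p (hxC t hp)) _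
  refine extUnbounded_realHom_le hφ (isAdditiveAlong hφ hcen Φ hΦ)
    (show 0 ≤ realRestrict f _ (hf.mono hyC) from fun p => hf0 p (hyC p.2)) hF0
    (L := {l | ∃ c d, (∀ q ∈ C, ∑ i, c i * q i + d ≤ f q) ∧ l = affineFun _ c d}) ?_ ?_
  · intro p r hr
    obtain ⟨c, d, hcd, hlt⟩ := exists_affine_minorant hf hconv (hyC p.2) hr
    exact ⟨_, ⟨c, d, hcd, rfl⟩, hlt⟩
  · rintro _ ⟨c, d, hcd, rfl⟩
    rw [haff, ← sub_nonneg]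
    have h1 := hF.sub (integral_affineElement ha hy c d)
    rw [← column_sub] at h1
    refine h1.nonneg fun t => star_left_conjugate_nonneg ?_ _
    rw [← jointCfc_sub_affine (hxsa t) (hxc t) (hf.mono (hxC t))]
    exact jointCfc_nonneg (hxsa t) (hxc t) ((hf.mono (hxC t)).sub (by fun_prop))
      fun p hp => sub_nonneg.2 (hcd p (hxC t hp))

/-- A bounded positive functional, as an unbounded one. -/
def toUnbounded (φ : A →ₚ[ℂ] ℂ) (x : A) : ℝ≥0∞ := ENNReal.ofReal (φ x).re

theorem isUnboundedFunctional_toUnbounded (φ : A →ₚ[ℂ] ℂ) :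
    IsUnboundedFunctional (toUnbounded φ) where
  map_add x y hx hy := by
    rw [toUnbounded, map_add, Complex.add_re, ENNReal.ofReal_add (re_nonneg φ hx) (re_nonneg φ hy)]
    rfl
  map_smul c x hx := by
    have h1 : c • x = ((c : ℝ) : ℂ) • x := by rw [Complex.coe_smul]; rfl
    rw [toUnbounded, h1, map_smul, smul_eq_mul, Complex.re_ofReal_mul,
      ENNReal.ofReal_mul c.coe_nonneg, ENNReal.ofReal_coe_nnreal]
    rfl
  lsc := (ENNReal.continuous_ofReal.comp
    (Complex.continuous_re.comp (posCLM φ).continuous)).lowerSemicontinuous.lowerSemicontinuousOn _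
  finite _ _ _ := ENNReal.ofReal_ne_top

theorem inUnboundedCentralizer_toUnbounded {φ : A →ₚ[ℂ] ℂ} {y : A} (h : InCentralizer φ y) :
    InUnboundedCentralizer (toUnbounded φ) y :=
  ⟨φ.toLinearMap, fun x _ hx => by
    rw [toUnbounded, ENNReal.toReal_ofReal (re_nonneg φ hx)]
    exact isSelfAdjoint_apply φ (.of_nonneg hx), fun x _ => h x⟩

theorem extUnbounded_toUnbounded (φ : A →ₚ[ℂ] ℂ) {m : 𝓜(ℂ, A)} (hm : 0 ≤ m) :
    extUnbounded (toUnbounded φ) m = ENNReal.ofReal (ext (posCLM φ) m).re := by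
  refine le_antisymm (extUnbounded_le fun x hx hxm => ?_) ?_
  · have := (ext_mono φ hxm).1
    rw [ext_coe] at this
    exact ENNReal.ofReal_le_ofReal this
  · refine le_of_forall_lt fun r hr => ?_
    have h1 := tendsto_apply_sandwich (posCLM φ) (CFC.sqrt m)
    rw [isSelfAdjoint_sqrt, CFC.sqrt_mul_sqrt_self m hm] at h1
    have h3 := ENNReal.tendsto_ofReal ((Complex.continuous_re.tendsto _).comp h1)
    obtain ⟨e, he, he0, he1⟩ := ((h3.eventually (lt_mem_nhds hr)).and
      ((CStarAlgebra.increasingApproximateUnit A).eventually_nonneg.and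
        (CStarAlgebra.increasingApproximateUnit A).eventually_norm)).exists
    refine he.trans_le (le_extUnbounded (φ := toUnbounded φ) (sandwich_nonneg _ he0)
      (coe_sandwich_sqrt_le hm he0 he1))

/-- The Jensen inequality for bounded functionals: subtract an affine minorant to reduce to a
nonnegative function. -/
theorem jensen_bounded (ha : IsUnitalColumnField μ a)
    (hxsa : ∀ t i, IsSelfAdjoint (x t i)) (hxc : ∀ t i j, x t i * x t j = x t j * x t i)
    (hysa : ∀ i, IsSelfAdjoint (y i)) (hyc : ∀ i j, y i * y j = y j * y i)
    (hy : ∀ i, HasWeakStarIntegral μ (fun t => star (a t) * x t i * a t) (y i : 𝓜(ℂ, A)))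
    {C : Set (Fin n → ℝ)} (hxC : ∀ t, spectralBox (x t) ⊆ C)
    (hyC : spectralBox (fun i => (y i : 𝓜(ℂ, A))) ⊆ C)
    {f : (Fin n → ℝ) → ℝ} (hf : ContinuousOn f C) (hconv : ConvexOn ℝ C f) {F : 𝓜(ℂ, A)}
    (hF : HasWeakStarIntegral μ (fun t => star (a t) * jointCfc (x t) f * a t) F)
    (φ : A →ₚ[ℂ] ℂ) (hcen : ∀ i, InCentralizer φ (y i)) :
    ext (posCLM φ) (jointCfc (fun i => (y i : 𝓜(ℂ, A))) f) ≤ ext (posCLM φ) F := by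
  cases subsingleton_or_nontrivial 𝓜(ℂ, A)
  · rw [Subsingleton.elim F (jointCfc (fun i => (y i : 𝓜(ℂ, A))) f)]
  have hysa' : ∀ i, IsSelfAdjoint (y i : 𝓜(ℂ, A)) := fun i => isSelfAdjoint_coe.2 (hysa i)
  have hyc' : ∀ i j, (y i : 𝓜(ℂ, A)) * y j = y j * y i := fun i j => by
    rw [← coe_mul_coe, ← coe_mul_coe, hyc]
  obtain ⟨p₀, hp₀⟩ := spectralBox_nonempty hysa'
  obtain ⟨c, d, hcd, -⟩ := exists_affine_minorant hf hconv (hyC hp₀) (sub_one_lt _)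
  have hf0 : ∀ p ∈ C, 0 ≤ f p - (∑ i, c i * p i + d) := fun p hp => sub_nonneg.2 (hcd p hp)
  have hcont : ContinuousOn (fun p => f p - (∑ i, c i * p i + d)) C := hf.sub (by fun_prop)
  have haff : ConcaveOn ℝ C fun p : Fin n → ℝ => ∑ i, c i * p i + d := by
    refine ⟨hconv.1, fun p _ q _ s t _ _ hst => le_of_eq ?_⟩
    simp only [smul_eq_mul, Pi.add_apply, Pi.smul_apply, mul_add, Finset.sum_add_distrib,
      Finset.mul_sum]
    have : d = s * d + t * d := by rw [← add_mul, hst, one_mul]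
    rw [add_add_add_comm, ← this]
    congr 2 <;> exact Finset.sum_congr rfl fun i _ => by ring
  have hint := hF.sub (integral_affineElement ha hy c d)
  rw [← column_sub] at hint
  simp only [← jointCfc_sub_affine (hxsa _) (hxc _) (hf.mono (hxC _))] at hint
  have hG0 : 0 ≤ jointCfc (fun i => (y i : 𝓜(ℂ, A))) fun p => f p - (∑ i, c i * p i + d) :=
    jointCfc_nonneg hysa' hyc' (hcont.mono hyC) fun p hp => hf0 p (hyC hp)
  have hF0 := hint.nonneg fun t => star_left_conjugate_nonneg
    (jointCfc_nonneg (hxsa t) (hxc t) (hcont.mono (hxC t)) fun p hp => hf0 p (hxC t hp)) _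
  have h1 := jensen_unbounded ha hxsa hxc hysa hyc hy hxC hyC hcont (hconv.sub haff) hf0 hint
    (isUnboundedFunctional_toUnbounded φ) fun i => inUnboundedCentralizer_toUnbounded (hcen i)
  rw [extUnbounded_toUnbounded φ hG0, extUnbounded_toUnbounded φ hF0,
    ENNReal.ofReal_le_ofReal_iff (ext_nonneg φ hF0).1] at h1
  have h2 : ext (posCLM φ) (jointCfc (fun i => (y i : 𝓜(ℂ, A)))
      fun p => f p - (∑ i, c i * p i + d)) ≤ ext (posCLM φ)
        (F - affineElement (fun i => (y i : 𝓜(ℂ, A))) c d) :=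
    ⟨h1, (ext_nonneg φ hG0).2.symm.trans (ext_nonneg φ hF0).2⟩
  rw [jointCfc_sub_affine hysa' hyc' (hf.mono hyC), map_sub, map_sub] at h2
  exact (sub_le_sub_iff_right _).1 h2

end Jensen

/-! ### Measurability of fields of multipliers -/

section Pettis

variable {E : Type*} [NormedAddCommGroup E] [NormedSpace ℂ E]

/-- The dual of a separable space contains a separating sequence. -/
theorem exists_separating_seq [TopologicalSpace.SeparableSpace E] :
    ∃ ω : ℕ → E →L[ℂ] ℂ, ∀ u, (∀ k, ω k u = 0) → u = 0 := by
  choose g hg hgn using fun v : E => exists_dual_vector'' ℂ v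
  refine ⟨fun k => g (TopologicalSpace.denseSeq E k), fun u hu => ?_⟩
  have h1 : ∀ k, ‖TopologicalSpace.denseSeq E k‖ ≤ ‖TopologicalSpace.denseSeq E k - u‖ := by
    intro k
    set v := TopologicalSpace.denseSeq E k
    have h2 : ((‖v‖ : ℝ) : ℂ) = g v (v - u) := by
      rw [map_sub, hu k, sub_zero]; exact (hgn v).symm
    have h3 := (g v).le_of_opNorm_le (hg v) (v - u)
    rw [← h2, one_mul] at h3
    simpa using h3
  have h4 : ∀ v : E, ‖v‖ ≤ ‖v - u‖ := fun v =>
    (TopologicalSpace.denseRange_denseSeq E).induction_on v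
      (isClosed_le continuous_norm (by fun_prop)) h1
  simpa using h4 u

/-- Pettis' theorem for a separable Banach space: weakly measurable functions are strongly
measurable. -/
theorem aestronglyMeasurable_of_forall_functional [CompleteSpace E]
    [TopologicalSpace.SeparableSpace E] {T : Type*} [MeasurableSpace T] {μ : Measure T} {u : T → E}
    (h : ∀ ω : E →L[ℂ] ℂ, AEMeasurable (fun t => ω (u t)) μ) : AEStronglyMeasurable u μ := by
  borelize E
  have : SecondCountableTopology E := UniformSpace.secondCountable_of_separable E
  obtain ⟨ω, hω⟩ := exists_separating_seq (E := E)
  have hemb : MeasurableEmbedding fun (v : E) (k : ℕ) => ω k v := by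
    refine Continuous.measurableEmbedding (by fun_prop) fun v w hvw => ?_
    rw [← sub_eq_zero]
    exact hω _ fun k => by rw [map_sub, sub_eq_zero]; exact congrFun hvw k
  rw [aestronglyMeasurable_iff_aemeasurable, ← hemb.aemeasurable_comp_iff]
  exact aemeasurable_pi_lambda _ fun k => h (ω k)

/-- A strongly measurable field of operators maps measurable fields of vectors to measurable
fields. -/
theorem aestronglyMeasurable_apply {T : Type*} [MeasurableSpace T] {μ : Measure T}
    {N : T → E →L[ℂ] E} (hN : ∀ b, AEStronglyMeasurable (fun t => N t b) μ) {u : T → E}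
    (hu : AEStronglyMeasurable u μ) : AEStronglyMeasurable (fun t => N t (u t)) μ := by
  obtain ⟨v, hv, huv⟩ := hu
  have hsimple : ∀ s : SimpleFunc T E, AEStronglyMeasurable (fun t => N t (s t)) μ := by
    classical
    intro s
    have e : (fun t => N t (s t)) = fun t =>
        ∑ b ∈ s.range, (s ⁻¹' {b}).indicator (fun t => N t b) t := by
      ext1 t
      rw [Finset.sum_eq_single (s t)]
      · simp
      · intro b _ hb
        have h : t ∉ s ⁻¹' {b} := fun h => hb (Set.mem_singleton_iff.1 h).symm
        rw [Set.indicator_of_notMem h]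
      · intro h
        exact absurd (s.mem_range_self t) h
    rw [e]
    exact Finset.aestronglyMeasurable_fun_sum _ fun b _ => (hN b).indicator (s.measurableSet_fiber b)
  have hlim : AEStronglyMeasurable (fun t => N t (v t)) μ :=
    aestronglyMeasurable_of_tendsto_ae atTop (fun k => hsimple (hv.approx k))
      (Eventually.of_forall fun t => ((N t).continuous.tendsto _).comp (hv.tendsto_approx t))
  refine hlim.congr ?_
  filter_upwards [huv] with t ht
  rw [ht]

end Pettis

section StrictMeasurability

variable {A : Type*} [NonUnitalCStarAlgebra A] {T : Type*} [MeasurableSpace T] {μ : Measure T}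

/-- Strict measurability of a field of multipliers: its products with elements of `A` from either
side are strongly measurable. -/
def StrictlyMeasurable (μ : Measure T) (m : T → 𝓜(ℂ, A)) : Prop :=
  ∀ b : A, AEStronglyMeasurable (fun t => (m t).fst b) μ ∧
    AEStronglyMeasurable (fun t => (m t).snd b) μ

namespace StrictlyMeasurable

variable {m m' : T → 𝓜(ℂ, A)}

theorem const (c : 𝓜(ℂ, A)) : StrictlyMeasurable μ fun _ : T => c := fun _ =>
  ⟨aestronglyMeasurable_const, aestronglyMeasurable_const⟩

theorem congr (h : StrictlyMeasurable μ m) (h' : ∀ t, m t = m' t) : StrictlyMeasurable μ m' :=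
  funext h' ▸ h

theorem add (h : StrictlyMeasurable μ m) (h' : StrictlyMeasurable μ m') :
    StrictlyMeasurable μ fun t => m t + m' t := fun b =>
  ⟨(h b).1.add (h' b).1, (h b).2.add (h' b).2⟩

theorem mul (h : StrictlyMeasurable μ m) (h' : StrictlyMeasurable μ m') :
    StrictlyMeasurable μ fun t => m t * m' t := fun b =>
  ⟨aestronglyMeasurable_apply (fun c => (h c).1) (h' b).1,
    aestronglyMeasurable_apply (fun c => (h' c).2) (h b).2⟩

theorem star (h : StrictlyMeasurable μ m) : StrictlyMeasurable μ fun t => Star.star (m t) := by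
  intro b
  have h1 : ∀ t, (Star.star (m t)).fst b = Star.star ((m t).snd (Star.star b)) := fun t => by simp
  have h2 : ∀ t, (Star.star (m t)).snd b = Star.star ((m t).fst (Star.star b)) := fun t => by simp
  simp only [h1, h2]
  exact ⟨(h _).2.star, (h _).1.star⟩

theorem of_tendsto {M : ℕ → T → 𝓜(ℂ, A)} (hM : ∀ k, StrictlyMeasurable μ (M k))
    (h : ∀ t, Tendsto (fun k => M k t) atTop (𝓝 (m t))) : StrictlyMeasurable μ m := by
  intro b
  have h1 : ∀ t, Tendsto (fun k => (M k t).fst b) atTop (𝓝 ((m t).fst b)) := fun t => by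
    rw [tendsto_iff_norm_sub_tendsto_zero]
    refine squeeze_zero (fun _ => norm_nonneg _) (fun k => ?_)
      (by simpa using (tendsto_iff_norm_sub_tendsto_zero.1 (h t)).mul_const ‖b‖)
    simpa using norm_fst_apply_le (M k t - m t) b
  have h2 : ∀ t, Tendsto (fun k => (M k t).snd b) atTop (𝓝 ((m t).snd b)) := fun t => by
    rw [tendsto_iff_norm_sub_tendsto_zero]
    refine squeeze_zero (fun _ => norm_nonneg _) (fun k => ?_)
      (by simpa using (tendsto_iff_norm_sub_tendsto_zero.1 (h t)).mul_const ‖b‖)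
    have := (M k t - m t).snd.le_opNorm b
    rw [DoubleCentralizer.norm_snd] at this
    simpa using this
  exact ⟨aestronglyMeasurable_of_tendsto_ae atTop (fun k => (hM k b).1) (Eventually.of_forall h1),
    aestronglyMeasurable_of_tendsto_ae atTop (fun k => (hM k b).2) (Eventually.of_forall h2)⟩

end StrictlyMeasurable

variable [PartialOrder A] [StarOrderedRing A]

theorem ext_comp_mulRight (ω : A →L[ℂ] ℂ) (b : A) (m : 𝓜(ℂ, A)) :
    ext (ω ∘L (ContinuousLinearMap.mul ℂ A).flip b) m = ω (m.fst b) := by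
  refine tendsto_nhds_unique (tendsto_extFunctional _ m) ?_
  have h1 := (CStarAlgebra.increasingApproximateUnit A).tendsto_mul_right b
  refine (((ω ∘L m.fst).continuous.tendsto b).comp h1).congr fun e => ?_
  simp [fst_mul]

theorem ext_comp_mulLeft (ω : A →L[ℂ] ℂ) (b : A) (m : 𝓜(ℂ, A)) :
    ext (ω ∘L ContinuousLinearMap.mul ℂ A b) m = ω (m.snd b) := by
  refine tendsto_nhds_unique (tendsto_extFunctional _ m) ?_
  have h1 := (CStarAlgebra.increasingApproximateUnit A).tendsto_mul_left (m.snd b)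
  refine ((ω.continuous.tendsto _).comp h1).congr fun e => ?_
  simp [m.central]

theorem WeakStarMeasurable.strictlyMeasurable [TopologicalSpace.SeparableSpace A]
    {m : T → 𝓜(ℂ, A)} (h : WeakStarMeasurable μ m) : StrictlyMeasurable μ m := by
  refine fun b => ⟨aestronglyMeasurable_of_forall_functional fun ω => ?_,
    aestronglyMeasurable_of_forall_functional fun ω => ?_⟩
  · simpa only [← ext_apply, ext_comp_mulRight] using h (ω ∘L (ContinuousLinearMap.mul ℂ A).flip b)
  · simpa only [← ext_apply, ext_comp_mulLeft] using h (ω ∘L ContinuousLinearMap.mul ℂ A b)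

/-- Approximate units can be replaced by sequences for a given functional, uniformly on bounded sets
of multipliers. -/
theorem exists_seq_norm_sub_ext_le (ω : A →L[ℂ] ℂ) :
    ∃ e : ℕ → A, ∀ k (m : 𝓜(ℂ, A)), ‖ω (m.fst (e k)) - ext ω m‖ ≤ 1 / ((k : ℝ) + 1) * ‖m‖ := by
  choose e he using fun k : ℕ => (eventually_norm_sub_extFunctional_le ω
    (show (0 : ℝ) < 1 / ((k : ℝ) + 1) by positivity)).exists
  exact ⟨e, he⟩

theorem StrictlyMeasurable.ext {m : T → 𝓜(ℂ, A)} (h : StrictlyMeasurable μ m) (ω : A →L[ℂ] ℂ) :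
    AEStronglyMeasurable (fun t => ext ω (m t)) μ := by
  obtain ⟨e, he⟩ := exists_seq_norm_sub_ext_le ω
  refine aestronglyMeasurable_of_tendsto_ae atTop
    (fun k => ω.continuous.comp_aestronglyMeasurable (h (e k)).1) (Eventually.of_forall fun t => ?_)
  rw [tendsto_iff_norm_sub_tendsto_zero]
  refine squeeze_zero (fun _ => norm_nonneg _) (fun k => he k (m t)) ?_
  simpa using (tendsto_one_div_add_atTop_nhds_zero_nat (𝕜 := ℝ)).mul_const ‖m t‖

end StrictMeasurability

/-! ### Measurability of the functional calculus -/

/-- An interval is exhausted by a sequence of compact subintervals. -/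
theorem exists_seq_exhaustion {I : Set ℝ} (hI : I.OrdConnected) (hne : I.Nonempty) :
    ∃ α β : ℕ → ℝ, (∀ j, Set.Icc (α j) (β j) ⊆ I) ∧ (∀ j, α j ≤ β j) ∧
      ∀ s ∈ I, ∀ᶠ j in atTop, α j ≤ s ∧ s ≤ β j := by
  have : Nonempty I := hne.to_subtype
  obtain ⟨u, hu⟩ := (atTop : Filter I).exists_seq_tendsto
  obtain ⟨v, hv⟩ := (atBot : Filter I).exists_seq_tendsto
  refine ⟨fun j => min (v j : ℝ) (u j), fun j => u j, fun j => ?_, fun j => min_le_right _ _,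
    fun s hs => ?_⟩
  · have h0 : min (v j : ℝ) (u j) ∈ I := by
      rcases min_choice (v j : ℝ) (u j) with h | h <;> rw [h]
      exacts [(v j).2, (u j).2]
    exact hI.out h0 (u j).2
  · filter_upwards [hu.eventually (eventually_ge_atTop (⟨s, hs⟩ : I)),
      hv.eventually (eventually_le_atBot (⟨s, hs⟩ : I))] with j h h'
    exact ⟨(min_le_left _ _).trans h', h⟩

section

variable {A : Type*} [NonUnitalCStarAlgebra A] [PartialOrder A] [StarOrderedRing A]
  {T : Type*} [MeasurableSpace T] {μ : Measure T}
  {n : ℕ} {x : T → Fin n → 𝓜(ℂ, A)}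

theorem jointCfc_congr {M : Type*} [CStarAlgebra M] {x : Fin n → M} (hsa : ∀ i, IsSelfAdjoint (x i))
    (hcomm : ∀ i j, x i * x j = x j * x i) {f g : (Fin n → ℝ) → ℝ}
    (hf : ContinuousOn f (spectralBox x)) (h : Set.EqOn g f (spectralBox x)) :
    jointCfc x g = jointCfc x f := by
  obtain ⟨Φ, -, -, hΦ⟩ := exists_jointCfc_eq_realHom hsa hcomm
  rw [hΦ f hf, hΦ g (hf.congr h)]
  congr 1
  ext p
  exact h p.2

/-- The functional calculus for functions that are continuous on `ℝⁿ` preserves strict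
measurability, by polynomial approximation on a cube. -/
theorem strictlyMeasurable_jointCfc_of_continuous (hsa : ∀ t i, IsSelfAdjoint (x t i))
    (hcomm : ∀ t i j, x t i * x t j = x t j * x t i)
    (hbdd : ∃ R : ℝ, ∀ t i, ‖x t i‖ ≤ R) (hx : ∀ i, StrictlyMeasurable μ fun t => x t i)
    {h : (Fin n → ℝ) → ℝ} (hh : Continuous h) :
    StrictlyMeasurable μ fun t => jointCfc (x t) h := by
  obtain ⟨R, hR⟩ := hbdd
  cases subsingleton_or_nontrivial 𝓜(ℂ, A)
  · have : (fun t => jointCfc (x t) h) = fun _ => 0 := by ext1 t; exact Subsingleton.elim _ _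
    rw [this]
    exact StrictlyMeasurable.const _
  let Q : Set (Fin n → ℝ) := Set.univ.pi fun _ => Set.Icc (-R) R
  have : CompactSpace Q := isCompact_iff_compactSpace.1 (isCompact_univ_pi fun _ => isCompact_Icc)
  have hQ : ∀ t, spectralBox (x t) ⊆ Q := fun t =>
    Set.pi_mono fun i _ s hs => abs_le.1 ((spectrum.norm_le_norm_of_mem hs).trans (hR t i))
  choose Φ hΦ _ hcfc using fun t => exists_jointCfc_eq_realHom (hsa t) (hcomm t)
  let ι : ∀ t, C(spectralBox (x t), Q) := fun t => ⟨Set.inclusion (hQ t), continuous_inclusion _⟩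
  have key : ∀ k : C(Q, ℝ), StrictlyMeasurable μ fun t => realHom (Φ t) (k.comp (ι t)) := by
    intro k
    induction k using continuousMap_induction with
    | hconst r =>
      have : (fun t => realHom (Φ t) ((ContinuousMap.const Q r).comp (ι t)))
          = fun _ => (r : ℂ) • (1 : 𝓜(ℂ, A)) := by
        ext1 t
        rw [← realHom_const (Φ t)]
        rfl
      rw [this]
      exact StrictlyMeasurable.const _
    | hcoord i =>
      refine (hx i).congr fun t => ?_
      rw [← hΦ t i]
      rfl
    | hadd g k hg hk => exact (hg.add hk).congr fun t => (map_add (realHom (Φ t)) _ _).symm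
    | hmul g k hg hk => exact (hg.mul hk).congr fun t => (map_mul (realHom (Φ t)) _ _).symm
    | hclosed =>
      refine IsSeqClosed.isClosed fun k k₀ hk hlim => ?_
      refine StrictlyMeasurable.of_tendsto hk fun t => ?_
      exact (((continuous_realHom (Φ t)).comp (ContinuousMap.continuous_precomp (ι t))).tendsto
        k₀).comp hlim
  refine (key (realRestrict h Q hh.continuousOn)).congr fun t => ?_
  rw [hcfc t h hh.continuousOn]
  rfl

/-- The functional calculus preserves strict measurability: functions on a product of intervals are
limits of functions that are continuous on `ℝⁿ`. -/
theorem strictlyMeasurable_jointCfc (hsa : ∀ t i, IsSelfAdjoint (x t i))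
    (hcomm : ∀ t i j, x t i * x t j = x t j * x t i)
    (hbdd : ∃ R : ℝ, ∀ t i, ‖x t i‖ ≤ R) (hx : ∀ i, StrictlyMeasurable μ fun t => x t i)
    {I : Fin n → Set ℝ} (hI : ∀ i, (I i).OrdConnected) (hspec : ∀ t i, spectrum ℝ (x t i) ⊆ I i)
    {f : (Fin n → ℝ) → ℝ} (hf : ContinuousOn f (Set.univ.pi I)) :
    StrictlyMeasurable μ fun t => jointCfc (x t) f := by
  cases subsingleton_or_nontrivial 𝓜(ℂ, A)
  · have : (fun t => jointCfc (x t) f) = fun _ => 0 := by ext1 t; exact Subsingleton.elim _ _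
    rw [this]
    exact StrictlyMeasurable.const _
  cases isEmpty_or_nonempty T with
  | inl hT =>
    have : (fun t => jointCfc (x t) f) = fun _ => 0 := by ext1 t; exact hT.elim t
    rw [this]
    exact StrictlyMeasurable.const _
  | inr hT =>
  have hne : ∀ t i, (spectrum ℝ (x t i)).Nonempty := fun t i =>
    ContinuousFunctionalCalculus.spectrum_nonempty (R := ℝ) (x t i) (hsa t i)
  obtain ⟨t₀⟩ := hT
  choose α β hαβI hαβ hlim using fun i =>
    exists_seq_exhaustion (hI i) ((hne t₀ i).mono (hspec t₀ i))
  let π : ℕ → (Fin n → ℝ) → Fin n → ℝ := fun j p i => max (α i j) (min (p i) (β i j))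
  have hπ : ∀ j, Continuous (π j) := fun j => by fun_prop
  have hπI : ∀ j p, π j p ∈ Set.univ.pi I := fun j p i _ =>
    hαβI i j ⟨le_max_left _ _, max_le (hαβ i j) (min_le_right _ _)⟩
  have hcont : ∀ j, Continuous (f ∘ π j) := fun j => hf.comp_continuous (hπ j) (hπI j)
  refine StrictlyMeasurable.of_tendsto
    (fun j => strictlyMeasurable_jointCfc_of_continuous hsa hcomm hbdd hx (hcont j)) fun t => ?_
  refine tendsto_const_nhds.congr' ?_
  have hev : ∀ᶠ j in atTop, ∀ i, ∀ s ∈ spectrum ℝ (x t i), α i j ≤ s ∧ s ≤ β i j := by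
    refine eventually_all.2 fun i => ?_
    obtain ⟨s₀, hs₀, hmin⟩ := (spectrum.isCompact (𝕜 := ℝ) (x t i)).exists_isLeast (hne t i)
    obtain ⟨s₁, hs₁, hmax⟩ := (spectrum.isCompact (𝕜 := ℝ) (x t i)).exists_isGreatest (hne t i)
    filter_upwards [hlim i s₀ (hspec t i hs₀), hlim i s₁ (hspec t i hs₁)] with j h h' s hs
    exact ⟨h.1.trans (hmin hs), (hmax hs).trans h'.2⟩
  filter_upwards [hev] with j hj
  refine (jointCfc_congr (hsa t) (hcomm t) (hf.mono (Set.pi_mono fun i _ => hspec t i))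
    fun p hp => ?_).symm
  have : π j p = p := by
    ext i
    have := hj i (p i) (hp i trivial)
    change max (α i j) (min (p i) (β i j)) = p i
    rw [min_eq_left this.2, max_eq_right this.1]
  rw [Function.comp_apply, this]

end

/-! ### Existence of weak⋆ integrals -/

section Existence

variable {A : Type*} [NonUnitalCStarAlgebra A] [PartialOrder A] [StarOrderedRing A]
  {T : Type*} [MeasurableSpace T] {μ : Measure T}

/-- Bounded strictly measurable fields on a finite measure space are integrable. -/
theorem exists_integral_of_bounded [IsFiniteMeasure μ] {m : T → 𝓜(ℂ, A)}
    (hm : StrictlyMeasurable μ m) {K : ℝ} (hK : ∀ᵐ t ∂μ, ‖m t‖ ≤ K) :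
    ∃ N : 𝓜(ℂ, A), HasWeakStarIntegral μ m N := by
  have hfst : ∀ b, ∀ᵐ t ∂μ, ‖(m t).fst b‖ ≤ K * ‖b‖ := fun b => by
    filter_upwards [hK] with t ht
    exact (norm_fst_apply_le _ _).trans (by gcongr)
  have hsnd : ∀ b, ∀ᵐ t ∂μ, ‖(m t).snd b‖ ≤ K * ‖b‖ := fun b => by
    filter_upwards [hK] with t ht
    have := (m t).snd.le_opNorm b
    rw [DoubleCentralizer.norm_snd] at this
    exact this.trans (by gcongr)
  have hifst : ∀ b, Integrable (fun t => (m t).fst b) μ := fun b => .of_bound (hm b).1 _ (hfst b)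
  have hisnd : ∀ b, Integrable (fun t => (m t).snd b) μ := fun b => .of_bound (hm b).2 _ (hsnd b)
  let L : A →L[ℂ] A := LinearMap.mkContinuous
    { toFun := fun b => ∫ t, (m t).fst b ∂μ
      map_add' := fun b c => by simp only [map_add]; exact integral_add (hifst b) (hifst c)
      map_smul' := fun r b => by simp only [map_smul]; exact integral_smul r _ }
    (K * μ.real Set.univ) fun b => by
      refine (norm_integral_le_of_norm_le_const (hfst b)).trans_eq ?_
      ring
  let R : A →L[ℂ] A := LinearMap.mkContinuous
    { toFun := fun b => ∫ t, (m t).snd b ∂μ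
      map_add' := fun b c => by simp only [map_add]; exact integral_add (hisnd b) (hisnd c)
      map_smul' := fun r b => by simp only [map_smul]; exact integral_smul r _ }
    (K * μ.real Set.univ) fun b => by
      refine (norm_integral_le_of_norm_le_const (hsnd b)).trans_eq ?_
      ring
  have hL : ∀ b, L b = ∫ t, (m t).fst b ∂μ := fun b => rfl
  have hR : ∀ b, R b = ∫ t, (m t).snd b ∂μ := fun b => rfl
  let N : 𝓜(ℂ, A) := ⟨(L, R), fun b c => by
    change R b * c = b * L c
    have h1 := ((ContinuousLinearMap.mul ℂ A).flip c).integral_comp_comm (hisnd b)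
    have h2 := (ContinuousLinearMap.mul ℂ A b).integral_comp_comm (hifst c)
    simp only [ContinuousLinearMap.flip_apply, ContinuousLinearMap.mul_apply'] at h1 h2
    rw [hR, hL, ← h1, ← h2]
    simp only [(m _).central]⟩
  refine ⟨N, fun ω => ?_⟩
  have hint : Integrable (fun t => ext ω (m t)) μ :=
    .of_bound (hm.ext ω) (‖ω‖ * K) (by
      filter_upwards [hK] with t ht
      exact (norm_ext_le ω _).trans (by gcongr))
  refine ⟨hint, ?_⟩
  obtain ⟨e, he⟩ := exists_seq_norm_sub_ext_le ω
  have hlim : ∀ m' : 𝓜(ℂ, A), Tendsto (fun k => ω (m'.fst (e k))) atTop (𝓝 (ext ω m')) := by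
    intro m'
    rw [tendsto_iff_norm_sub_tendsto_zero]
    refine squeeze_zero (fun _ => norm_nonneg _) (fun k => he k m') ?_
    simpa using (tendsto_one_div_add_atTop_nhds_zero_nat (𝕜 := ℝ)).mul_const ‖m'‖
  have h1 : Tendsto (fun k => ∫ t, ω ((m t).fst (e k)) ∂μ) atTop (𝓝 (∫ t, ext ω (m t) ∂μ)) := by
    refine tendsto_integral_of_dominated_convergence (fun _ => (‖ω‖ + 1) * K)
      (fun k => ω.continuous.comp_aestronglyMeasurable (hm (e k)).1) (integrable_const _)
      (fun k => ?_) (Eventually.of_forall fun t => hlim (m t))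
    filter_upwards [hK] with t ht
    have h2 := he k (m t)
    have h3 : (1 : ℝ) / (k + 1) * ‖m t‖ ≤ 1 * ‖m t‖ := by
      gcongr
      rw [div_le_one (by positivity)]
      linarith [(Nat.cast_nonneg k : (0 : ℝ) ≤ k)]
    calc ‖ω ((m t).fst (e k))‖ = ‖(ω ((m t).fst (e k)) - ext ω (m t)) + ext ω (m t)‖ := by
          rw [sub_add_cancel]
      _ ≤ 1 * ‖m t‖ + ‖ω‖ * ‖m t‖ :=
        (norm_add_le _ _).trans (add_le_add (h2.trans h3) (norm_ext_le ω _))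
      _ = (‖ω‖ + 1) * ‖m t‖ := by ring
      _ ≤ _ := by gcongr
  refine tendsto_nhds_unique h1 ((hlim N).congr fun k => ?_)
  exact (ω.integral_comp_comm (hifst (e k))).symm

theorem HasWeakStarIntegral.diff {m : T → 𝓜(ℂ, A)} {J J' : 𝓜(ℂ, A)} {S S' : Set T}
    (hS : MeasurableSet S) (hSS' : S ⊆ S') (h : HasWeakStarIntegral (μ.restrict S) m J)
    (h' : HasWeakStarIntegral (μ.restrict S') m J') :
    HasWeakStarIntegral (μ.restrict (S' \ S)) m (J' - J) := fun ω =>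
  ⟨IntegrableOn.mono_set (h' ω).1 Set.sdiff_subset, by
    rw [setIntegral_sdiff hS (h' ω).1 hSS', (h ω).2, (h' ω).2]
    exact (map_sub (ext ω) J' J).symm⟩

/-- **Dini's theorem**: a decreasing sequence of positive elements that converges weakly to `0`
converges in norm. -/
theorem tendsto_zero_of_antitone {G : ℕ → A} (h0 : ∀ k, 0 ≤ G k) (hG : Antitone G)
    (hω : ∀ ω : A →ₚ[ℂ] ℂ, Tendsto (fun k => ω (G k)) atTop (𝓝 0)) : Tendsto G atTop (𝓝 0) := by
  rw [Metric.tendsto_atTop]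
  intro δ hδ
  suffices h : ∃ k, ‖G k‖ < δ by
    obtain ⟨k, hk⟩ := h
    refine ⟨k, fun l hl => ?_⟩
    rw [dist_zero_right]
    exact (CStarAlgebra.norm_le_norm_of_nonneg_of_le (h0 l) (hG hl)).trans_lt hk
  by_contra! hcon
  -- otherwise some positive functional is at least `δ` on all elements of the sequence
  obtain ⟨g, hg, -⟩ := exists_linear_le_cost
    (fun (x : selfAdjoint A) (r : ℝ) => ∃ (k : ℕ) (s ρ : ℝ), 0 ≤ s ∧ 0 ≤ ρ ∧
      ((x : A) : 𝓜(ℂ, A)) + (s : ℂ) • (G k : 𝓜(ℂ, A)) ≤ algebraMap ℝ _ ρ ∧ r = ρ - s * δ)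
    (by
      rintro x y r r' ⟨k, s, ρ, hs, hρ, hx, rfl⟩ ⟨l, s', ρ', hs', hρ', hy, rfl⟩
      refine ⟨max k l, s + s', ρ + ρ', add_nonneg hs hs', add_nonneg hρ hρ', ?_, by ring⟩
      have h1 := smul_le_smul_coe hs (coe_le_coe.2 (hG (le_max_left k l)))
      have h2 := smul_le_smul_coe hs' (coe_le_coe.2 (hG (le_max_right k l)))
      rw [AddSubgroup.coe_add, coe_add, Complex.ofReal_add, add_smul, add_add_add_comm, map_add]
      exact add_le_add ((add_le_add le_rfl h1).trans hx) ((add_le_add le_rfl h2).trans hy))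
    (by
      rintro c hc x r ⟨k, s, ρ, hs, hρ, hx, rfl⟩
      refine ⟨k, c * s, c * ρ, by positivity, by positivity, ?_, by ring⟩
      rw [← smul_algebraMap, selfAdjoint.val_smul, coe_real_smul, Complex.ofReal_mul, mul_smul,
        ← smul_add]
      exact smul_le_smul_coe hc.le hx)
    (fun x => ⟨_, 0, 0, ‖(x : A)‖, le_rfl, norm_nonneg _, by
      rw [Complex.ofReal_zero, zero_smul, add_zero]; exact le_norm_mul_one x.2, rfl⟩)
    (fun x => ⟨-‖(x : A)‖, by
      rintro r ⟨k, s, ρ, hs, hρ, hx, rfl⟩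
      have h1 : (s : ℂ) • (G k : 𝓜(ℂ, A)) ≤ algebraMap ℝ _ (ρ + ‖(x : A)‖) := by
        have h2 := neg_norm_mul_one_le x.2
        rw [map_add]
        have h3 := add_le_add hx (neg_le.1 h2)
        rw [add_right_comm, add_neg_cancel, zero_add] at h3
        exact h3
      have h4 : 0 ≤ (s : ℂ) • (G k : 𝓜(ℂ, A)) := by
        rw [← coe_real_smul]; exact coe_nonneg.2 (smul_nonneg hs (h0 k))
      have h5 := (CStarAlgebra.norm_le_iff_le_algebraMap _
        (add_nonneg hρ (norm_nonneg _)) h4).2 h1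
      rw [norm_smul, norm_coe, Complex.norm_real, Real.norm_of_nonneg hs] at h5
      have h6 := mul_le_mul_of_nonneg_left (hcon k) hs
      linarith⟩) 0
  obtain ⟨ω, hω'⟩ := exists_positive_extension g fun a ha => by
    have h1 := hg (-a) _ ⟨0, 0, 0, le_rfl, le_rfl, by
      rw [Complex.ofReal_zero, zero_smul, add_zero, map_zero, AddSubgroup.coe_neg, coe_neg,
        neg_nonpos]
      exact coe_nonneg.2 ha, rfl⟩
    rw [map_neg] at h1
    linarith
  have hge : ∀ k, δ ≤ (ω (G k)).re := fun k => by
    have h1 := hω' ⟨G k, .of_nonneg (h0 k)⟩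
    have h2 := hg (-⟨G k, .of_nonneg (h0 k)⟩) _ ⟨k, 1, 0, zero_le_one, le_rfl, by
      rw [Complex.ofReal_one, one_smul, map_zero, AddSubgroup.coe_neg, coe_neg, neg_add_cancel], rfl⟩
    rw [map_neg] at h2
    have h3 := congrArg Complex.re h1
    simp only [Complex.ofReal_re] at h3
    rw [h3]
    linarith
  have h3 := (Complex.continuous_re.tendsto _).comp (hω ω)
  exact absurd (ge_of_tendsto' h3 hge) (by simpa using hδ)

theorem innerMul_star_mul_self (b : A) (m : 𝓜(ℂ, A)) :
    innerMul b (star m * m) = star (m.fst b) * m.fst b := by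
  rw [← coe_inj, coe_innerMul, coe_mul_coe, coe_star, ← mul_coe, star_mul]
  simp only [mul_assoc]

theorem innerMul_mono (b : A) {m m' : 𝓜(ℂ, A)} (h : m ≤ m') : innerMul b m ≤ innerMul b m' := by
  rw [← coe_le_coe, coe_innerMul, coe_innerMul]
  exact star_left_conjugate_le_conjugate h _

/-- A unital column field lives on an increasing sequence of sets of finite measure on which it is
bounded. -/
theorem IsUnitalColumnField.exists_exhaustion [TopologicalSpace.SeparableSpace A]
    {a : T → 𝓜(ℂ, A)} (ha : IsUnitalColumnField μ a) :
    ∃ S : ℕ → Set T, (∀ k, MeasurableSet (S k)) ∧ Monotone S ∧ (∀ k, μ (S k) < ∞) ∧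
      (∀ k, ∀ t ∈ S k, ‖a t‖ ≤ k) ∧ ∀ᵐ t ∂μ, t ∉ ⋃ k, S k → a t = 0 := by
  obtain ⟨ω, hω⟩ := exists_separating_seq (E := A)
  let d := TopologicalSpace.denseSeq A
  have hd : DenseRange d := TopologicalSpace.denseRange_denseSeq A
  have hav : ∀ j, AEStronglyMeasurable (fun t => ‖(a t).fst (d j)‖) μ := fun j =>
    (ha.1.strictlyMeasurable (d j)).1.norm
  let w : ℕ → T → ℂ := fun j t => ω j.unpair.1 (innerMul (d j.unpair.2) (star (a t) * a t))
  have hwi : ∀ j, Integrable (w j) μ := fun j => by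
    refine (ha.2 (ω j.unpair.1 ∘L sandwich (star (d j.unpair.2 : 𝓜(ℂ, A))))).1.congr
      (Eventually.of_forall fun t => ?_)
    dsimp only [w]
    rw [← ext_apply, ext_comp_sandwich, star_star, ← coe_innerMul, ext_coe]
  have hw0 : ∀ t, (∀ j, w j t = 0) → a t = 0 := by
    intro t ht
    have h1 : ∀ l, (a t).fst (d l) = 0 := fun l => by
      rw [← CStarRing.star_mul_self_eq_zero_iff, ← innerMul_star_mul_self]
      refine hω _ fun k => ?_
      have := ht (Nat.pair k l)
      simpa [w] using this
    refine multiplier_ext fun b => ?_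
    exact hd.induction_on b (isClosed_eq (a t).fst.continuous continuous_const) h1
  obtain ⟨T₀, hT₀, hT₀m, hT₀p⟩ := ((ae_all_iff.2 fun j => (hav j).ae_eq_mk).and
    (ae_all_iff.2 fun j => (hwi j).1.ae_eq_mk)).exists_measurable_mem
  let v' := fun j => (hav j).mk
  let w' := fun j => (hwi j).1.mk
  have hv' : ∀ j, Measurable (v' j) := fun j => (hav j).stronglyMeasurable_mk.measurable
  have hw' : ∀ j, Measurable fun t => ‖w' j t‖ := fun j =>
    (hwi j).1.stronglyMeasurable_mk.norm.measurable
  -- the first condition says `‖a t‖ ≤ k`, the second makes the measure finite by Markov's inequality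
  refine ⟨fun k => (T₀ ∩ ⋂ j, {t | v' j t ≤ k * ‖d j‖}) ∩
      ⋃ j ∈ Finset.range (k + 1), {t | 1 / ((k : ℝ) + 1) ≤ ‖w' j t‖}, fun k => ?_, ?_, fun k => ?_,
    fun k t ht => ?_, ?_⟩
  · refine (hT₀m.inter (MeasurableSet.iInter fun j => measurableSet_le (hv' j) measurable_const)).inter
      (Finset.measurableSet_biUnion _ fun j _ => measurableSet_le measurable_const (hw' j))
  · intro k l hkl
    have hkl' : (k : ℝ) ≤ l := by exact_mod_cast hkl
    refine Set.inter_subset_inter (Set.inter_subset_inter_right _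
      (Set.iInter_mono fun j t ht => ?_)) ?_
    · have ht' : v' j t ≤ k * ‖d j‖ := ht
      have h : (k : ℝ) * ‖d j‖ ≤ l * ‖d j‖ := by gcongr
      exact ht'.trans h
    · intro t ht
      simp only [Set.mem_iUnion, Finset.mem_range] at ht ⊢
      obtain ⟨j, hj, h⟩ := ht
      have h' : (1 : ℝ) / (l + 1) ≤ 1 / (k + 1) := by gcongr
      exact ⟨j, by omega, h'.trans h⟩
  · refine (measure_mono Set.inter_subset_right).trans_lt ?_
    refine measure_biUnion_lt_top (Finset.finite_toSet _) fun j _ => ?_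
    exact Integrable.measure_norm_ge_lt_top ((hwi j).congr (hwi j).1.ae_eq_mk) (by positivity)
  · rw [← DoubleCentralizer.norm_fst]
    refine ContinuousLinearMap.opNorm_le_bound _ (Nat.cast_nonneg k) fun b => ?_
    refine hd.induction_on b (isClosed_le (by fun_prop) (by fun_prop)) fun j => ?_
    have h1 : ‖(a t).fst (d j)‖ = v' j t := (hT₀p t ht.1.1).1 j
    exact h1.trans_le (Set.mem_iInter.1 ht.1.2 j)
  · filter_upwards [hT₀] with t ht htS
    refine hw0 t fun j => ?_
    obtain ⟨hv, hw⟩ := hT₀p t ht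
    rw [hw j]
    by_contra hne
    obtain ⟨k₁, hk₁⟩ := exists_nat_one_div_lt (norm_pos_iff.2 hne)
    obtain ⟨k₂, hk₂⟩ := exists_nat_ge ‖a t‖
    set k := max j (max k₁ k₂) with hk
    have hk1 : (k₁ : ℝ) ≤ k := by exact_mod_cast (le_max_left _ _).trans (le_max_right j _)
    have hk2 : (k₂ : ℝ) ≤ k := by exact_mod_cast (le_max_right _ _).trans (le_max_right j _)
    refine htS (Set.mem_iUnion.2 ⟨k, ⟨ht, Set.mem_iInter.2 fun i => ?_⟩, ?_⟩)
    · have h1 : v' i t = ‖(a t).fst (d i)‖ := (hv i).symm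
      change v' i t ≤ k * ‖d i‖
      rw [h1]
      exact (norm_fst_apply_le _ _).trans (by gcongr; linarith)
    · simp only [Set.mem_iUnion, Finset.mem_range]
      refine ⟨j, Nat.lt_succ_of_le (le_max_left _ _), ?_⟩
      refine le_trans ?_ hk₁.le
      gcongr

end Existence

section Compression

variable {A : Type*} [NonUnitalCStarAlgebra A] [PartialOrder A] [StarOrderedRing A]
  {T : Type*} [MeasurableSpace T] {μ : Measure T}

theorem HasWeakStarIntegral.restrict_univ {m : T → 𝓜(ℂ, A)} {J : 𝓜(ℂ, A)}
    (h : HasWeakStarIntegral μ m J) : HasWeakStarIntegral (μ.restrict Set.univ) m J := by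
  rwa [Measure.restrict_univ]

theorem tendsto_setIntegral_of_ae_compl {S : ℕ → Set T} (hS : ∀ k, MeasurableSet (S k))
    (hmono : Monotone S) {h : T → ℂ} (hi : Integrable h μ)
    (h0 : ∀ᵐ t ∂μ, t ∉ ⋃ k, S k → h t = 0) :
    Tendsto (fun k => ∫ t in S k, h t ∂μ) atTop (𝓝 (∫ t, h t ∂μ)) := by
  rw [← setIntegral_eq_integral_of_ae_compl_eq_zero h0]
  exact tendsto_setIntegral_of_monotone hS hmono hi.integrableOn

/-- For `0 ≤ D ≤ c` one has `D² ≤ c D`. -/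
theorem mul_self_le_smul {D : 𝓜(ℂ, A)} {c : ℝ} (h0 : 0 ≤ D) (h : D ≤ (c : ℂ) • 1) :
    star D * D ≤ (c : ℂ) • D := by
  set s := CFC.sqrt D
  have hs : star s = s := isSelfAdjoint_sqrt D
  have hss : s * s = D := CFC.sqrt_mul_sqrt_self D h0
  have h1 := star_left_conjugate_le_conjugate h s
  rw [hs, mul_smul_comm, mul_one, smul_mul_assoc, hss] at h1
  calc star D * D = s * D * s := by
        rw [(IsSelfAdjoint.of_nonneg h0).star_eq]
        nth_rw 1 [← hss]
        rw [mul_assoc s s D, mul_assoc s D s]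
        congr 1
        rw [← hss, mul_assoc]
    _ ≤ _ := h1

theorem norm_le_of_nonneg_of_le_smul {D : 𝓜(ℂ, A)} {c : ℝ} (hc : 0 ≤ c) (h0 : 0 ≤ D)
    (h : D ≤ (c : ℂ) • 1) : ‖D‖ ≤ c := by
  rw [CStarAlgebra.norm_le_iff_le_algebraMap _ hc h0, algebraMap_eq_smul]
  exact h

theorem innerMul_smul (b : A) (c : ℂ) (m : 𝓜(ℂ, A)) : innerMul b (c • m) = c • innerMul b m := by
  simp [innerMul, mul_smul_comm]

/-- A sequence of self-adjoint multipliers that converges pointwise has a multiplier as its limit. -/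
theorem exists_strict_limit {F : ℕ → 𝓜(ℂ, A)} (hsa : ∀ k, star (F k) = F k)
    (h : ∀ b, ∃ c, Tendsto (fun k => (F k).fst b) atTop (𝓝 c)) :
    ∃ F₀ : 𝓜(ℂ, A), ∀ b, Tendsto (fun k => (F k).fst b) atTop (𝓝 (F₀.fst b)) := by
  choose L hL using h
  have hsnd : ∀ k b, (F k).snd b = star ((F k).fst (star b)) := fun k b => by
    rw [star_fst_apply, star_star, hsa]
  have hR : ∀ b, Tendsto (fun k => (F k).snd b) atTop (𝓝 (star (L (star b)))) := fun b => by
    simp only [hsnd]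
    exact (continuous_star.tendsto _).comp (hL (star b))
  let L' : A →L[ℂ] A := continuousLinearMapOfTendsto (fun k => (F k).fst) (tendsto_pi_nhds.2 hL)
  let R' : A →L[ℂ] A := continuousLinearMapOfTendsto (fun k => (F k).snd) (tendsto_pi_nhds.2 hR)
  exact ⟨⟨(L', R'), fun b c => tendsto_nhds_unique ((hR b).mul_const c)
    (((hL c).const_mul b).congr fun k => ((F k).central b c).symm)⟩, hL⟩

/-- If the column `a` is unital and the field `g` is bounded, positive and measurable, then
`∫ a⋆ g a` exists: the partial integrals over an exhaustion by sets of finite measure converge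
strictly, since `∫ b⋆ a⋆ a b` over the complements decreases to `0` in norm for every `b` in the
algebra. -/
theorem exists_integral_conj_of_nonneg [TopologicalSpace.SeparableSpace A] {a : T → 𝓜(ℂ, A)}
    (ha : IsUnitalColumnField μ a) {g : T → 𝓜(ℂ, A)} (hg : StrictlyMeasurable μ g)
    (hg0 : ∀ t, 0 ≤ g t) {c : ℝ} (hc : 0 ≤ c) (hgc : ∀ t, g t ≤ (c : ℂ) • 1) :
    ∃ F : 𝓜(ℂ, A), HasWeakStarIntegral μ (fun t => star (a t) * g t * a t) F := by
  obtain ⟨S, hS, hmono, hfin, hbd, hcompl⟩ := ha.exists_exhaustion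
  have ham : StrictlyMeasurable μ a := ha.1.strictlyMeasurable
  set M : T → 𝓜(ℂ, A) := fun t => star (a t) * g t * a t with hM
  set Q : T → 𝓜(ℂ, A) := fun t => star (a t) * a t with hQ
  have hMm : StrictlyMeasurable μ M := (ham.star.mul hg).mul ham
  have hQm : StrictlyMeasurable μ Q := ham.star.mul ham
  have hM0 : ∀ t, 0 ≤ M t := fun t => star_left_conjugate_nonneg (hg0 t) _
  have hQ0 : ∀ t, 0 ≤ Q t := fun t => star_mul_self_nonneg _
  have hMQ : ∀ t, M t ≤ (c : ℂ) • Q t := fun t => by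
    have := star_left_conjugate_le_conjugate (hgc t) (a t)
    rwa [mul_smul_comm, mul_one, smul_mul_assoc] at this
  have hrestr : ∀ {m : T → 𝓜(ℂ, A)} (_ : StrictlyMeasurable μ m) k,
      StrictlyMeasurable (μ.restrict (S k)) m := fun hm k b => ⟨(hm b).1.restrict, (hm b).2.restrict⟩
  have hQn : ∀ k, ∀ t ∈ S k, ‖Q t‖ ≤ (k : ℝ) * k := fun k t ht => by
    rw [hQ]; dsimp only
    rw [CStarRing.norm_star_mul_self]
    have := hbd k t ht
    gcongr
  have hMn : ∀ k, ∀ t ∈ S k, ‖M t‖ ≤ c * ((k : ℝ) * k) := fun k t ht => by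
    refine (CStarAlgebra.norm_le_norm_of_nonneg_of_le (hM0 t) (hMQ t)).trans ?_
    rw [norm_smul, Complex.norm_real, Real.norm_of_nonneg hc]
    exact mul_le_mul_of_nonneg_left (hQn k t ht) hc
  have hex : ∀ k, (∃ N, HasWeakStarIntegral (μ.restrict (S k)) Q N) ∧
      ∃ F, HasWeakStarIntegral (μ.restrict (S k)) M F := fun k => by
    have : IsFiniteMeasure (μ.restrict (S k)) := ⟨by rw [Measure.restrict_apply_univ]; exact hfin k⟩
    exact ⟨exists_integral_of_bounded (hrestr hQm k) ((ae_restrict_iff' (hS k)).2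
        (Eventually.of_forall (hQn k))),
      exists_integral_of_bounded (hrestr hMm k) ((ae_restrict_iff' (hS k)).2
        (Eventually.of_forall (hMn k)))⟩
  choose N hN using fun k => (hex k).1
  choose F hF using fun k => (hex k).2
  have hF0 : ∀ k, 0 ≤ F k := fun k => (hF k).nonneg hM0
  have hFmono : Monotone F := fun k l hkl =>
    sub_nonneg.1 (((hF k).diff (hS k) (hmono hkl) (hF l)).nonneg hM0)
  have hNmono : Monotone N := fun k l hkl =>
    sub_nonneg.1 (((hN k).diff (hS k) (hmono hkl) (hN l)).nonneg hQ0)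
  have hN1 : ∀ k, N k ≤ 1 := fun k => sub_nonneg.1
    (((hN k).diff (hS k) (Set.subset_univ _) ha.2.restrict_univ).nonneg hQ0)
  have hN0 : ∀ k, 0 ≤ N k := fun k => (hN k).nonneg hQ0
  have hFN : ∀ k, F k ≤ (c : ℂ) • N k := fun k => sub_nonneg.1
    ((((hN k).smul (c : ℂ)).sub (hF k)).nonneg fun t => sub_nonneg.2 (hMQ t))
  have hFNd : ∀ k l, k ≤ l → F l - F k ≤ (c : ℂ) • (N l - N k) := fun k l hkl => by
    have h1 := (((hN k).diff (hS k) (hmono hkl) (hN l)).smul (c : ℂ)).sub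
      ((hF k).diff (hS k) (hmono hkl) (hF l))
    exact sub_nonneg.1 (h1.nonneg fun t => sub_nonneg.2 (hMQ t))
  have hFnorm : ∀ k, ‖F k‖ ≤ c := fun k =>
    norm_le_of_nonneg_of_le_smul hc (hF0 k) ((hFN k).trans (smul_le_smul_coe hc (hN1 k)))
  have hQcompl : ∀ ω : A →L[ℂ] ℂ, ∀ᵐ t ∂μ, t ∉ ⋃ k, S k → ext ω (Q t) = 0 := fun ω => by
    filter_upwards [hcompl] with t ht htS
    rw [hQ]; dsimp only
    rw [ht htS, mul_zero, map_zero]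
  have hMcompl : ∀ ω : A →L[ℂ] ℂ, ∀ᵐ t ∂μ, t ∉ ⋃ k, S k → ext ω (M t) = 0 := fun ω => by
    filter_upwards [hcompl] with t ht htS
    rw [hM]; dsimp only
    rw [ht htS, mul_zero, map_zero]
  -- the tails of `∫ b⋆ a⋆ a b` converge to `0` in norm
  have hG : ∀ b : A, Tendsto (fun k => innerMul b (1 - N k)) atTop (𝓝 0) := fun b => by
    refine tendsto_zero_of_antitone (fun k => ?_) (fun k l hkl => ?_) fun ω => ?_
    · exact multiplier_nonneg_iff.1 (sub_nonneg.2 (hN1 k)) b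
    · exact innerMul_mono b (sub_le_sub_left (hNmono hkl) 1)
    · set ω' := posConj ω (star (b : 𝓜(ℂ, A)))
      have h1 : ∀ k, ω (innerMul b (1 - N k)) = ext (posCLM ω') 1 - ext (posCLM ω') (N k) := by
        intro k
        rw [← map_sub, ext_posConj, star_star, ← coe_innerMul, ext_coe, posCLM_apply]
      have h2 := tendsto_setIntegral_of_ae_compl hS hmono (ha.2 (posCLM ω')).1
        (hQcompl (posCLM ω'))
      rw [(ha.2 (posCLM ω')).2] at h2
      have h3 := h2.const_sub (ext (posCLM ω') 1)
      rw [ext_apply, sub_self] at h3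
      refine h3.congr fun k => ?_
      rw [h1, ext_apply, ext_apply, (hN k (posCLM ω')).2]
  have hdist : ∀ (b : A) k l, k ≤ l → dist ((F k).fst b) ((F l).fst b)
      ≤ √(c * c * ‖innerMul b (1 - N k)‖) := fun b k l hkl => by
    rw [dist_comm, dist_eq_norm]
    refine Real.le_sqrt_of_sq_le ?_
    have hD0 : 0 ≤ F l - F k := sub_nonneg.2 (hFmono hkl)
    have hD1 : F l - F k ≤ (c : ℂ) • (1 - N k) := (hFNd k l hkl).trans
      (smul_le_smul_coe hc (sub_le_sub_right (hN1 l) _))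
    have hD2 : F l - F k ≤ (c : ℂ) • 1 := hD1.trans
      (smul_le_smul_coe hc (sub_le_self _ (hN0 k)))
    have h1 : innerMul b (star (F l - F k) * (F l - F k))
        ≤ ((c * c : ℝ) : ℂ) • innerMul b (1 - N k) := by
      rw [← innerMul_smul]
      refine innerMul_mono b ((mul_self_le_smul hD0 hD2).trans ?_)
      rw [Complex.ofReal_mul, mul_smul]
      exact smul_le_smul_coe hc hD1
    rw [innerMul_star_mul_self] at h1
    have h2 := CStarAlgebra.norm_le_norm_of_nonneg_of_le (star_mul_self_nonneg _) h1
    rw [CStarRing.norm_star_mul_self, norm_smul, Complex.norm_real,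
      Real.norm_of_nonneg (mul_nonneg hc hc), ← pow_two] at h2
    simpa using h2
  obtain ⟨F₀, hF₀⟩ := exists_strict_limit (fun k => (IsSelfAdjoint.of_nonneg (hF0 k)).star_eq)
    fun b => by
      refine cauchySeq_tendsto_of_complete (cauchySeq_of_le_tendsto_0'
        (fun k => √(c * c * ‖innerMul b (1 - N k)‖)) (hdist b) ?_)
      have := ((hG b).norm.const_mul (c * c)).sqrt
      simpa using this
  refine ⟨F₀, fun ω => ?_⟩
  induction ω using functional_induction with
  | hpos ω =>
    have hint : Integrable (fun t => extFunctional (posCLM ω) (M t)) μ := by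
      refine ((ha.2 (posCLM ω)).1.const_mul (c : ℂ)).mono (hMm.ext (posCLM ω))
        (Eventually.of_forall fun t => ?_)
      refine CStarAlgebra.norm_le_norm_of_nonneg_of_le (ext_nonneg ω (hM0 t)) ?_
      exact (ext_mono ω (hMQ t)).trans_eq (map_smul (ext (posCLM ω)) _ _)
    refine ⟨hint, ?_⟩
    have h1 := tendsto_setIntegral_of_ae_compl hS hmono hint (hMcompl (posCLM ω))
    refine tendsto_nhds_unique h1 ?_
    refine (tendsto_ext_of_strict (posCLM ω) (K := c) (Eventually.of_forall hFnorm) hF₀).congr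
      fun k => ?_
    exact (hF k (posCLM ω)).2.symm
  | hadd ω ω' h h' =>
    have e : ∀ m : 𝓜(ℂ, A), extFunctional (ω + ω') m = extFunctional ω m + extFunctional ω' m :=
      fun m => ext_add ω ω' m
    simp only [e]
    exact ⟨h.1.add h'.1, by rw [integral_add h.1 h'.1, h.2, h'.2]⟩
  | hsmul r ω h =>
    have e : ∀ m : 𝓜(ℂ, A), extFunctional (r • ω) m = r * extFunctional ω m :=
      fun m => ext_smul r ω m
    simp only [e]
    exact ⟨h.1.const_mul r, by rw [integral_const_mul, h.2]⟩

/-- Bounded self-adjoint measurable fields can be integrated against a unital column. -/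
theorem exists_integral_conj [TopologicalSpace.SeparableSpace A] {a : T → 𝓜(ℂ, A)}
    (ha : IsUnitalColumnField μ a) {g : T → 𝓜(ℂ, A)} (hg : StrictlyMeasurable μ g)
    (hsa : ∀ t, IsSelfAdjoint (g t)) {R : ℝ} (hR : ∀ t, ‖g t‖ ≤ R) :
    ∃ F : 𝓜(ℂ, A), HasWeakStarIntegral μ (fun t => star (a t) * g t * a t) F := by
  have hR' : ∀ t, ‖g t‖ ≤ |R| := fun t => (hR t).trans (le_abs_self R)
  have h0 : ∀ t, 0 ≤ g t + ((|R| : ℝ) : ℂ) • 1 := fun t => by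
    rw [← algebraMap_eq_smul]
    have h1 := (hsa t).neg_algebraMap_norm_le_self
    have h2 := algebraMap_mono (A := A) (hR' t)
    have h3 := add_le_add h1 h2
    rwa [neg_add_cancel] at h3
  have h1 : ∀ t, g t + ((|R| : ℝ) : ℂ) • 1 ≤ ((2 * |R| : ℝ) : ℂ) • 1 := fun t => by
    rw [← algebraMap_eq_smul, ← algebraMap_eq_smul, two_mul, map_add]
    exact add_le_add ((hsa t).le_algebraMap_norm_self.trans (algebraMap_mono (hR' t))) le_rfl
  obtain ⟨F, hF⟩ := exists_integral_conj_of_nonneg ha (hg.add (StrictlyMeasurable.const _)) h0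
    (by positivity) h1
  refine ⟨F - ((|R| : ℝ) : ℂ) • 1, ?_⟩
  have h := hF.sub (ha.integral_const ((|R| : ℝ) : ℂ))
  rw [← column_sub] at h
  simpa only [add_sub_cancel_right] using h

end Compression

end JensenCStar

end

theorem corollary12 {A : Type*} [NonUnitalCStarAlgebra A] [PartialOrder A] [StarOrderedRing A]
    {T : Type*} [MeasurableSpace T] (μ : Measure T) (n : ℕ)
    -- a continuous convex function on a product of intervals
    (I : Fin n → Set ℝ) (hI : ∀ i, (I i).OrdConnected)
    (f : (Fin n → ℝ) → ℝ) (hf_cont : ContinuousOn f (Set.univ.pi I))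
    (hf_conv : ConvexOn ℝ (Set.univ.pi I) f)
    -- mutually commuting C⋆-subalgebras
    (B : Fin n → NonUnitalStarSubalgebra ℂ A) (hB_closed : ∀ i, IsClosed (B i : Set A))
    (hB_comm : ∀ i j, i ≠ j → ∀ b ∈ B i, ∀ c ∈ B j, b * c = c * b)
    -- bounded weak⋆ measurable fields of self-adjoint elements of `B i` with spectra in `I i`
    (x : Fin n → T → A) (hx_mem : ∀ i t, x i t ∈ B i) (hx_sa : ∀ i t, IsSelfAdjoint (x i t))
    (hx_spec : ∀ i t, spectrum ℝ (x i t : 𝓜(ℂ, A)) ⊆ I i)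
    (hx_bdd : ∃ R : ℝ, ∀ i t, ‖x i t‖ ≤ R)
    (hx_meas : ∀ i, JensenCStar.WeakStarMeasurable μ fun t => (x i t : 𝓜(ℂ, A)))
    -- a unital column field in the multiplier algebra
    (a : T → 𝓜(ℂ, A)) (ha : JensenCStar.IsUnitalColumnField μ a)
    -- the integrals `y i` form an abelian tuple in `A`
    (y : Fin n → A)
    (hy : ∀ i, JensenCStar.HasWeakStarIntegral μ
      (fun t => star (a t) * (x i t : 𝓜(ℂ, A)) * a t) (y i : 𝓜(ℂ, A)))
    (hy_comm : ∀ i j, y i * y j = y j * y i) :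
    -- `f(y)` is defined
    (∀ i, spectrum ℝ (y i : 𝓜(ℂ, A)) ⊆ I i) ∧
    -- the integral of `a_t⋆ f(x_t) a_t` exists
    (TopologicalSpace.SeparableSpace A →
      (∃ R : ℝ, ∀ t, ‖JensenCStar.jointCfc (fun i => (x i t : 𝓜(ℂ, A))) f‖ ≤ R) →
      ∃ F : 𝓜(ℂ, A), JensenCStar.HasWeakStarIntegral μ
        (fun t => star (a t) * JensenCStar.jointCfc (fun i => (x i t : 𝓜(ℂ, A))) f * a t) F) ∧
    -- the Jensen inequality
    (∀ F : 𝓜(ℂ, A), JensenCStar.HasWeakStarIntegral μ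
        (fun t => star (a t) * JensenCStar.jointCfc (fun i => (x i t : 𝓜(ℂ, A))) f * a t) F →
      (∀ φ : A →ₚ[ℂ] ℂ, (∀ i, JensenCStar.InCentralizer φ (y i)) →
        JensenCStar.extFunctional φ
            (JensenCStar.jointCfc (fun i => (y i : 𝓜(ℂ, A))) f) ≤
          JensenCStar.extFunctional φ F) ∧
      (∀ φ : A → ℝ≥0∞, JensenCStar.IsUnboundedFunctional φ →
        (∀ p ∈ Set.univ.pi I, 0 ≤ f p) →
        (∀ i, JensenCStar.InUnboundedCentralizer φ (y i)) →
        JensenCStar.extUnbounded φ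
            (JensenCStar.jointCfc (fun i => (y i : 𝓜(ℂ, A))) f) ≤
          JensenCStar.extUnbounded φ F)) := by
  have hB : ∀ t i j, x i t * x j t = x j t * x i t := fun t i j => by
    rcases eq_or_ne i j with rfl | hij
    · rfl
    · exact hB_comm i j hij _ (hx_mem i t) _ (hx_mem j t)
  have hxsa : ∀ t i, IsSelfAdjoint (x i t : 𝓜(ℂ, A)) := fun t i =>
    JensenCStar.isSelfAdjoint_coe.2 (hx_sa i t)
  have hxc : ∀ t i j, (x i t : 𝓜(ℂ, A)) * x j t = x j t * x i t := fun t i j => by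
    rw [← JensenCStar.coe_mul_coe, ← JensenCStar.coe_mul_coe, hB]
  obtain ⟨R, hR⟩ := hx_bdd
  have hysa : ∀ i, IsSelfAdjoint (y i) := fun i => JensenCStar.isSelfAdjoint_coe.1
    (JensenCStar.isSelfAdjoint_of_integral ha (hx_sa i) ⟨R, hR i⟩ (hy i))
  have hspec : ∀ i, spectrum ℝ (y i : 𝓜(ℂ, A)) ⊆ I i := fun i =>
    JensenCStar.spectrum_integral_subset (hI i) ha (hx_sa i) (hx_spec i) (hysa i) (hy i)
  have hxC : ∀ t, JensenCStar.spectralBox (fun i => (x i t : 𝓜(ℂ, A))) ⊆ Set.univ.pi I := fun t =>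
    Set.pi_mono fun i _ => hx_spec i t
  have hyC : JensenCStar.spectralBox (fun i => (y i : 𝓜(ℂ, A))) ⊆ Set.univ.pi I :=
    Set.pi_mono fun i _ => hspec i
  refine ⟨hspec, ?_, fun F hF => ⟨fun φ hφ => ?_, fun φ hφ hf0 hcen => ?_⟩⟩
  · rintro hsep ⟨K, hK⟩
    have hm : JensenCStar.StrictlyMeasurable μ
        fun t => JensenCStar.jointCfc (fun i => (x i t : 𝓜(ℂ, A))) f :=
      JensenCStar.strictlyMeasurable_jointCfc hxsa hxc
        ⟨R, fun t i => by rw [JensenCStar.norm_coe]; exact hR i t⟩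
        (fun i => (hx_meas i).strictlyMeasurable) hI (fun t i => hx_spec i t) hf_cont
    exact JensenCStar.exists_integral_conj ha hm
      (fun t => JensenCStar.jointCfc_isSelfAdjoint (hxsa t) (hxc t) (hf_cont.mono (hxC t))) hK
  · exact JensenCStar.jensen_bounded ha hxsa hxc hysa hy_comm hy hxC hyC hf_cont hf_conv hF φ hφ
  · exact JensenCStar.jensen_unbounded ha hxsa hxc hysa hy_comm hy hxC hyC hf_cont hf_conv hf0 hF
      hφ hcen
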